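/- Let $(X_i)_{i\in\mathbb Z}$ be a second-order stationary sequence of centered, square-integrable real random variables on a probability space $(\Omega,\mathcal A,\mathbb P)$ (that is, $\mathrm{Cov}(X_i,X_{i+k})=\mathrm{Cov}(X_0,X_k)$ for all $i,k\in\mathbb Z$). For a sub-$\sigma$-algebra $\mathcal M\subset\mathcal A$ and an integrable real random variable $Z$, put $$\tau(\mathcal M,Z)=\Big\|\sup_{f}\Big|\int f\,d\mathbb P_{Z|\mathcal M}-\int f\,d\mathbb P_Z\Big|\Big\|_1,$$ where $f$ runs over the $1$-Lipschitz functions $\mathbb R\to\mathbb R$, $\mathbb P_{Z|\mathcal M}$ is a conditional distribution of $Z$ given $\mathcal M$, and $\mathbb P_Z$ is the distribution of $Z$. For an integrable random vector $Y$ in $\mathbb R^\ell$ let $\tau(\mathcal M,Y)=\sup_f\tau(\mathcal M,f(Y))$, where $f$ runs over the functions $\mathbb R^\ell\to\mathbb R$ that are $1$-Lipschitz for the distance $\sum_{i=1}^{\ell}|x_i-y_i|$. With $\mathcal M_p=\sigma(X_j,\,j\le p)$, let $$\tau_k(i)=\max_{1\le\ell\le k}\frac1\ell\sup\big\{\tau(\mathcal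 M_p,(X_{j_1},\dots,X_{j_\ell})):\ p\in\mathbb Z,\ p+i\le j_1<\dots<j_\ell\big\},\qquad \tau(i)=\sup_{k\ge0}\tau_k(i).$$ Assume that there are constants $c>0$, $\gamma_1>0$ and $\gamma_2\in(0,\infty]$ such that $$\tau([x])\le\exp(-cx^{\gamma_1})\ \text{ for all real } x\ge1,\qquad \sup_{k>0}\mathbb P(|X_k|>t)\le\exp(1-t^{\gamma_2})\ \text{ for all } t>0$$ (for $\gamma_2=\infty$ the second condition means that $\|X_k\|_\infty\le1$ for all $k>0$), and that $\gamma<1$, where $1/\gamma=1/\gamma_1+1/\gamma_2$ (with $1/\infty=0$). Let $S_n=X_1+\dots+X_n$ and assume that $\mathrm{Var}\,S_n\to\infty$. Then there is $\sigma>0$ such that $\lim_{n\to\infty}\mathrm{Var}(S_n)/n=\sigma^2$. The function $I(t)=t^2/(2\sigma^2)$ is a good rate function (lower semicontinuous with compact level sets $\{I\le r\}$). For every positive sequence $(a_n)_{n\ge1}$ with $a_n\to0$ and $a_nn^{\gamma/(2-\gamma)}\to\infty$, the sequence $T_n=n^{-1/2}S_n$ satisfies the moderate deviation principle with speed $a_n$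 and rate function $I$: for every Borel set $A\subset\mathbb R$, $$-\inf_{t\in A^{o}}I(t)\le\liminf_{n\to\infty}a_n\log\mathbb P(\sqrt{a_n}\,T_n\in A)\le\limsup_{n\to\infty}a_n\log\mathbb P(\sqrt{a_n}\,T_n\in A)\le-\inf_{t\in\bar A}I(t),$$ where $A^{o}$ and $\bar A$ are the interior and the closure of $A$, $\log 0=-\infty$ and $\inf\emptyset=+\infty$. -/

import Mathlib

open MeasureTheory ProbabilityTheory Filter Topology
open scoped ENNReal NNReal

/-- The conditional distribution `P_{Z | m}` of a real random variable `Z` given a sub-σ-algebra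
`m` of the ambient one, as a map from `Ω` to measures on `ℝ` (the identity of `Ω` is regarded as a
random variable with values in the measurable space `(Ω, m)`). -/
noncomputable def condLaw {Ω : Type*} (m : MeasurableSpace Ω) {mΩ : MeasurableSpace Ω}
    (μ : Measure Ω) [IsFiniteMeasure μ] (Z : Ω → ℝ) (ω : Ω) : Measure ℝ :=
  @condDistrib Ω Ω ℝ _ _ _ mΩ m Z id μ _ ω

/-- The coefficient `τ(m, Z)` of an integrable real random variable `Z`: the `L¹`-norm of
`sup_f |∫ f dP_{Z|m} - ∫ f dP_Z|`, the supremum being over the 1-Lipschitz functions. -/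
noncomputable def tauReal {Ω : Type*} (m : MeasurableSpace Ω) {mΩ : MeasurableSpace Ω}
    (μ : Measure Ω) [IsFiniteMeasure μ] (Z : Ω → ℝ) : ℝ≥0∞ :=
  ∫⁻ ω, ⨆ (f : ℝ → ℝ) (_ : LipschitzWith 1 f),
    ENNReal.ofReal |∫ x, f x ∂(condLaw m μ Z ω) - ∫ x, f x ∂(μ.map Z)| ∂μ

/-- 1-Lipschitz functions on `ℝ^ℓ` with respect to the distance `∑ i, |x i - y i|`. -/
def IsLipOne {l : ℕ} (f : (Fin l → ℝ) → ℝ) : Prop :=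
  ∀ x y : Fin l → ℝ, |f x - f y| ≤ ∑ i, |x i - y i|

/-- The coefficient `τ(m, Y)` of an integrable random vector `Y`: the supremum of `τ(m, f(Y))`
over the 1-Lipschitz functions `f : ℝ^ℓ → ℝ`. -/
noncomputable def tauVec {Ω : Type*} (m : MeasurableSpace Ω) {mΩ : MeasurableSpace Ω}
    (μ : Measure Ω) [IsFiniteMeasure μ] {l : ℕ} (Y : Ω → Fin l → ℝ) : ℝ≥0∞ :=
  ⨆ (f : (Fin l → ℝ) → ℝ) (_ : IsLipOne f), tauReal m μ (fun ω => f (Y ω))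

/-- The past σ-algebra `σ(X_j, j ≤ p)`. -/
abbrev pastSigma {Ω : Type*} (X : ℤ → Ω → ℝ) (p : ℤ) : MeasurableSpace Ω :=
  ⨆ (j : ℤ) (_ : j ≤ p), MeasurableSpace.comap (X j) inferInstance

/-- `τ_k(i) = max_{1 ≤ ℓ ≤ k} ℓ⁻¹ sup τ(σ(X_j, j ≤ p), (X_{j_1}, …, X_{j_ℓ}))`, the supremum
being over all integers `p` and `p + i ≤ j_1 < ⋯ < j_ℓ`. -/
noncomputable def tauMixK {Ω : Type*} {mΩ : MeasurableSpace Ω} (μ : Measure Ω) [IsFiniteMeasure μ]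
    (X : ℤ → Ω → ℝ) (k i : ℕ) : ℝ≥0∞ :=
  ⨆ (l : ℕ) (_ : 1 ≤ l) (_ : l ≤ k), (l : ℝ≥0∞)⁻¹ *
    ⨆ (p : ℤ) (j : Fin l → ℤ) (_ : StrictMono j) (_ : ∀ s, p + (i : ℤ) ≤ j s),
      tauVec (pastSigma X p) μ (fun ω s => X (j s) ω)

/-- The τ-mixing coefficient `τ(i) = sup_k τ_k(i)` of the sequence `X`. -/
noncomputable def tauMix {Ω : Type*} {mΩ : MeasurableSpace Ω} (μ : Measure Ω) [IsFiniteMeasure μ]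
    (X : ℤ → Ω → ℝ) (i : ℕ) : ℝ≥0∞ :=
  ⨆ k : ℕ, tauMixK μ X k i

/-- The tail condition of order `g ∈ (0, ∞]`: `P(|X_k| > t) ≤ exp(1 - t^g)` for all `k > 0` and
`t > 0`; for `g = ∞` it means that `‖X_k‖_∞ ≤ 1` for all `k > 0`. -/
def TailCondition {Ω : Type*} {mΩ : MeasurableSpace Ω} (μ : Measure Ω) (X : ℤ → Ω → ℝ)
    (g : ℝ≥0∞) : Prop :=
  (g ≠ ∞ → ∀ k : ℤ, 0 < k → ∀ t : ℝ, 0 < t →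
    μ {ω | t < |X k ω|} ≤ ENNReal.ofReal (Real.exp (1 - t ^ g.toReal))) ∧
  (g = ∞ → ∀ k : ℤ, 0 < k → ∀ᵐ ω ∂μ, |X k ω| ≤ 1)

/-- Second-order (weak) stationarity: square integrable, with constant mean and with covariances
that depend on the lag only. -/
def SecondOrderStationary {Ω : Type*} {mΩ : MeasurableSpace Ω} (μ : Measure Ω)
    (X : ℤ → Ω → ℝ) : Prop :=
  (∀ i, MemLp (X i) 2 μ) ∧ (∀ i, ∫ ω, X i ω ∂μ = ∫ ω, X 0 ω ∂μ) ∧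
  (∀ i k : ℤ, covariance (X i) (X (i + k)) μ = covariance (X 0) (X k) μ)

/-- `S_n = X_1 + ⋯ + X_n`. -/
noncomputable def partialSum {Ω : Type*} (X : ℤ → Ω → ℝ) (n : ℕ) (ω : Ω) : ℝ :=
  ∑ i ∈ Finset.Icc (1 : ℕ) n, X (i : ℤ) ω

/-- A good rate function: lower semicontinuous with compact level sets. -/
def IsGoodRateFunction (I : ℝ → ℝ≥0∞) : Prop :=
  LowerSemicontinuous I ∧ ∀ r : ℝ≥0, IsCompact {t : ℝ | I t ≤ r}

/-- The moderate deviation principle for `(T_n)` with speed `a_n` and rate function `I`, in the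
extended reals (`log 0 = -∞`, and an infimum over the empty set is `+∞`). -/
def SatisfiesMDP {Ω : Type*} {mΩ : MeasurableSpace Ω} (μ : Measure Ω) (T : ℕ → Ω → ℝ)
    (a : ℕ → ℝ) (I : ℝ → ℝ≥0∞) : Prop :=
  ∀ A : Set ℝ, MeasurableSet A →
    -((⨅ t ∈ interior A, I t : ℝ≥0∞) : EReal) ≤
        liminf (fun n => (a n : EReal) * ENNReal.log (μ {ω | √(a n) * T n ω ∈ A})) atTop ∧
    limsup (fun n => (a n : EReal) * ENNReal.log (μ {ω | √(a n) * T n ω ∈ A})) atTop ≤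
        -((⨅ t ∈ closure A, I t : ℝ≥0∞) : EReal)

/-! Moderate deviations for partial sums of a `τ`-mixing sequence with stretched exponential tails.

The hypotheses are first put in a uniform shape (`StretchedMixing`): with `r = 1 / γ₂`, the tails
satisfy `P(|ξ_i| > s ^ r) ≤ exp(1 - s)`, and `τ`-mixing says that in the expectation of a function
that is Lipschitz in a block sum, a block at distance `d` from the past may be replaced by an
independent copy at a cost of order `exp(-c d ^ g)`, where `g = γ₁` (`stretchedMixing_of_tauMix`).
Covariances then decay so fast that the variance of a sum of `l` terms is `l σ² + O(1)`
(`exists_abs_sumVar_sub_le`); as it tends to infinity, `σ² > 0`.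

The heart of the matter is a Gaussian asymptotic for the log-Laplace transform of a truncated block
of length `p`, in the range of parameters that the moderate deviations call for. Exponentials of
long sums are too large to be decoupled directly, so this is obtained by a recursion over scales.
A block of length `l` is cut into two halves separated by a gap; Hölder's inequality with the
weight `w = (gap / l) ^ κ` removes the gap, mixing decouples the halves, and the truncation level is
lowered to one adapted to the shorter length. The range `|u| ≤ U (p / l) ^ κ` is stable under this
operation, the variance constant changes by a factor `1 + O(w)`, and the weights of all the scales
sum to something small. At the lowest scale `u S` is uniformly small and the Taylor expansion of
the exponential gives `u² Var(S) / 2`. A first pass gives a bound of order `u² l`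
(`ScaleData.logLaplace_le`), which is then used for the gaps in the sharp upper and lower bounds
(`ScaleData.logLaplace_le_sharp`, `ScaleData.le_logLaplace_sharp`).

For the speed `a_n`, put `b = 1 / a_n` and `x = √(n b)`, the scale of the deviations. The assumption
on `a_n` says exactly that `ω = x ^ γ / b` tends to infinity, and there is room to choose
`D = b √ω`, gaps of length `q = D ^ (1 / g)` and blocks of length `p = q ω ^ κ`: the probability that
the truncation at `D ^ r` has an effect and the mixing coefficient of the gaps are negligible at the
speed `b`, and the recursion applies (`StretchedMixing.exists_blockRegime`).

The sum of the blocks is compared with its version with independent blocks through Lipschitz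
approximations of indicator functions (`StretchedMixing.measureReal_blockSum_le`). For the
independent version, Chernoff's inequality gives the upper bounds and exponential tilting the lower
bounds (`half_exp_le_measureReal_ball`). The gaps, the last incomplete block and the truncation are
superexponentially small by the crude bound, and the bounds for half-lines and balls yield the
principle for all Borel sets (`satisfiesMDP_of_expLe`), as the rate function is quadratic.
-/

set_option linter.unusedSectionVars false

/-! ### The coefficient `τ` and decoupling -/

/-- Disintegration: the expectation of `Φ(W(X), Y)` is computed by integrating first with respect to
the conditional law of `Y` given `X`. -/
lemma integral_comp_condDistrib {Ω β : Type*} {mΩ : MeasurableSpace Ω} {mβ : MeasurableSpace β}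
    (μ : Measure Ω) [IsProbabilityMeasure μ] {X : Ω → β} (hX : Measurable X) {Y : Ω → ℝ}
    (hY : Measurable Y) {W : β → ℝ} (hW : Measurable W) {Φ : ℝ → ℝ → ℝ}
    (hΦ : Measurable (Function.uncurry Φ)) {B : ℝ} (hB : ∀ w y, |Φ w y| ≤ B) :
    Integrable (fun ω => ∫ y, Φ (W (X ω)) y ∂(condDistrib Y X μ (X ω))) μ ∧
    ∫ ω, Φ (W (X ω)) (Y ω) ∂μ = ∫ ω, ∫ y, Φ (W (X ω)) y ∂(condDistrib Y X μ (X ω)) ∂μ := by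
  set F : β × ℝ → ℝ := fun q => Φ (W q.1) q.2 with hF
  have hFm : Measurable F := hΦ.comp ((hW.comp measurable_fst).prodMk measurable_snd)
  have hprob : IsProbabilityMeasure (μ.map X) := Measure.isProbabilityMeasure_map hX.aemeasurable
  have hint : Integrable F (μ.map X ⊗ₘ condDistrib Y X μ) :=
    Integrable.of_bound hFm.aestronglyMeasurable B (ae_of_all _ fun q => hB _ _)
  have h1 : ∫ ω, Φ (W (X ω)) (Y ω) ∂μ = ∫ q, F q ∂(μ.map (fun a => (X a, Y a))) := by
    rw [integral_map (hX.prodMk hY).aemeasurable hFm.aestronglyMeasurable]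
  have hi : Integrable (fun x => ∫ y, F (x, y) ∂(condDistrib Y X μ x)) (μ.map X) :=
    hint.integral_compProd
  constructor
  · exact hi.comp_measurable hX
  · rw [h1, ← compProd_map_condDistrib hY.aemeasurable, Measure.integral_compProd hint,
      integral_map hX.aemeasurable hi.aestronglyMeasurable]

/-- Freezing the past: if `W` is measurable with respect to `m` and `Φ(w, ·)` is `K`-Lipschitz,
replacing `Y` by an independent copy in `E Φ(W, Y)` costs at most `K τ(m, Y)`. -/
lemma abs_integral_sub_le_tauReal {Ω : Type*} {m mΩ : MeasurableSpace Ω} (μ : Measure Ω)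
    [IsProbabilityMeasure μ] (hm : m ≤ mΩ) {W Y : Ω → ℝ}
    (hW : Measurable[m] W) (hY : Measurable Y) {Φ : ℝ → ℝ → ℝ}
    (hΦ : Measurable (Function.uncurry Φ)) {B : ℝ} (hB : ∀ w y, |Φ w y| ≤ B) {K : ℝ≥0}
    (hK : ∀ w, LipschitzWith K (Φ w)) :
    ENNReal.ofReal |∫ ω, Φ (W ω) (Y ω) ∂μ - ∫ ω, ∫ y, Φ (W ω) y ∂(μ.map Y) ∂μ|
      ≤ K * tauReal m μ Y := by
  -- the conditional law given `m` is the conditional law given the identity into `(Ω, m)`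
  have hid : @Measurable Ω Ω mΩ m id := measurable_id'' hm
  obtain ⟨hi, he⟩ := @integral_comp_condDistrib Ω Ω mΩ m μ _ id hid Y hY W hW Φ hΦ B hB
  have hprobY : IsProbabilityMeasure (μ.map Y) := Measure.isProbabilityMeasure_map hY.aemeasurable
  have hi2 : Integrable (fun ω => ∫ y, Φ (W ω) y ∂(μ.map Y)) μ := by
    refine Integrable.of_bound (C := B) ?_ (ae_of_all _ fun ω => ?_)
    · have : StronglyMeasurable (fun w => ∫ y, Φ w y ∂(μ.map Y)) :=
        hΦ.stronglyMeasurable.integral_prod_right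
      exact (this.comp_measurable (hW.mono hm le_rfl)).aestronglyMeasurable
    · refine (norm_integral_le_of_norm_le_const (ae_of_all _ fun y => hB _ _)).trans ?_
      simp
  have he' : ∫ ω, Φ (W ω) (Y ω) ∂μ = ∫ ω, ∫ y, Φ (W ω) y ∂(condLaw m μ Y ω) ∂μ := he
  have hi' : Integrable (fun ω => ∫ y, Φ (W ω) y ∂(condLaw m μ Y ω)) μ := hi
  rw [he', ← integral_sub hi' hi2]
  refine (ENNReal.ofReal_le_ofReal (abs_integral_le_integral_abs)).trans ?_
  have hsub : Integrable (fun ω => |∫ y, Φ (W ω) y ∂(condLaw m μ Y ω) -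
      ∫ y, Φ (W ω) y ∂(μ.map Y)|) μ := (hi'.sub hi2).abs
  rw [ofReal_integral_eq_lintegral_ofReal hsub (ae_of_all _ fun _ => abs_nonneg _)]
  unfold tauReal
  rw [← lintegral_const_mul' _ _ ENNReal.coe_ne_top]
  refine lintegral_mono fun ω => ?_
  dsimp only
  have hpc : IsProbabilityMeasure (condLaw m μ Y ω) := by
    unfold condLaw; infer_instance
  -- `K⁻¹ Φ(w, ·)` is an admissible test function in the definition of `τ`, unless `K = 0`
  rcases eq_or_ne K 0 with h0 | h0
  · have hc : ∀ y, Φ (W ω) y = Φ (W ω) 0 := fun y => by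
      have := (hK (W ω)).dist_le_mul y 0
      rw [h0] at this
      simpa [dist_le_zero] using this
    simp [hc]
  · have hK0 : (0 : ℝ) < K := lt_of_le_of_ne K.2 (by exact_mod_cast h0.symm)
    have hL : LipschitzWith 1 (fun y => (K : ℝ)⁻¹ * Φ (W ω) y) := by
      refine LipschitzWith.of_dist_le_mul fun x y => ?_
      have := (hK (W ω)).dist_le_mul x y
      rw [Real.dist_eq] at this ⊢
      rw [← mul_sub, abs_mul, abs_of_pos (inv_pos.2 hK0), NNReal.coe_one, one_mul,
        inv_mul_le_iff₀ hK0]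
      exact this
    refine le_trans ?_ (mul_le_mul_right (le_iSup₂_of_le _ hL le_rfl) _)
    rw [integral_const_mul, integral_const_mul, ← mul_sub, abs_mul,
      abs_of_pos (inv_pos.2 hK0), ENNReal.ofReal_mul (inv_pos.2 hK0).le, ← mul_assoc]
    rw [ENNReal.ofReal_inv_of_pos hK0, ENNReal.ofReal_coe_nnreal,
      ENNReal.mul_inv_cancel (by exact_mod_cast h0) ENNReal.coe_ne_top, one_mul]

/-- The coefficient of one Lipschitz function of `l` future variables is at most `l` times the mixing
coefficient, which is normalized by the number of variables. -/
lemma tauReal_le_tauMix {Ω : Type*} {mΩ : MeasurableSpace Ω} (μ : Measure Ω)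
    [IsProbabilityMeasure μ] (X : ℤ → Ω → ℝ) {l : ℕ} (p : ℤ) (i : ℕ) (j : Fin l → ℤ)
    (hj : StrictMono j) (hpj : ∀ s, p + (i : ℤ) ≤ j s) (hl : 1 ≤ l)
    {f : (Fin l → ℝ) → ℝ} (hf : IsLipOne f) :
    tauReal (pastSigma X p) μ (fun ω => f (fun s => X (j s) ω)) ≤ l * tauMix μ X i := by
  have h1 : tauReal (pastSigma X p) μ (fun ω => f (fun s => X (j s) ω)) ≤
      tauVec (pastSigma X p) μ (fun ω s => X (j s) ω) :=
    le_iSup₂ (f := fun (f : (Fin l → ℝ) → ℝ) (_ : IsLipOne f) =>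
      tauReal (pastSigma X p) μ (fun ω => f (fun s => X (j s) ω))) f hf
  have h2 : (l : ℝ≥0∞)⁻¹ * tauVec (pastSigma X p) μ (fun ω s => X (j s) ω) ≤ tauMix μ X i := by
    refine le_trans ?_ (le_iSup _ l)
    unfold tauMixK
    refine le_trans ?_ (le_iSup _ l)
    refine le_trans ?_ (le_iSup₂ hl le_rfl)
    refine mul_le_mul_right ?_ _
    refine le_trans ?_ (le_iSup₂ p j)
    exact le_iSup₂ (f := fun _ _ => tauVec (pastSigma X p) μ (fun ω s => X (j s) ω)) hj hpj
  refine h1.trans ?_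
  have hl0 : (l : ℝ≥0∞) ≠ 0 := by
    simp only [ne_eq, Nat.cast_eq_zero]; omega
  calc tauVec (pastSigma X p) μ (fun ω s => X (j s) ω)
      = l * ((l : ℝ≥0∞)⁻¹ * tauVec (pastSigma X p) μ (fun ω s => X (j s) ω)) := by
        rw [← mul_assoc, ENNReal.mul_inv_cancel hl0 (ENNReal.natCast_ne_top l), one_mul]
    _ ≤ _ := by gcongr

/-- Truncation of a real number at level `M`. -/
noncomputable def clip (M x : ℝ) : ℝ := max (-M) (min x M)

lemma measurable_clip (M : ℝ) : Measurable (clip M) := by unfold clip; fun_prop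

lemma abs_clip_le {M : ℝ} (hM : 0 ≤ M) (x : ℝ) : |clip M x| ≤ M := by
  unfold clip; rw [abs_le]; exact ⟨le_max_left _ _, max_le (by linarith) (min_le_right _ _)⟩

lemma clip_of_abs_le {M x : ℝ} (h : |x| ≤ M) : clip M x = x := by
  unfold clip; rw [abs_le] at h; rw [min_eq_left h.2, max_eq_right h.1]

lemma abs_clip_sub_clip_le (M x y : ℝ) : |clip M x - clip M y| ≤ |x - y| := by
  unfold clip
  refine (abs_max_sub_max_le_max _ _ _ _).trans ?_
  refine max_le (by simp) ((abs_min_sub_min_le_max _ _ _ _).trans (by simp))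

lemma abs_clip_le_abs {M : ℝ} (hM : 0 ≤ M) (x : ℝ) : |clip M x| ≤ |x| := by
  have := abs_clip_sub_clip_le M x 0
  rwa [clip_of_abs_le (x := 0) (by simpa using hM), sub_zero, sub_zero] at this

/-- The standing assumptions in a form suited to the proof, for a one-sided sequence `ξ`: tails
`P(|ξ_i| > s^r) ≤ e^{1-s}`, and a decoupling property with rate `exp(-c d^g)` for sums of
variables truncated at the level `M` (the past is given by the filtration `ℱ`). -/
structure StretchedMixing {Ω : Type*} {mΩ : MeasurableSpace Ω} (μ : Measure Ω)
    (ℱ : ℕ → MeasurableSpace Ω) (ξ : ℕ → Ω → ℝ) (c g r : ℝ) : Prop where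
  c_pos : 0 < c
  g_pos : 0 < g
  r_nonneg : 0 ≤ r
  meas : ∀ i, Measurable (ξ i)
  past_meas : ∀ i N, i < N → Measurable[ℱ N] (ξ i)
  tail : ∀ i, ∀ s : ℝ, 0 < s → μ.real {ω | s ^ r < |ξ i ω|} ≤ Real.exp (1 - s)
  decouple : ∀ (N d m l : ℕ) (M : ℝ) (W : Ω → ℝ) (Φ : ℝ → ℝ → ℝ) (B : ℝ) (K : ℝ≥0),
    1 ≤ d → N + d ≤ m → Measurable[ℱ N] W → Measurable (Function.uncurry Φ) →
    (∀ w y, |Φ w y| ≤ B) → (∀ w, LipschitzWith K (Φ w)) →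
    |∫ ω, Φ (W ω) (∑ i ∈ Finset.range l, clip M (ξ (m + i) ω)) ∂μ
      - ∫ ω, ∫ ω', Φ (W ω) (∑ i ∈ Finset.range l, clip M (ξ (m + i) ω')) ∂μ ∂μ|
      ≤ K * l * Real.exp (-c * (d : ℝ) ^ g)

/-- The hypotheses on the tails and on the mixing coefficients, for the variables with positive
indices; the shift by one makes the partial sums start at index `0`. -/
lemma stretchedMixing_of_tauMix {Ω : Type*} {mΩ : MeasurableSpace Ω} (μ : Measure Ω)
    [IsProbabilityMeasure μ] (X : ℤ → Ω → ℝ) (hX : ∀ i, Measurable (X i))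
    (c γ₁ : ℝ) (γ₂ : ℝ≥0∞) (hc : 0 < c) (hγ₁ : 0 < γ₁) (hγ₂ : 0 < γ₂)
    (hτ : ∀ x : ℝ, 1 ≤ x → tauMix μ X ⌊x⌋₊ ≤ ENNReal.ofReal (Real.exp (-c * x ^ γ₁)))
    (htail : TailCondition μ X γ₂) :
    StretchedMixing μ (fun N => pastSigma X N) (fun i => X ((i : ℤ) + 1)) c γ₁ (γ₂⁻¹).toReal where
  c_pos := hc
  g_pos := hγ₁
  r_nonneg := ENNReal.toReal_nonneg
  meas i := hX _
  past_meas i N hi := by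
    have h : MeasurableSpace.comap (X ((i : ℤ) + 1)) inferInstance ≤ pastSigma X N :=
      le_iSup₂ (f := fun (j : ℤ) (_ : j ≤ (N : ℤ)) => MeasurableSpace.comap (X j) inferInstance)
        ((i : ℤ) + 1) (by omega)
    exact (comap_measurable _).mono h le_rfl
  tail i s hs := by
    rcases eq_or_ne γ₂ ∞ with h | h
    -- for `γ₂ = ∞` the exponent is `r = 0`, the level `s ^ r` is `1`, and the variables are bounded by `1`
    · have h1 := htail.2 h ((i : ℤ) + 1) (by omega)
      have : μ {ω | s ^ (γ₂⁻¹).toReal < |X ((i : ℤ) + 1) ω|} = 0 := by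
        rw [h]
        simp only [ENNReal.inv_top, ENNReal.toReal_zero, Real.rpow_zero]
        have h2 := ae_iff.1 h1
        simpa using h2
      rw [Measure.real, this]; simpa using (Real.exp_pos _).le
    · have h1 := htail.1 h ((i : ℤ) + 1) (by omega) (s ^ (γ₂⁻¹).toReal) (Real.rpow_pos_of_pos hs _)
      have h2 : 0 < γ₂.toReal := ENNReal.toReal_pos hγ₂.ne' h
      rw [← Real.rpow_mul hs.le, ENNReal.toReal_inv, inv_mul_cancel₀ h2.ne', Real.rpow_one] at h1
      rw [Measure.real, ENNReal.toReal_inv]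
      exact ENNReal.toReal_le_of_le_ofReal (Real.exp_pos _).le h1
  decouple N d m l M W Φ B K hd hm hW hΦ hB hK := by
    rcases Nat.eq_zero_or_pos l with rfl | hl
    · simp
    have hYm : Measurable (fun ω => ∑ i ∈ Finset.range l, clip M (X (((m + i : ℕ) : ℤ) + 1) ω)) :=
      Finset.measurable_sum _ fun i _ => (measurable_clip M).comp (hX _)
    -- the sum of the truncated coordinates is `1`-Lipschitz for the `ℓ¹` distance
    set f : (Fin l → ℝ) → ℝ := fun x => ∑ s, clip M (x s) with hf
    have hfL : IsLipOne f := fun x y => by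
      simp only [hf]
      rw [← Finset.sum_sub_distrib]
      exact (Finset.abs_sum_le_sum_abs _ _).trans
        (Finset.sum_le_sum fun i _ => abs_clip_sub_clip_le _ _ _)
    have h1 := tauReal_le_tauMix μ X (N : ℤ) d (fun s : Fin l => ((m + s : ℕ) : ℤ) + 1)
      (fun a b hab => by simpa using hab) (fun s => by push_cast; omega) hl hfL
    have hfY : (fun ω => f (fun s : Fin l => X (((m + s : ℕ) : ℤ) + 1) ω)) =
        fun ω => ∑ i ∈ Finset.range l, clip M (X (((m + i : ℕ) : ℤ) + 1) ω) := by
      funext ω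
      simp only [hf]
      exact Fin.sum_univ_eq_sum_range (fun i => clip M (X (((m + i : ℕ) : ℤ) + 1) ω)) l
    rw [hfY] at h1
    have h2 := hτ d (by exact_mod_cast hd)
    rw [Nat.floor_natCast] at h2
    have hle : pastSigma X (N : ℤ) ≤ mΩ := iSup₂_le fun j _ => (hX j).comap_le
    have h3 := abs_integral_sub_le_tauReal μ hle hW hYm hΦ hB hK
    have h4 : ∀ w, ∫ y, Φ w y ∂(μ.map fun ω => ∑ i ∈ Finset.range l,
        clip M (X (((m + i : ℕ) : ℤ) + 1) ω)) =
        ∫ ω', Φ w (∑ i ∈ Finset.range l, clip M (X (((m + i : ℕ) : ℤ) + 1) ω')) ∂μ := fun w =>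
      integral_map hYm.aemeasurable (hΦ.comp measurable_prodMk_left).aestronglyMeasurable
    simp only [h4] at h3
    have h5 : (K : ℝ≥0∞) * (l * ENNReal.ofReal (Real.exp (-c * (d : ℝ) ^ γ₁))) =
        ENNReal.ofReal (K * l * Real.exp (-c * (d : ℝ) ^ γ₁)) := by
      rw [ENNReal.ofReal_mul (by positivity), ENNReal.ofReal_mul (by positivity),
        ENNReal.ofReal_coe_nnreal, ENNReal.ofReal_natCast, mul_assoc]
    refine (ENNReal.ofReal_le_ofReal_iff (by positivity)).1 (h3.trans ?_)
    rw [← h5]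
    gcongr
    exact h1.trans (by gcongr)

/-! ### Moments and truncation -/


/-- Sum of the variables `ξ_m, …, ξ_{m+l-1}` truncated at the level `M`. -/
noncomputable def truncSum {Ω : Type*} (ξ : ℕ → Ω → ℝ) (M : ℝ) (m l : ℕ) (ω : Ω) : ℝ :=
  ∑ i ∈ Finset.range l, clip M (ξ (m + i) ω)

lemma abs_truncSum_le {M : ℝ} (hM : 0 ≤ M) {Ω : Type*} (ξ : ℕ → Ω → ℝ) (m l : ℕ) (ω : Ω) :
    |truncSum ξ M m l ω| ≤ M * l := by
  unfold truncSum
  refine (Finset.abs_sum_le_sum_abs _ _).trans ?_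
  refine (Finset.sum_le_sum fun i _ => abs_clip_le hM _).trans ?_
  simp [mul_comm]

lemma truncSum_add {Ω : Type*} (ξ : ℕ → Ω → ℝ) (M : ℝ) (m l₁ l₂ : ℕ) (ω : Ω) :
    truncSum ξ M m (l₁ + l₂) ω = truncSum ξ M m l₁ ω + truncSum ξ M (m + l₁) l₂ ω := by
  unfold truncSum
  rw [Finset.sum_range_add]
  simp [add_assoc]

section Moments

variable {Ω : Type*} {mΩ : MeasurableSpace Ω} {μ : Measure Ω} [IsProbabilityMeasure μ]

/-- The Cauchy–Schwarz inequality. -/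
lemma abs_integral_mul_le_sqrt_mul_sqrt {f h : Ω → ℝ} (hf : MemLp f 2 μ) (hh : MemLp h 2 μ) :
    |∫ ω, f ω * h ω ∂μ| ≤ √(∫ ω, f ω ^ 2 ∂μ) * √(∫ ω, h ω ^ 2 ∂μ) := by
  have h1 : |∫ ω, f ω * h ω ∂μ| ≤ ∫ ω, ‖f ω‖ * ‖h ω‖ ∂μ := by
    refine (abs_integral_le_integral_abs).trans (le_of_eq ?_)
    simp [abs_mul]
  have h2 := integral_mul_norm_le_Lp_mul_Lq (μ := μ) (f := f) (g := h)
    (Real.HolderConjugate.two_two) (by simpa using hf) (by simpa using hh)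
  refine h1.trans (h2.trans (le_of_eq ?_))
  simp [Real.sqrt_eq_rpow]

lemma abs_sub_clip_le_indicator {M x : ℝ} (hM : 0 ≤ M) :
    |x - clip M x| ≤ Set.indicator {y : ℝ | M < |y|} (fun y => |y|) x := by
  by_cases h : M < |x|
  · rw [Set.indicator_of_mem (by exact h)]
    unfold clip
    rcases le_total 0 x with hx | hx
    · rw [abs_of_nonneg hx] at h ⊢
      rw [min_eq_right h.le, max_eq_right (by linarith), abs_of_nonneg (by linarith)]; linarith
    · rw [abs_of_nonpos hx] at h ⊢
      rw [min_eq_left (by linarith), max_eq_left (by linarith), abs_of_nonpos (by linarith)]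
      linarith
  · rw [Set.indicator_of_notMem (by exact h), clip_of_abs_le (not_lt.1 h)]; simp

lemma summable_rpow_mul_exp_neg (A c g : ℝ) (hc : 0 < c) (hg : 0 < g) :
    Summable (fun k : ℕ => (k : ℝ) ^ A * Real.exp (-c * (k : ℝ) ^ g)) := by
  have h1 := (tendsto_rpow_mul_exp_neg_mul_atTop_nhds_zero ((A + 2) / g) c hc).comp
    ((tendsto_rpow_atTop hg).comp tendsto_natCast_atTop_atTop)
  have h2 : (fun k : ℕ => (k : ℝ) ^ A * Real.exp (-c * (k : ℝ) ^ g)) =O[atTop]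
      fun k : ℕ => ((k : ℝ) ^ (2 : ℝ))⁻¹ := by
    refine Asymptotics.IsBigO.of_bound 1 ?_
    filter_upwards [h1.eventually (gt_mem_nhds (zero_lt_one)), eventually_gt_atTop 0] with k hk hk0
    have hk1 : (0 : ℝ) < k := by exact_mod_cast hk0
    simp only [Function.comp] at hk
    rw [← Real.rpow_mul hk1.le, mul_div_cancel₀ _ hg.ne', Real.rpow_add hk1] at hk
    rw [Real.norm_of_nonneg (by positivity), Real.norm_of_nonneg (by positivity), one_mul,
      ← one_div, le_div_iff₀ (by positivity)]
    linarith [mul_right_comm ((k : ℝ) ^ A) (Real.exp (-c * (k : ℝ) ^ g)) ((k : ℝ) ^ (2 : ℝ))]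
  exact summable_of_isBigO_nat (Real.summable_nat_rpow_inv.2 one_lt_two) h2

variable {ℱ : ℕ → MeasurableSpace Ω} {ξ : ℕ → Ω → ℝ} {c g r : ℝ}

/-- Each variable is almost surely bounded by some `(k + 1) ^ r`; for `r = 0`, where these levels do
not grow, this says that the tail condition forces `|ξ_i| ≤ 1`. -/
lemma StretchedMixing.ae_le_rpow (H : StretchedMixing μ ℱ ξ c g r) (i : ℕ) :
    ∀ᵐ ω ∂μ, ∃ k : ℕ, |ξ i ω| ≤ ((k + 1 : ℕ) : ℝ) ^ r := by
  rw [ae_iff]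
  simp only [not_exists, not_le]
  have h1 : ∀ k : ℕ, μ.real {a | ∀ x : ℕ, ((x + 1 : ℕ) : ℝ) ^ r < |ξ i a|} ≤
      Real.exp (1 - ((k + 1 : ℕ) : ℝ)) := fun k => by
    have hs : {a | ∀ x : ℕ, ((x + 1 : ℕ) : ℝ) ^ r < |ξ i a|} ⊆
        {ω | ((k + 1 : ℕ) : ℝ) ^ r < |ξ i ω|} := fun a ha =>
      (ha : ∀ x : ℕ, ((x + 1 : ℕ) : ℝ) ^ r < |ξ i a|) k
    exact (measureReal_mono hs).trans (H.tail i _ (by positivity))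
  have h2 : Tendsto (fun k : ℕ => Real.exp (1 - ((k + 1 : ℕ) : ℝ))) atTop (𝓝 0) := by
    refine Real.tendsto_exp_atBot.comp ?_
    have : Tendsto (fun k : ℕ => ((k + 1 : ℕ) : ℝ)) atTop atTop :=
      tendsto_natCast_atTop_atTop.comp (tendsto_add_atTop_nat 1)
    exact tendsto_atBot_add_const_left _ _ (tendsto_neg_atTop_atBot.comp this)
  have h3 := ge_of_tendsto' h2 h1
  have h4 := le_antisymm h3 measureReal_nonneg
  rwa [measureReal_eq_zero_iff] at h4

/-- The fourth moments are bounded uniformly in the index. -/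
lemma StretchedMixing.exists_fourth_moment (H : StretchedMixing μ ℱ ξ c g r) :
    ∃ C : ℝ, 0 ≤ C ∧ ∀ i, Integrable (fun ω => ξ i ω ^ 4) μ ∧ ∫ ω, ξ i ω ^ 4 ∂μ ≤ C := by
  have hsum : Summable (fun k : ℕ => ((k : ℝ) + 2) ^ (4 * r) * Real.exp (1 - ((k : ℝ) + 1))) := by
    have h1 := (summable_nat_add_iff 2).2
      (summable_rpow_mul_exp_neg (4 * r) 1 1 one_pos one_pos)
    refine (h1.mul_left (Real.exp 2)).congr fun k => ?_
    push_cast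
    rw [Real.rpow_one, mul_left_comm, ← Real.exp_add]
    ring_nf
  set C : ℝ := 1 + ∑' k : ℕ, ((k : ℝ) + 2) ^ (4 * r) * Real.exp (1 - ((k : ℝ) + 1)) with hC
  have hC0 : 0 ≤ C := by
    have : 0 ≤ ∑' k : ℕ, ((k : ℝ) + 2) ^ (4 * r) * Real.exp (1 - ((k : ℝ) + 1)) :=
      tsum_nonneg fun k => by positivity
    linarith
  refine ⟨C, hC0, fun i => ?_⟩
  have hm := H.meas i
  have hset : ∀ k : ℕ, MeasurableSet {ω | ((k : ℝ) + 1) ^ r < |ξ i ω|} := fun k =>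
    measurableSet_lt measurable_const hm.abs
  have key : ∫⁻ ω, ENNReal.ofReal (ξ i ω ^ 4) ∂μ ≤ ENNReal.ofReal C := by
    -- if `k ≥ 1` is the least number with `|ξ| ≤ (k + 1) ^ r`, then `|ξ| > k ^ r`, and the term of
    -- index `k - 1` of the series dominates `ξ ^ 4`
    have hle : ∀ᵐ ω ∂μ, ENNReal.ofReal (ξ i ω ^ 4) ≤ 1 + ∑' k : ℕ,
        Set.indicator {ω | ((k : ℝ) + 1) ^ r < |ξ i ω|}
          (fun _ => ENNReal.ofReal (((k : ℝ) + 2) ^ (4 * r))) ω := by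
      filter_upwards [H.ae_le_rpow i] with ω hω
      classical
      have hk := Nat.find_spec hω
      have hmin := fun j hj => Nat.find_min hω (m := j) hj
      set k := Nat.find hω with hkdef
      have h4 : ξ i ω ^ 4 ≤ ((k : ℝ) + 1) ^ (4 * r) := by
        rw [← (show Even 4 by decide).pow_abs]
        refine (pow_le_pow_left₀ (abs_nonneg _) hk 4).trans (le_of_eq ?_)
        rw [← Real.rpow_mul_natCast (by positivity)]
        push_cast; ring_nf
      rcases Nat.eq_zero_or_pos k with h0 | h0
      · rw [h0] at h4
        simp only [Nat.cast_zero, zero_add, Real.one_rpow] at h4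
        refine le_trans ?_ le_self_add
        exact ENNReal.ofReal_le_one.2 h4
      · obtain ⟨j, hj⟩ : ∃ j, k = j + 1 := ⟨k - 1, by omega⟩
        refine le_trans ?_ le_add_self
        refine le_trans ?_ (ENNReal.le_tsum j)
        have hj1 := hmin j (by omega)
        push_cast at hj1
        rw [Set.indicator_of_mem (by simpa using hj1)]
        refine ENNReal.ofReal_le_ofReal (h4.trans (le_of_eq ?_))
        rw [hj]; push_cast; ring_nf
    refine (lintegral_mono_ae hle).trans ?_
    rw [lintegral_add_left measurable_const, lintegral_tsum fun k =>
      (measurable_const.indicator (hset k)).aemeasurable]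
    simp only [lintegral_const, measure_univ, mul_one, lintegral_indicator_const (hset _)]
    rw [hC, ENNReal.ofReal_add zero_le_one (tsum_nonneg fun k => by positivity),
      ENNReal.ofReal_one, ENNReal.ofReal_tsum_of_nonneg (fun k => by positivity) hsum]
    gcongr with k
    rw [ENNReal.ofReal_mul (by positivity)]
    gcongr
    rw [← ofReal_measureReal]
    exact ENNReal.ofReal_le_ofReal (H.tail i _ (by positivity))
  have hnn : ∀ ω, 0 ≤ ξ i ω ^ 4 := fun ω => by positivity
  have hmeas : AEStronglyMeasurable (fun ω => ξ i ω ^ 4) μ := (hm.pow_const 4).aestronglyMeasurable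
  constructor
  · refine ⟨hmeas, ?_⟩
    rw [hasFiniteIntegral_iff_ofReal (ae_of_all _ hnn)]
    exact key.trans_lt ENNReal.ofReal_lt_top
  · rw [integral_eq_lintegral_of_nonneg_ae (ae_of_all _ hnn) hmeas]
    exact ENNReal.toReal_le_of_le_ofReal hC0 key

lemma memLp_two_of_fourth {f : Ω → ℝ} (hf : Measurable f)
    (h4 : Integrable (fun ω => f ω ^ 4) μ) : MemLp f 2 μ := by
  rw [memLp_two_iff_integrable_sq hf.aestronglyMeasurable]
  refine (h4.add (integrable_const (1 : ℝ))).mono' (hf.pow_const 2).aestronglyMeasurable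
    (ae_of_all _ fun ω => ?_)
  rw [Real.norm_of_nonneg (by positivity)]
  simp only [Pi.add_apply]
  nlinarith [sq_nonneg (f ω ^ 2 - 1), sq_nonneg (f ω)]

lemma StretchedMixing.memLp_two (H : StretchedMixing μ ℱ ξ c g r) (i : ℕ) : MemLp (ξ i) 2 μ := by
  obtain ⟨C, _, hC⟩ := H.exists_fourth_moment
  exact memLp_two_of_fourth (H.meas i) (hC i).1

/-- Truncating at the level `D^r` is an `L²`-error of order `exp(-D/4)`. -/
lemma StretchedMixing.exists_truncation_bound (H : StretchedMixing μ ℱ ξ c g r) :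
    ∃ C : ℝ, 1 ≤ C ∧ ∀ i, ∫ ω, ξ i ω ^ 2 ∂μ ≤ C ^ 2 ∧ ∀ D : ℝ, 0 < D →
      ∫ ω, (ξ i ω - clip (D ^ r) (ξ i ω)) ^ 2 ∂μ ≤ (C * Real.exp (-D / 4)) ^ 2 := by
  obtain ⟨C, hC0, hC⟩ := H.exists_fourth_moment
  have hsq : ∀ i, MemLp (fun ω => ξ i ω ^ 2) 2 μ := fun i => by
    rw [memLp_two_iff_integrable_sq ((H.meas i).pow_const 2).aestronglyMeasurable]
    simpa [← pow_mul] using (hC i).1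
  have e4 : ∀ i, ∫ ω, (ξ i ω ^ 2) ^ 2 ∂μ ≤ C := fun i => by
    simpa [← pow_mul] using (hC i).2
  refine ⟨2 * C + 2, by linarith, fun i => ⟨?_, fun D hD => ?_⟩⟩
  · have h1 := abs_integral_mul_le_sqrt_mul_sqrt (hsq i) (memLp_const (μ := μ) (1 : ℝ))
    simp only [mul_one, one_pow, integral_const, probReal_univ, smul_eq_mul, Real.sqrt_one] at h1
    refine (le_abs_self _).trans (h1.trans ?_)
    refine (Real.sqrt_le_sqrt (e4 i)).trans ?_
    rw [Real.sqrt_le_left (by positivity)]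
    nlinarith [sq_nonneg (C^2), pow_nonneg hC0 3, pow_nonneg hC0 4]
  · set A : Set Ω := {ω | D ^ r < |ξ i ω|} with hA
    have hAm : MeasurableSet A := measurableSet_lt measurable_const (H.meas i).abs
    have hind : MemLp (A.indicator fun _ => (1 : ℝ)) 2 μ :=
      memLp_indicator_const 2 hAm 1 (Or.inr (measure_ne_top _ _))
    -- Cauchy–Schwarz for `ξ² 1_A`, with the fourth moment and `P(A) ≤ exp(1 - D)`
    have h1 := abs_integral_mul_le_sqrt_mul_sqrt (hsq i) hind
    have h2 : ∫ ω, (A.indicator (fun _ => (1 : ℝ)) ω) ^ 2 ∂μ = μ.real A := by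
      rw [← integral_indicator_one hAm]
      congr 1; ext ω; by_cases hω : ω ∈ A <;> simp [hω]
    rw [h2] at h1
    have h3 : ∫ ω, (ξ i ω - clip (D ^ r) (ξ i ω)) ^ 2 ∂μ ≤
        ∫ ω, ξ i ω ^ 2 * A.indicator (fun _ => (1 : ℝ)) ω ∂μ := by
      refine integral_mono_of_nonneg (ae_of_all _ fun ω => by positivity)
        ((hsq i).integrable_mul hind) (ae_of_all _ fun ω => ?_)
      have h5 := abs_sub_clip_le_indicator (M := D ^ r) (x := ξ i ω) (by positivity)
      have h6 := pow_le_pow_left₀ (abs_nonneg _) h5 2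
      rw [sq_abs] at h6
      refine h6.trans (le_of_eq ?_)
      dsimp only
      by_cases hω : ω ∈ A
      · have : ξ i ω ∈ {y : ℝ | D ^ r < |y|} := hω
        rw [Set.indicator_of_mem this, Set.indicator_of_mem hω, sq_abs, mul_one]
      · have : ξ i ω ∉ {y : ℝ | D ^ r < |y|} := hω
        rw [Set.indicator_of_notMem this, Set.indicator_of_notMem hω]; simp
    refine h3.trans ((le_abs_self _).trans (h1.trans ?_))
    have h7 : √(μ.real A) ≤ 2 * Real.exp (-D / 4) ^ 2 := by
      rw [Real.sqrt_le_left (by positivity)]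
      refine (H.tail i D hD).trans ?_
      rw [mul_pow, ← pow_mul, ← Real.exp_nat_mul, sub_eq_add_neg, Real.exp_add]
      push_cast
      have : Real.exp 1 ≤ 2 ^ 2 := by linarith [Real.exp_one_lt_d9]
      have e : (4 * (-D / 4) : ℝ) = -D := by ring
      rw [e]
      gcongr
    have h8 : √(∫ ω, (ξ i ω ^ 2) ^ 2 ∂μ) ≤ C + 1 := by
      rw [Real.sqrt_le_left (by positivity)]
      nlinarith [e4 i]
    calc √(∫ ω, (ξ i ω ^ 2) ^ 2 ∂μ) * √(μ.real A)
        ≤ (C + 1) * (2 * Real.exp (-D / 4) ^ 2) := by gcongr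
      _ ≤ (2 * C + 2) ^ 2 * Real.exp (-D / 4) ^ 2 := by
        rw [← mul_assoc]; gcongr; nlinarith
      _ = _ := by ring

lemma StretchedMixing.measurable_truncSum (H : StretchedMixing μ ℱ ξ c g r) (M : ℝ) (m l : ℕ) :
    Measurable (truncSum ξ M m l) :=
  Finset.measurable_sum _ fun _ _ => (measurable_clip M).comp (H.meas _)

lemma StretchedMixing.measurable_past_truncSum (H : StretchedMixing μ ℱ ξ c g r) (M : ℝ)
    {m l N : ℕ} (h : m + l ≤ N) : Measurable[ℱ N] (truncSum ξ M m l) :=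
  Finset.measurable_sum _ fun i hi => (measurable_clip M).comp
    (H.past_meas _ _ (by have := Finset.mem_range.1 hi; omega))

lemma StretchedMixing.memLp_clip (H : StretchedMixing μ ℱ ξ c g r) {M : ℝ} (hM : 0 ≤ M) (i : ℕ) :
    MemLp (fun ω => clip M (ξ i ω)) 2 μ :=
  MemLp.of_bound ((measurable_clip M).comp (H.meas i)).aestronglyMeasurable M
    (ae_of_all _ fun _ => abs_clip_le hM _)

end Moments

/-! ### Covariances and the variance of partial sums -/

section Variance

variable {Ω : Type*} {mΩ : MeasurableSpace Ω} {μ : Measure Ω} [IsProbabilityMeasure μ]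
  {ℱ : ℕ → MeasurableSpace Ω} {ξ : ℕ → Ω → ℝ} {c g r : ℝ}

lemma sqrt_integral_le {f : Ω → ℝ} {a : ℝ} (ha : 0 ≤ a) (h : ∫ ω, f ω ^ 2 ∂μ ≤ a ^ 2) :
    √(∫ ω, f ω ^ 2 ∂μ) ≤ a := by
  rwa [Real.sqrt_le_left ha]

lemma integral_sq_clip_le {f : Ω → ℝ} (hf : MemLp f 2 μ) {M : ℝ} (hM : 0 ≤ M) :
    ∫ ω, clip M (f ω) ^ 2 ∂μ ≤ ∫ ω, f ω ^ 2 ∂μ :=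
  integral_mono_of_nonneg (ae_of_all _ fun _ => sq_nonneg _) hf.integrable_sq
    (ae_of_all _ fun _ => sq_le_sq.2 (abs_clip_le_abs hM _))

/-- A centered variable truncated at the level `D^r` has a mean of order `exp(-D/4)`. -/
lemma StretchedMixing.abs_integral_clip_le (H : StretchedMixing μ ℱ ξ c g r)
    (h0 : ∀ i, ∫ ω, ξ i ω ∂μ = 0) {C : ℝ} (hC : 1 ≤ C) {i : ℕ} {D : ℝ} (hD : 0 < D)
    (hC2 : ∫ ω, (ξ i ω - clip (D ^ r) (ξ i ω)) ^ 2 ∂μ ≤ (C * Real.exp (-D / 4)) ^ 2) :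
    |∫ ω, clip (D ^ r) (ξ i ω) ∂μ| ≤ C * Real.exp (-D / 4) := by
  have hm := H.memLp_two i
  have hcl := H.memLp_clip (Real.rpow_nonneg hD.le r) i
  have h1 := abs_integral_mul_le_sqrt_mul_sqrt (hm.sub hcl) (memLp_const (μ := μ) (1 : ℝ))
  simp only [mul_one, Pi.sub_apply, one_pow, integral_const, probReal_univ, smul_eq_mul,
    Real.sqrt_one] at h1
  rw [integral_sub (hm.integrable (by norm_num)) (hcl.integrable (by norm_num)), h0, zero_sub,
    abs_neg] at h1
  exact h1.trans (sqrt_integral_le (by positivity) hC2)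

/-- Covariances decay at the stretched exponential rate, up to a power of the lag. -/
lemma StretchedMixing.exists_abs_covariance_le (H : StretchedMixing μ ℱ ξ c g r)
    (h0 : ∀ i, ∫ ω, ξ i ω ∂μ = 0) :
    ∃ C c' : ℝ, 0 < c' ∧ ∀ d : ℕ, 1 ≤ d →
      |∫ ω, ξ 0 ω * ξ (d + 1) ω ∂μ| ≤
        C * ((1 + (d : ℝ) ^ (g * r)) * Real.exp (-c' * (d : ℝ) ^ g)) := by
  obtain ⟨C, hC1, hC⟩ := H.exists_truncation_bound
  refine ⟨3 * C ^ 2 + 1, min c (1 / 4), lt_min H.c_pos (by norm_num), fun d hd => ?_⟩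
  have hd0 : (0 : ℝ) < d := by exact_mod_cast hd
  -- truncate at the level `D ^ r` with `D = d ^ g`, so that the truncation error `exp(-D / 4)` and the
  -- mixing coefficient `exp(-c D)` are of the same kind
  set D : ℝ := (d : ℝ) ^ g with hDdef
  have hD : 0 < D := Real.rpow_pos_of_pos hd0 _
  set M : ℝ := D ^ r with hMdef
  have hM0 : 0 ≤ M := Real.rpow_nonneg hD.le _
  have hMd : (d : ℝ) ^ (g * r) = M := by rw [Real.rpow_mul hd0.le]
  set e : ℝ := C * Real.exp (-D / 4) with he
  have he0 : 0 ≤ e := by positivity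
  have hm := H.memLp_two 0
  have hm' := H.memLp_two (d + 1)
  have hcl := H.memLp_clip hM0 0
  have hcl' := H.memLp_clip hM0 (d + 1)
  have h1 : |∫ ω, (ξ 0 ω - clip M (ξ 0 ω)) * ξ (d + 1) ω ∂μ| ≤ e * C :=
    (abs_integral_mul_le_sqrt_mul_sqrt (hm.sub hcl) hm').trans
      (mul_le_mul (sqrt_integral_le he0 ((hC 0).2 D hD))
        (sqrt_integral_le (by positivity) (hC (d + 1)).1) (Real.sqrt_nonneg _) he0)
  have h2 : |∫ ω, clip M (ξ 0 ω) * (ξ (d + 1) ω - clip M (ξ (d + 1) ω)) ∂μ| ≤ C * e :=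
    (abs_integral_mul_le_sqrt_mul_sqrt hcl (hm'.sub hcl')).trans
      (mul_le_mul (sqrt_integral_le (by positivity)
        ((integral_sq_clip_le hm hM0).trans (hC 0).1))
        (sqrt_integral_le he0 ((hC (d + 1)).2 D hD)) (Real.sqrt_nonneg _) (by positivity))
  -- clipping `w` again makes the test function bounded and Lipschitz in `y`
  have h3 := H.decouple 1 d (d + 1) 1 M (fun ω => clip M (ξ 0 ω))
    (fun w y => clip M w * clip M y) (M * M) M.toNNReal hd (by omega)
    ((measurable_clip M).comp (H.past_meas 0 1 one_pos))
    (((measurable_clip M).comp measurable_fst).mul ((measurable_clip M).comp measurable_snd))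
    (fun w y => by rw [abs_mul]; gcongr <;> exact abs_clip_le hM0 _)
    (fun w => LipschitzWith.of_dist_le_mul fun x y => by
      rw [Real.dist_eq, ← mul_sub, abs_mul, Real.coe_toNNReal _ hM0]
      gcongr
      · exact abs_clip_le hM0 _
      · exact abs_clip_sub_clip_le _ _ _)
  have hcc : ∀ x, clip M (clip M x) = clip M x := fun x => clip_of_abs_le (abs_clip_le hM0 _)
  simp only [Finset.range_one, Finset.sum_singleton, add_zero, hcc, Nat.cast_one, mul_one,
    Real.coe_toNNReal _ hM0, integral_const_mul, integral_mul_const] at h3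
  have h4 : |(∫ ω, clip M (ξ 0 ω) ∂μ) * ∫ ω, clip M (ξ (d + 1) ω) ∂μ| ≤ e * C := by
    rw [abs_mul]
    have e1 := H.abs_integral_clip_le h0 hC1 hD ((hC 0).2 D hD)
    have e2 := H.abs_integral_clip_le h0 hC1 hD ((hC (d + 1)).2 D hD)
    refine mul_le_mul e1 (e2.trans ?_) (abs_nonneg _) he0
    have : Real.exp (-D / 4) ≤ 1 := Real.exp_le_one_iff.2 (by linarith)
    nlinarith
  have hi1 : Integrable (fun ω => (ξ 0 ω - clip M (ξ 0 ω)) * ξ (d + 1) ω) μ :=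
    (hm.sub hcl).integrable_mul hm'
  have hi2 : Integrable (fun ω => clip M (ξ 0 ω) * (ξ (d + 1) ω - clip M (ξ (d + 1) ω))) μ :=
    hcl.integrable_mul (hm'.sub hcl')
  have hi3 : Integrable (fun ω => clip M (ξ 0 ω) * clip M (ξ (d + 1) ω)) μ :=
    hcl.integrable_mul hcl'
  have hsplit : ∫ ω, ξ 0 ω * ξ (d + 1) ω ∂μ =
      ∫ ω, (ξ 0 ω - clip M (ξ 0 ω)) * ξ (d + 1) ω ∂μ +
      ∫ ω, clip M (ξ 0 ω) * (ξ (d + 1) ω - clip M (ξ (d + 1) ω)) ∂μ +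
      ∫ ω, clip M (ξ 0 ω) * clip M (ξ (d + 1) ω) ∂μ := by
    have hi12 : Integrable (fun ω => (ξ 0 ω - clip M (ξ 0 ω)) * ξ (d + 1) ω +
        clip M (ξ 0 ω) * (ξ (d + 1) ω - clip M (ξ (d + 1) ω))) μ := hi1.add hi2
    rw [← integral_add hi1 hi2, ← integral_add hi12 hi3]
    exact integral_congr_ae (ae_of_all _ fun ω => by ring)
  have hx1 : Real.exp (-D / 4) ≤ Real.exp (-(min c (1 / 4)) * D) := by
    rw [Real.exp_le_exp]; nlinarith [min_le_right c (1 / 4)]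
  have hx2 : Real.exp (-c * D) ≤ Real.exp (-(min c (1 / 4)) * D) := by
    rw [Real.exp_le_exp]; nlinarith [min_le_left c (1 / 4)]
  rw [hMd]
  set E := Real.exp (-(min c (1 / 4)) * D) with hE
  have hE0 : 0 < E := Real.exp_pos _
  have heE : e * C ≤ C ^ 2 * E := by rw [he]; nlinarith [sq_nonneg C]
  have hME : M * Real.exp (-c * D) ≤ M * E := by gcongr
  have h5 : |∫ ω, clip M (ξ 0 ω) * clip M (ξ (d + 1) ω) ∂μ| ≤ M * E + C ^ 2 * E := by
    have := abs_sub_abs_le_abs_sub (∫ ω, clip M (ξ 0 ω) * clip M (ξ (d + 1) ω) ∂μ)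
      ((∫ ω, clip M (ξ 0 ω) ∂μ) * ∫ ω, clip M (ξ (d + 1) ω) ∂μ)
    linarith
  -- the three terms of the decomposition are bounded by `C² E`, `C² E` and `(M + C²) E`
  rw [hsplit]
  refine (abs_add_three _ _ _).trans ?_
  have : 0 ≤ C ^ 2 * (M * E) := by positivity
  nlinarith [mul_comm C e]

/-- The variance of `ξ_m + ⋯ + ξ_{m+l-1}` for a weakly stationary sequence with autocovariances
`ρ`. -/
noncomputable def sumVar (ρ : ℕ → ℝ) (l : ℕ) : ℝ :=
  ∑ j ∈ Finset.range l, (ρ 0 + 2 * ∑ k ∈ Finset.range j, ρ (k + 1))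

/-- The second moment of a sum of `l` consecutive variables does not depend on where it starts. -/
lemma integral_sq_sum_eq (hm : ∀ i, MemLp (ξ i) 2 μ) {ρ : ℕ → ℝ}
    (hρ : ∀ i k, ∫ ω, ξ i ω * ξ (i + k) ω ∂μ = ρ k) (m l : ℕ) :
    ∫ ω, (∑ i ∈ Finset.range l, ξ (m + i) ω) ^ 2 ∂μ = sumVar ρ l := by
  induction l with
  | zero => simp [sumVar]
  | succ l ih =>
    have hs : MemLp (fun ω => ∑ i ∈ Finset.range l, ξ (m + i) ω) 2 μ :=
      memLp_finsetSum _ fun i _ => hm _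
    have h1 : ∫ ω, (∑ i ∈ Finset.range (l + 1), ξ (m + i) ω) ^ 2 ∂μ =
        ∫ ω, (∑ i ∈ Finset.range l, ξ (m + i) ω) ^ 2 ∂μ +
        (2 * ∫ ω, (∑ i ∈ Finset.range l, ξ (m + i) ω) * ξ (m + l) ω ∂μ +
          ∫ ω, ξ (m + l) ω * ξ (m + l) ω ∂μ) := by
      have i1 : Integrable (fun ω => 2 * ((∑ i ∈ Finset.range l, ξ (m + i) ω) * ξ (m + l) ω)) μ :=
        (hs.integrable_mul (hm (m + l))).const_mul 2
      have i2 : Integrable (fun ω => ξ (m + l) ω * ξ (m + l) ω) μ := (hm _).integrable_mul (hm _)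
      have i3 : Integrable (fun ω => 2 * ((∑ i ∈ Finset.range l, ξ (m + i) ω) * ξ (m + l) ω) +
        ξ (m + l) ω * ξ (m + l) ω) μ := i1.add i2
      rw [← integral_const_mul, ← integral_add i1 i2, ← integral_add hs.integrable_sq i3]
      refine integral_congr_ae (ae_of_all _ fun ω => ?_)
      simp only [Finset.sum_range_succ]
      ring
    have h2 : ∫ ω, (∑ i ∈ Finset.range l, ξ (m + i) ω) * ξ (m + l) ω ∂μ =
        ∑ k ∈ Finset.range l, ρ (k + 1) := by
      simp only [Finset.sum_mul]
      have i1 : ∀ i, Integrable (fun ω => ξ (m + i) ω * ξ (m + l) ω) μ := fun i =>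
        (hm _).integrable_mul (hm _)
      rw [integral_finsetSum _ fun i _ => i1 i, ← Finset.sum_range_reflect]
      refine Finset.sum_congr rfl fun i hi => ?_
      have hi' := Finset.mem_range.1 hi
      rw [← hρ (m + (l - 1 - i)) (i + 1)]
      congr 3
      ext ω
      congr 2
      omega
    have h3 : ∫ ω, ξ (m + l) ω * ξ (m + l) ω ∂μ = ρ 0 := hρ (m + l) 0
    rw [h1, ih, h2, h3, sumVar, sumVar, Finset.sum_range_succ]
    ring

/-- If `∑ (k + 1) |ρ_{k+1}| < ∞`, the variance of a sum of `l` terms is `l σ² + O(1)`. -/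
lemma exists_abs_sumVar_sub_le {ρ : ℕ → ℝ} (h : Summable fun k : ℕ => ((k : ℝ) + 1) * |ρ (k + 1)|) :
    ∃ s C : ℝ, 0 ≤ C ∧ ∀ l : ℕ, |sumVar ρ l - l * s| ≤ C := by
  have hs : Summable fun k : ℕ => |ρ (k + 1)| :=
    Summable.of_nonneg_of_le (fun _ => abs_nonneg _)
      (fun k => le_mul_of_one_le_left (abs_nonneg _) (by linarith [Nat.cast_nonneg (α := ℝ) k])) h
  have hs' : Summable fun k : ℕ => ρ (k + 1) := hs.of_abs
  refine ⟨ρ 0 + 2 * ∑' k, ρ (k + 1), 2 * ∑' k : ℕ, ((k : ℝ) + 1) * |ρ (k + 1)|,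
    mul_nonneg zero_le_two (tsum_nonneg fun k => by positivity), fun l => ?_⟩
  have hmin : Summable fun k : ℕ => min ((k : ℝ) + 1) l * ρ (k + 1) := by
    refine Summable.of_norm_bounded h fun k => ?_
    rw [Real.norm_eq_abs, abs_mul, abs_of_nonneg (by positivity)]
    exact mul_le_mul_of_nonneg_right (min_le_left _ _) (abs_nonneg _)
  have key : sumVar ρ l = l * (ρ 0 + 2 * ∑' k, ρ (k + 1)) -
      2 * ∑' k : ℕ, min ((k : ℝ) + 1) l * ρ (k + 1) := by
    have e1 : ∑' k : ℕ, ((l : ℝ) - min ((k : ℝ) + 1) l) * ρ (k + 1) =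
        l * (∑' k, ρ (k + 1)) - ∑' k : ℕ, min ((k : ℝ) + 1) l * ρ (k + 1) := by
      rw [← tsum_mul_left, ← (hs'.mul_left _).tsum_sub hmin]
      exact tsum_congr fun k => by ring
    have e2 : ∑' k : ℕ, ((l : ℝ) - min ((k : ℝ) + 1) l) * ρ (k + 1) =
        ∑ k ∈ Finset.range l, ((l : ℝ) - (k + 1)) * ρ (k + 1) := by
      rw [tsum_eq_sum (s := Finset.range l)]
      · refine Finset.sum_congr rfl fun k hk => ?_
        rw [min_eq_left (by exact_mod_cast Finset.mem_range.1 hk)]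
      · intro k hk
        have : l ≤ k := by simpa using hk
        have : (l : ℝ) ≤ k := by exact_mod_cast this
        rw [min_eq_right (by linarith), sub_self, zero_mul]
    -- the usual formula `Var S_l = l ρ_0 + 2 ∑ (l - k) ρ_k`
    have e3 : ∀ l : ℕ, sumVar ρ l = l * ρ 0 +
        2 * ∑ k ∈ Finset.range l, ((l : ℝ) - (k + 1)) * ρ (k + 1) := by
      intro l
      induction l with
      | zero => simp [sumVar]
      | succ l ih =>
        rw [sumVar, Finset.sum_range_succ, ← sumVar, ih, Finset.sum_range_succ]
        push_cast
        rw [show ((l : ℝ) + 1 - (l + 1)) = 0 by ring, zero_mul, add_zero]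
        have : ∑ k ∈ Finset.range l, ((l : ℝ) + 1 - (k + 1)) * ρ (k + 1) =
            ∑ k ∈ Finset.range l, ((l : ℝ) - (k + 1)) * ρ (k + 1) +
              ∑ k ∈ Finset.range l, ρ (k + 1) := by
          rw [← Finset.sum_add_distrib]
          exact Finset.sum_congr rfl fun k _ => by ring
        rw [this]; ring
    rw [e3, ← e2, e1]; ring
  rw [key, sub_sub_cancel_left, abs_neg, abs_mul, abs_two]
  refine mul_le_mul_of_nonneg_left ?_ zero_le_two
  have h5 := norm_tsum_le_tsum_norm hmin.norm
  rw [Real.norm_eq_abs] at h5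
  refine h5.trans (Summable.tsum_le_tsum (fun k => ?_) hmin.norm h)
  rw [Real.norm_eq_abs, abs_mul, abs_of_nonneg (by positivity)]
  exact mul_le_mul_of_nonneg_right (min_le_left _ _) (abs_nonneg _)

/-- The summability that makes the variance of the partial sums linear up to a bounded error. -/
lemma StretchedMixing.summable_covariance (H : StretchedMixing μ ℱ ξ c g r)
    (h0 : ∀ i, ∫ ω, ξ i ω ∂μ = 0) {ρ : ℕ → ℝ} (hρ : ∀ i k, ∫ ω, ξ i ω * ξ (i + k) ω ∂μ = ρ k) :
    Summable fun k : ℕ => ((k : ℝ) + 1) * |ρ (k + 1)| := by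
  obtain ⟨C, c', hc', hC⟩ := H.exists_abs_covariance_le h0
  have s1 := summable_rpow_mul_exp_neg 1 c' g hc' H.g_pos
  have s2 := summable_rpow_mul_exp_neg (1 + g * r) c' g hc' H.g_pos
  rw [← summable_nat_add_iff 1]
  have s3 := ((summable_nat_add_iff 1).2 (s1.add s2)).mul_left (2 * C)
  refine Summable.of_nonneg_of_le (fun k => by positivity) (fun k => ?_) s3
  have h1 := hC (k + 1) (by omega)
  have h2 := hρ 0 (k + 1 + 1)
  rw [zero_add] at h2
  rw [h2] at h1
  have hk : (0 : ℝ) < ((k + 1 : ℕ) : ℝ) := by positivity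
  have hk1 : (1 : ℝ) ≤ ((k + 1 : ℕ) : ℝ) := by exact_mod_cast Nat.le_add_left 1 k
  have h3 : 0 ≤ |ρ (k + 1 + 1)| := abs_nonneg _
  rw [Real.rpow_one, Real.rpow_add hk, Real.rpow_one]
  have h4 : 0 ≤ C * ((1 + ((k + 1 : ℕ) : ℝ) ^ (g * r)) * Real.exp (-c' * ((k + 1 : ℕ) : ℝ) ^ g)) :=
    h3.trans h1
  calc (((k + 1 : ℕ) : ℝ) + 1) * |ρ (k + 1 + 1)| ≤ (2 * ((k + 1 : ℕ) : ℝ)) * (C * ((1 +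
      ((k + 1 : ℕ) : ℝ) ^ (g * r)) * Real.exp (-c' * ((k + 1 : ℕ) : ℝ) ^ g))) := by
        apply mul_le_mul _ h1 h3 (by positivity)
        linarith
    _ = _ := by ring

end Variance

/-! ### Exponential moments of truncated sums -/

section ExpMoment

lemma abs_exp_sub_exp_le {a b L : ℝ} (ha : |a| ≤ L) (hb : |b| ≤ L) :
    |Real.exp a - Real.exp b| ≤ Real.exp L * |a - b| := by
  wlog h : b ≤ a generalizing a b
  · rw [abs_sub_comm, abs_sub_comm a]; exact this hb ha (le_of_not_ge h)
  rw [abs_of_nonneg (sub_nonneg.2 (Real.exp_le_exp.2 h)), abs_of_nonneg (sub_nonneg.2 h)]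
  have h1 : Real.exp a - Real.exp b = Real.exp a * (1 - Real.exp (b - a)) := by
    rw [mul_sub, ← Real.exp_add]; ring_nf
  rw [h1]
  have h2 := Real.add_one_le_exp (b - a)
  have h3 := Real.exp_le_exp.2 ((le_abs_self a).trans ha)
  have h4 : 0 ≤ 1 - Real.exp (b - a) := by
    have := Real.exp_le_one_iff.2 (sub_nonpos.2 h); linarith
  exact mul_le_mul h3 (by linarith) h4 (Real.exp_pos _).le

lemma abs_log_sub_log_le {a b : ℝ} {k : ℝ} (hk : 0 < k) (ha : k ≤ a) (hb : k ≤ b) :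
    |Real.log a - Real.log b| ≤ k⁻¹ * |a - b| := by
  wlog h : b ≤ a generalizing a b
  · rw [abs_sub_comm, abs_sub_comm a]; exact this hb ha (le_of_not_ge h)
  have hb0 : 0 < b := hk.trans_le hb
  have ha0 : 0 < a := hk.trans_le ha
  rw [abs_of_nonneg (sub_nonneg.2 (Real.log_le_log hb0 h)), abs_of_nonneg (sub_nonneg.2 h),
    ← Real.log_div ha0.ne' hb0.ne']
  refine (Real.log_le_sub_one_of_pos (by positivity)).trans ?_
  rw [div_sub_one hb0.ne', div_eq_inv_mul]
  exact mul_le_mul_of_nonneg_right (inv_anti₀ hk hb) (sub_nonneg.2 h)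

variable {Ω : Type*} {mΩ : MeasurableSpace Ω} {μ : Measure Ω} [IsProbabilityMeasure μ]

lemma integrable_exp_of_abs_le {f : Ω → ℝ} (hf : Measurable f) {L : ℝ} (hL : ∀ ω, |f ω| ≤ L) :
    Integrable (fun ω => Real.exp (f ω)) μ :=
  Integrable.of_bound hf.exp.aestronglyMeasurable (Real.exp L) (ae_of_all _ fun ω => by
    rw [Real.norm_of_nonneg (Real.exp_pos _).le]
    exact Real.exp_le_exp.2 ((le_abs_self _).trans (hL ω)))

/-- Hölder's inequality for exponential moments of bounded variables. -/
lemma log_integral_exp_add_le {f h : Ω → ℝ} (hf : Measurable f) (hh : Measurable h) {L : ℝ}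
    (hfL : ∀ ω, |f ω| ≤ L) (hhL : ∀ ω, |h ω| ≤ L) {w : ℝ} (hw0 : 0 < w) (hw1 : w < 1) :
    Real.log (∫ ω, Real.exp (f ω + h ω) ∂μ) ≤
      (1 - w) * Real.log (∫ ω, Real.exp (f ω / (1 - w)) ∂μ) +
        w * Real.log (∫ ω, Real.exp (h ω / w) ∂μ) := by
  have hw : 0 < 1 - w := by linarith
  have hpq : (1 / (1 - w)).HolderConjugate (1 / w) := by
    rw [Real.holderConjugate_iff]
    refine ⟨by rw [lt_div_iff₀ hw]; linarith, by simp⟩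
  have hmem : ∀ (k : Ω → ℝ) (p : ℝ≥0∞), Measurable k → (∀ ω, |k ω| ≤ L) →
      MemLp (fun ω => Real.exp (k ω)) p μ := fun k p hk hkL =>
    MemLp.of_bound hk.exp.aestronglyMeasurable (Real.exp L) (ae_of_all _ fun ω => by
      rw [Real.norm_of_nonneg (Real.exp_pos _).le]
      exact Real.exp_le_exp.2 ((le_abs_self _).trans (hkL ω)))
  have h1 := integral_mul_le_Lp_mul_Lq_of_nonneg (μ := μ) hpq
    (ae_of_all _ fun ω => (Real.exp_pos (f ω)).le) (ae_of_all _ fun ω => (Real.exp_pos (h ω)).le)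
    (hmem f _ hf hfL) (hmem h _ hh hhL)
  simp only [← Real.exp_add, ← Real.exp_mul, one_div_one_div, mul_one_div] at h1
  have hL0 : ∀ ω : Ω, 0 ≤ L := fun ω => (abs_nonneg _).trans (hfL ω)
  have hpos : ∀ k : Ω → ℝ, Measurable k → ∀ L', (∀ ω, |k ω| ≤ L') →
      0 < ∫ ω, Real.exp (k ω) ∂μ := fun k hk L' hkL =>
    integral_exp_pos (integrable_exp_of_abs_le hk hkL)
  have p1 := hpos _ (hf.div_const (1 - w)) (L / (1 - w)) fun ω => by
    rw [abs_div, abs_of_pos hw]; gcongr; exact hfL ω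
  have p2 := hpos _ (hh.div_const w) (L / w) fun ω => by
    rw [abs_div, abs_of_pos hw0]; gcongr; exact hhL ω
  have p3 := hpos _ (hf.add hh) (L + L) fun ω => (abs_add_le _ _).trans (add_le_add (hfL ω) (hhL ω))
  simp only [Pi.add_apply] at p3
  have h2 := Real.log_le_log p3 h1
  rwa [Real.log_mul (Real.rpow_pos_of_pos p1 _).ne' (Real.rpow_pos_of_pos p2 _).ne',
    Real.log_rpow p1, Real.log_rpow p2] at h2

/-- The constant `C` controls the `L²`-norms of the `ξ_i` and the `L²`-errors of truncation. -/
def TruncationBound (μ : Measure Ω) (ξ : ℕ → Ω → ℝ) (r C : ℝ) : Prop :=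
  1 ≤ C ∧ ∀ i, ∫ ω, ξ i ω ^ 2 ∂μ ≤ C ^ 2 ∧ ∀ D : ℝ, 0 < D →
      ∫ ω, (ξ i ω - clip (D ^ r) (ξ i ω)) ^ 2 ∂μ ≤ (C * Real.exp (-D / 4)) ^ 2

/-- The exponential moment `E exp(u S)` of the sum of `l` variables, starting at the index `m`,
truncated at the level `M`. -/
noncomputable def expMoment (μ : Measure Ω) (ξ : ℕ → Ω → ℝ) (M u : ℝ) (m l : ℕ) : ℝ :=
  ∫ ω, Real.exp (u * truncSum ξ M m l ω) ∂μ

variable {ℱ : ℕ → MeasurableSpace Ω} {ξ : ℕ → Ω → ℝ} {c g r C : ℝ}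

lemma abs_mul_truncSum_le {M : ℝ} (hM : 0 ≤ M) (u : ℝ) (m l : ℕ) (ω : Ω) :
    |u * truncSum ξ M m l ω| ≤ |u| * M * l := by
  rw [abs_mul, mul_assoc]; gcongr; exact abs_truncSum_le hM _ _ _ _

/-- Two truncation levels give the same sum unless some variable exceeds the lower one. -/
lemma StretchedMixing.abs_expMoment_sub_le (H : StretchedMixing μ ℱ ξ c g r) {D M u N : ℝ}
    (hD : 0 < D) (hDM : D ^ r ≤ M) (m l : ℕ) (hN : |u| * M * l ≤ N) :
    |expMoment μ ξ M u m l - expMoment μ ξ (D ^ r) u m l| ≤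
      2 * Real.exp N * (l * Real.exp (1 - D)) := by
  have hD0 : 0 ≤ D ^ r := Real.rpow_nonneg hD.le _
  have hM : 0 ≤ M := hD0.trans hDM
  set A : Set Ω := ⋃ i ∈ Finset.range l, {ω | D ^ r < |ξ (m + i) ω|} with hA
  have hAm : MeasurableSet A := Finset.measurableSet_biUnion _ fun i _ =>
    measurableSet_lt measurable_const (H.meas _).abs
  have hμA : μ.real A ≤ l * Real.exp (1 - D) := by
    refine (measureReal_biUnion_finset_le _ _).trans ?_
    refine (Finset.sum_le_sum fun i _ => H.tail (m + i) D hD).trans ?_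
    simp
  have b1 : ∀ ω, |u * truncSum ξ M m l ω| ≤ N := fun ω => (abs_mul_truncSum_le hM _ _ _ _).trans hN
  have b2 : ∀ ω, |u * truncSum ξ (D ^ r) m l ω| ≤ N := fun ω =>
    (abs_mul_truncSum_le hD0 _ _ _ _).trans (le_trans (by gcongr) hN)
  unfold expMoment
  rw [← integral_sub (integrable_exp_of_abs_le ((H.measurable_truncSum _ _ _).const_mul u) b1)
    (integrable_exp_of_abs_le ((H.measurable_truncSum _ _ _).const_mul u) b2)]
  refine abs_integral_le_integral_abs.trans ?_
  have hle : ∀ ω, |Real.exp (u * truncSum ξ M m l ω) - Real.exp (u * truncSum ξ (D ^ r) m l ω)| ≤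
      A.indicator (fun _ => 2 * Real.exp N) ω := by
    intro ω
    by_cases hω : ω ∈ A
    · rw [Set.indicator_of_mem hω]
      refine (abs_sub _ _).trans ?_
      rw [abs_of_pos (Real.exp_pos _), abs_of_pos (Real.exp_pos _)]
      linarith [Real.exp_le_exp.2 ((le_abs_self _).trans (b1 ω)),
        Real.exp_le_exp.2 ((le_abs_self _).trans (b2 ω))]
    · rw [Set.indicator_of_notMem hω]
      have h1 : ∀ i ∈ Finset.range l, |ξ (m + i) ω| ≤ D ^ r := by
        simpa [hA] using hω
      have : truncSum ξ M m l ω = truncSum ξ (D ^ r) m l ω :=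
        Finset.sum_congr rfl fun i hi => by
          rw [clip_of_abs_le (h1 i hi), clip_of_abs_le ((h1 i hi).trans hDM)]
      rw [this]; simp
  refine (integral_mono_of_nonneg (ae_of_all _ fun _ => abs_nonneg _)
    ((integrable_const _).indicator hAm) (ae_of_all _ hle)).trans ?_
  rw [integral_indicator_const _ hAm, smul_eq_mul, mul_comm]
  gcongr

/-- Decoupling of the exponential moment of two blocks at distance `d`. The factor `exp N` is the price
of the size and of the Lipschitz constant of the exponential, and has to be beaten by the mixing
coefficient. -/
lemma StretchedMixing.abs_integral_exp_sub_le (H : StretchedMixing μ ℱ ξ c g r) {M u N : ℝ}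
    (hM : 0 ≤ M) (m l₁ d l₂ : ℕ) (hd : 1 ≤ d) (hN : |u| * M * (l₁ + l₂) ≤ N) :
    |∫ ω, Real.exp (u * (truncSum ξ M m l₁ ω + truncSum ξ M (m + l₁ + d) l₂ ω)) ∂μ -
      expMoment μ ξ M u m l₁ * expMoment μ ξ M u (m + l₁ + d) l₂| ≤
      |u| * Real.exp N * l₂ * Real.exp (-c * (d : ℝ) ^ g) := by
  have hbd : ∀ (l : ℕ) y, |u * clip (M * l) y| ≤ |u| * M * l := fun l y => by
    rw [abs_mul, mul_assoc]; gcongr; exact abs_clip_le (by positivity) _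
  have hexp : ∀ (l : ℕ) y, Real.exp (u * clip (M * l) y) ≤ Real.exp (|u| * M * l) := fun l y =>
    Real.exp_le_exp.2 ((le_abs_self _).trans (hbd l y))
  -- a sum of `l` truncated variables is bounded by `M l`, so that clipping the arguments at this level
  -- changes nothing and makes the test function bounded and Lipschitz
  have h := H.decouple (m + l₁) d (m + l₁ + d) l₂ M (truncSum ξ M m l₁)
    (fun w y => Real.exp (u * clip (M * l₁) w) * Real.exp (u * clip (M * l₂) y))
    (Real.exp N) (|u| * Real.exp N).toNNReal hd le_rfl (H.measurable_past_truncSum M le_rfl)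
    ((((measurable_clip _).comp measurable_fst).const_mul u).exp.mul
      (((measurable_clip _).comp measurable_snd).const_mul u).exp)
    (fun w y => by
      rw [abs_of_pos (by positivity), ← Real.exp_add, Real.exp_le_exp]
      linarith [le_abs_self (u * clip (M * l₁) w), le_abs_self (u * clip (M * l₂) y),
        hbd l₁ w, hbd l₂ y])
    (fun w => LipschitzWith.of_dist_le_mul fun x y => by
      rw [Real.dist_eq, Real.dist_eq, ← mul_sub, abs_mul, abs_of_pos (Real.exp_pos _),
        Real.coe_toNNReal _ (by positivity)]
      have h1 := abs_exp_sub_exp_le (hbd l₂ x) (hbd l₂ y)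
      calc Real.exp (u * clip (M * l₁) w) *
            |Real.exp (u * clip (M * l₂) x) - Real.exp (u * clip (M * l₂) y)|
          ≤ Real.exp (|u| * M * l₁) * (Real.exp (|u| * M * l₂) * (|u| * |x - y|)) := by
            refine mul_le_mul (hexp _ _) (h1.trans ?_) (abs_nonneg _) (Real.exp_pos _).le
            rw [← mul_sub, abs_mul]
            exact mul_le_mul_of_nonneg_left (mul_le_mul_of_nonneg_left
              (abs_clip_sub_clip_le _ _ _) (abs_nonneg u)) (Real.exp_pos _).le
        _ = |u| * Real.exp (|u| * M * l₁ + |u| * M * l₂) * |x - y| := by rw [Real.exp_add]; ring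
        _ ≤ _ := by gcongr; linarith)
  have e1 : ∀ (m' l : ℕ) ω, clip (M * l) (truncSum ξ M m' l ω) = truncSum ξ M m' l ω :=
    fun m' l ω => clip_of_abs_le (abs_truncSum_le hM _ _ _ _)
  have e2 : ∀ ω, ∑ i ∈ Finset.range l₂, clip M (ξ (m + l₁ + d + i) ω) =
    truncSum ξ M (m + l₁ + d) l₂ ω := fun ω => rfl
  simp only [e2, e1, integral_const_mul, integral_mul_const,
    Real.coe_toNNReal _ (show 0 ≤ |u| * Real.exp N by positivity)] at h
  simpa only [expMoment, mul_add, Real.exp_add] using h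

lemma StretchedMixing.integrable_truncSum (H : StretchedMixing μ ℱ ξ c g r) {M : ℝ} (hM : 0 ≤ M)
    (m l : ℕ) : Integrable (truncSum ξ M m l) μ :=
  Integrable.of_bound (H.measurable_truncSum _ _ _).aestronglyMeasurable (M * l)
    (ae_of_all _ fun _ => abs_truncSum_le hM _ _ _ _)

lemma StretchedMixing.abs_integral_truncSum_le (H : StretchedMixing μ ℱ ξ c g r)
    (h0 : ∀ i, ∫ ω, ξ i ω ∂μ = 0) (hC : TruncationBound μ ξ r C) {D : ℝ} (hD : 0 < D) (m l : ℕ) :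
    |∫ ω, truncSum ξ (D ^ r) m l ω ∂μ| ≤ l * (C * Real.exp (-D / 4)) := by
  unfold truncSum
  rw [integral_finsetSum _ fun i _ =>
    (H.memLp_clip (Real.rpow_nonneg hD.le r) (m + i)).integrable (by norm_num)]
  refine (Finset.abs_sum_le_sum_abs _ _).trans ?_
  refine (Finset.sum_le_sum fun i _ => H.abs_integral_clip_le h0 hC.1 hD ((hC.2 _).2 D hD)).trans ?_
  simp

lemma one_add_integral_le_integral_exp {f : Ω → ℝ} (hf : Measurable f) {L : ℝ}
    (hL : ∀ ω, |f ω| ≤ L) : 1 + ∫ ω, f ω ∂μ ≤ ∫ ω, Real.exp (f ω) ∂μ := by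
  have hi : Integrable f μ := Integrable.of_bound hf.aestronglyMeasurable L (ae_of_all _ hL)
  have h1 : ∫ ω, (f ω + 1) ∂μ ≤ ∫ ω, Real.exp (f ω) ∂μ :=
    integral_mono (hi.add (integrable_const _)) (integrable_exp_of_abs_le hf hL)
      fun ω => Real.add_one_le_exp _
  rw [integral_add hi (integrable_const _)] at h1
  simpa [add_comm] using h1

/-- As `exp z ≥ 1 + z`, exponential moments are at least `1`, up to the mean that truncation creates. -/
lemma StretchedMixing.one_sub_le_expMoment (H : StretchedMixing μ ℱ ξ c g r)
    (h0 : ∀ i, ∫ ω, ξ i ω ∂μ = 0) (hC : TruncationBound μ ξ r C) {D u : ℝ} (hD : 0 < D)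
    (m l : ℕ) : 1 - |u| * l * (C * Real.exp (-D / 4)) ≤ expMoment μ ξ (D ^ r) u m l := by
  have hM := Real.rpow_nonneg hD.le r
  have h1 := one_add_integral_le_integral_exp (μ := μ)
    ((H.measurable_truncSum (D ^ r) m l).const_mul u) (abs_mul_truncSum_le hM u m l)
  rw [integral_const_mul] at h1
  have h2 := abs_mul u (∫ ω, truncSum ξ (D ^ r) m l ω ∂μ)
  have h3 := mul_le_mul_of_nonneg_left (H.abs_integral_truncSum_le h0 hC hD m l) (abs_nonneg u)
  have h4 := neg_abs_le (u * ∫ ω, truncSum ξ (D ^ r) m l ω ∂μ)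
  unfold expMoment
  nlinarith

/-- The second moment of a truncated sum is the variance of the sum, up to an error of order
`exp(-D/4)`. -/
lemma StretchedMixing.abs_integral_sq_truncSum_sub_le (H : StretchedMixing μ ℱ ξ c g r)
    (hC : TruncationBound μ ξ r C) {ρ : ℕ → ℝ} (hρ : ∀ i k, ∫ ω, ξ i ω * ξ (i + k) ω ∂μ = ρ k)
    {D : ℝ} (hD : 0 < D) (m l : ℕ) :
    |∫ ω, truncSum ξ (D ^ r) m l ω ^ 2 ∂μ - sumVar ρ l| ≤
      l ^ 2 * (2 * C ^ 2 * Real.exp (-D / 4)) := by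
  have hM := Real.rpow_nonneg hD.le r
  have hC1 := hC.1
  set e := C * Real.exp (-D / 4) with he
  have he0 : 0 ≤ e := by positivity
  -- truncating the factors of a product one after the other
  have key : ∀ i j, |∫ ω, (clip (D ^ r) (ξ i ω) * clip (D ^ r) (ξ j ω) - ξ i ω * ξ j ω) ∂μ| ≤
      2 * C * e := by
    intro i j
    have hi := H.memLp_two i
    have hj := H.memLp_two j
    have ci := H.memLp_clip hM i
    have cj := H.memLp_clip hM j
    have h1 : |∫ ω, (ξ i ω - clip (D ^ r) (ξ i ω)) * ξ j ω ∂μ| ≤ e * C :=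
      (abs_integral_mul_le_sqrt_mul_sqrt (hi.sub ci) hj).trans
        (mul_le_mul (sqrt_integral_le he0 ((hC.2 i).2 D hD))
          (sqrt_integral_le (by positivity) (hC.2 j).1) (Real.sqrt_nonneg _) he0)
    have h2 : |∫ ω, clip (D ^ r) (ξ i ω) * (ξ j ω - clip (D ^ r) (ξ j ω)) ∂μ| ≤ C * e :=
      (abs_integral_mul_le_sqrt_mul_sqrt ci (hj.sub cj)).trans
        (mul_le_mul (sqrt_integral_le (by positivity)
          ((integral_sq_clip_le hi hM).trans (hC.2 i).1))
          (sqrt_integral_le he0 ((hC.2 j).2 D hD)) (Real.sqrt_nonneg _) (by positivity))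
    have hi1 : Integrable (fun ω => (ξ i ω - clip (D ^ r) (ξ i ω)) * ξ j ω) μ :=
      (hi.sub ci).integrable_mul hj
    have hi2 : Integrable (fun ω => clip (D ^ r) (ξ i ω) * (ξ j ω - clip (D ^ r) (ξ j ω))) μ :=
      ci.integrable_mul (hj.sub cj)
    have : ∫ ω, (clip (D ^ r) (ξ i ω) * clip (D ^ r) (ξ j ω) - ξ i ω * ξ j ω) ∂μ =
        -(∫ ω, (ξ i ω - clip (D ^ r) (ξ i ω)) * ξ j ω ∂μ +
          ∫ ω, clip (D ^ r) (ξ i ω) * (ξ j ω - clip (D ^ r) (ξ j ω)) ∂μ) := by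
      rw [← integral_add hi1 hi2, ← integral_neg]
      exact integral_congr_ae (ae_of_all _ fun ω => by ring)
    rw [this, abs_neg]
    refine (abs_add_le _ _).trans ?_
    linarith
  have ip : ∀ i j, Integrable (fun ω => clip (D ^ r) (ξ i ω) * clip (D ^ r) (ξ j ω)) μ :=
    fun i j => (H.memLp_clip hM i).integrable_mul (H.memLp_clip hM j)
  have iq : ∀ i j, Integrable (fun ω => ξ i ω * ξ j ω) μ :=
    fun i j => (H.memLp_two i).integrable_mul (H.memLp_two j)
  have hexp : ∫ ω, truncSum ξ (D ^ r) m l ω ^ 2 ∂μ - sumVar ρ l =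
      ∑ i ∈ Finset.range l, ∑ j ∈ Finset.range l,
        ∫ ω, (clip (D ^ r) (ξ (m + i) ω) * clip (D ^ r) (ξ (m + j) ω) -
          ξ (m + i) ω * ξ (m + j) ω) ∂μ := by
    rw [← integral_sq_sum_eq H.memLp_two hρ m l]
    unfold truncSum
    simp only [sq, Finset.sum_mul_sum]
    rw [integral_finsetSum _ fun i _ => integrable_finsetSum _ fun j _ => ip _ _,
      integral_finsetSum _ fun i _ => integrable_finsetSum _ fun j _ => iq _ _,
      ← Finset.sum_sub_distrib]
    refine Finset.sum_congr rfl fun i _ => ?_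
    rw [integral_finsetSum _ fun j _ => ip _ _, integral_finsetSum _ fun j _ => iq _ _,
      ← Finset.sum_sub_distrib]
    exact Finset.sum_congr rfl fun j _ => (integral_sub (ip _ _) (iq _ _)).symm
  rw [hexp]
  refine (Finset.abs_sum_le_sum_abs _ _).trans ?_
  refine (Finset.sum_le_sum fun i _ => (Finset.abs_sum_le_sum_abs _ _).trans
    (Finset.sum_le_sum fun j _ => key _ _)).trans (le_of_eq ?_)
  simp only [Finset.sum_const, Finset.card_range, nsmul_eq_mul, he]
  ring

end ExpMoment

/-! ### Log-Laplace transforms of blocks -/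

section LogLaplace

variable {Ω : Type*} {mΩ : MeasurableSpace Ω} {μ : Measure Ω} [IsProbabilityMeasure μ]
  {ℱ : ℕ → MeasurableSpace Ω} {ξ : ℕ → Ω → ℝ} {c g r C : ℝ}

/-- The log-Laplace transform `log E exp(u S)` of a truncated sum. -/
noncomputable def logLaplace (μ : Measure Ω) (ξ : ℕ → Ω → ℝ) (M u : ℝ) (m l : ℕ) : ℝ :=
  Real.log (expMoment μ ξ M u m l)

lemma abs_exp_sub_quadratic_le {x θ : ℝ} (hx : |x| ≤ θ) (hθ : θ ≤ 1) :
    |Real.exp x - (1 + x + x ^ 2 / 2)| ≤ θ * x ^ 2 := by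
  have h := Real.exp_bound (hx.trans hθ) (n := 3) (by norm_num)
  simp only [Finset.sum_range_succ, Finset.sum_range_zero] at h
  norm_num [Nat.factorial] at h
  have e : |x| ^ 3 = |x| * x ^ 2 := by rw [← sq_abs x]; ring
  rw [e] at h
  refine h.trans ?_
  have : |x| * x ^ 2 ≤ θ * x ^ 2 := by gcongr
  have : 0 ≤ |x| * x ^ 2 := by positivity
  linarith

lemma sub_sq_le_log {Z : ℝ} (hZ : 1 / 2 ≤ Z) : Z - 1 - 2 * (Z - 1) ^ 2 ≤ Real.log Z := by
  have hZ0 : 0 < Z := by linarith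
  refine le_trans ?_ (Real.one_sub_inv_le_log_of_pos hZ0)
  have h2 : 1 - Z⁻¹ - (Z - 1 - 2 * (Z - 1) ^ 2) = (Z - 1) ^ 2 * (2 - Z⁻¹) := by
    field_simp; ring
  have h4 : Z⁻¹ ≤ 2 := by rw [inv_le_comm₀ hZ0 two_pos]; linarith
  nlinarith [mul_nonneg (sq_nonneg (Z - 1)) (sub_nonneg.2 h4)]

/-- If `Z` is close to `1 + a + y / 2` with `y` small and `a` negligible, then `log Z` is close to
`y / 2`; here `v` is an approximation of `y`, and `k` bounds the additive errors. -/
lemma log_bounds_of_quadratic {Z a y v k e θ : ℝ} (hθ0 : 0 ≤ θ) (hθ : θ ≤ 1 / 6) (hy0 : 0 ≤ y)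
    (hy : y ≤ θ ^ 2) (ha : |a| ≤ e) (he : e ≤ 1 / 4) (hek : e ≤ k)
    (hZ : |Z - (1 + a + y / 2)| ≤ θ * y) (hv : |y - v| ≤ 2 * k) :
    (1 - 6 * θ) * v / 2 - 4 * k ≤ Real.log Z ∧ Real.log Z ≤ (1 + 2 * θ) * v / 2 + 4 * k := by
  have he0 : 0 ≤ e := (abs_nonneg _).trans ha
  rw [abs_le] at hZ ha hv
  have hθy : 0 ≤ θ * y := mul_nonneg hθ0 hy0
  have hθy' : θ * y ≤ 1 / 6 * y := by gcongr
  have hZ1 : 3 / 4 ≤ Z := by linarith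
  have hθk : θ * k ≤ 1 / 6 * k := by gcongr; linarith
  constructor
  · refine le_trans ?_ (sub_sq_le_log (by linarith))
    have hab : |Z - 1| ≤ e + y := by rw [abs_le]; constructor <;> linarith
    have hsq : (Z - 1) ^ 2 ≤ (e + y) ^ 2 := by
      rw [← sq_abs]; exact pow_le_pow_left₀ (abs_nonneg _) hab 2
    have h5 : (e + y) ^ 2 ≤ 2 * e ^ 2 + 2 * y ^ 2 := by nlinarith [sq_nonneg (e - y)]
    have h6 : e ^ 2 ≤ 1 / 4 * e := by rw [sq]; gcongr
    have h7 : y ^ 2 ≤ θ ^ 2 * y := by rw [sq y]; gcongr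
    have h8 : θ ^ 2 * y ≤ 1 / 6 * (θ * y) := by
      rw [sq, mul_assoc]; exact mul_le_mul_of_nonneg_right hθ hθy
    have h9 : (1 - 6 * θ) * v ≤ (1 - 6 * θ) * (y + 2 * k) :=
      mul_le_mul_of_nonneg_left (by linarith) (by linarith)
    have h10 : (1 - 6 * θ) * (y + 2 * k) = y - 6 * (θ * y) + 2 * k - 12 * (θ * k) := by ring
    have h11 : 0 ≤ θ * k := mul_nonneg hθ0 (he0.trans hek)
    linarith
  · refine (Real.log_le_sub_one_of_pos (by linarith)).trans ?_
    have h9 : (1 + 2 * θ) * y ≤ (1 + 2 * θ) * (v + 2 * k) :=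
      mul_le_mul_of_nonneg_left (by linarith) (by linarith)
    have h10 : (1 + 2 * θ) * (v + 2 * k) = (1 + 2 * θ) * v + 2 * k + 4 * (θ * k) := by ring
    linarith

/-- The expansion `log E exp(u S) ≈ u² Var(S) / 2` when `|u S| ≤ θ` is small. -/
lemma StretchedMixing.logLaplace_small (H : StretchedMixing μ ℱ ξ c g r)
    (h0 : ∀ i, ∫ ω, ξ i ω ∂μ = 0) (hC : TruncationBound μ ξ r C) {ρ : ℕ → ℝ}
    (hρ : ∀ i k, ∫ ω, ξ i ω * ξ (i + k) ω ∂μ = ρ k) {D u θ : ℝ} (hD : 1 ≤ D) (hθ : θ ≤ 1 / 6)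
    {m l : ℕ} (hu : |u| * D ^ r * l ≤ θ) (hCD : C * Real.exp (-D / 4) ≤ 1 / 4) :
    u ^ 2 / 2 * ((1 - 6 * θ) * sumVar ρ l) - 4 * C ^ 2 * Real.exp (-D / 4)
        ≤ logLaplace μ ξ (D ^ r) u m l ∧
      logLaplace μ ξ (D ^ r) u m l ≤
        u ^ 2 / 2 * ((1 + 2 * θ) * sumVar ρ l) + 4 * C ^ 2 * Real.exp (-D / 4) := by
  have hD0 : 0 < D := by linarith
  have hM : 0 ≤ D ^ r := Real.rpow_nonneg hD0.le r
  have hM1 : 1 ≤ D ^ r := Real.one_le_rpow hD H.r_nonneg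
  have hθ0 : 0 ≤ θ := le_trans (by positivity) hu
  have hul : |u| * l ≤ θ := by
    refine le_trans ?_ hu
    rw [mul_right_comm]
    exact le_mul_of_one_le_right (by positivity) hM1
  have hC1 := hC.1
  set E := Real.exp (-D / 4) with hE
  have hE0 : 0 < E := Real.exp_pos _
  set S := truncSum ξ (D ^ r) m l with hS
  have hSm : Measurable S := H.measurable_truncSum _ _ _
  have hbd : ∀ ω, |u * S ω| ≤ θ := fun ω => (abs_mul_truncSum_le hM u m l ω).trans hu
  have hSi : Integrable S μ := H.integrable_truncSum hM m l
  have hS2i : Integrable (fun ω => S ω ^ 2) μ :=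
    Integrable.of_bound (hSm.pow_const 2).aestronglyMeasurable ((D ^ r * l) ^ 2)
      (ae_of_all _ fun ω => by
        rw [norm_pow, Real.norm_eq_abs]
        exact pow_le_pow_left₀ (abs_nonneg _) (abs_truncSum_le hM _ _ _ _) 2)
  set V := ∫ ω, S ω ^ 2 ∂μ with hV
  have hV0 : 0 ≤ V := integral_nonneg fun ω => sq_nonneg _
  set A := ∫ ω, S ω ∂μ with hA
  set Z := expMoment μ ξ (D ^ r) u m l with hZ
  -- the Taylor expansion, integrated
  have hT : |Z - (1 + u * A + u ^ 2 * V / 2)| ≤ θ * (u ^ 2 * V) := by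
    have hq : Integrable (fun ω => 1 + u * S ω + u ^ 2 * S ω ^ 2 / 2) μ :=
      ((integrable_const _).add (hSi.const_mul u)).add ((hS2i.const_mul _).div_const _)
    have hq1 : Integrable (fun ω => 1 + u * S ω) μ := (integrable_const _).add (hSi.const_mul u)
    have e1 : ∫ ω, (1 + u * S ω + u ^ 2 * S ω ^ 2 / 2) ∂μ = 1 + u * A + u ^ 2 * V / 2 := by
      rw [integral_add hq1 ((hS2i.const_mul _).div_const _),
        integral_add (integrable_const _) (hSi.const_mul u), integral_const_mul, integral_div,
        integral_const_mul]
      simp [hA, hV]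
    rw [← e1, hZ, expMoment, ← integral_sub
      (integrable_exp_of_abs_le (hSm.const_mul u) hbd) hq]
    refine abs_integral_le_integral_abs.trans ?_
    have e2 : θ * (u ^ 2 * V) = ∫ ω, θ * (u ^ 2 * S ω ^ 2) ∂μ := by
      rw [integral_const_mul, integral_const_mul]
    rw [e2]
    refine integral_mono_of_nonneg (ae_of_all _ fun _ => abs_nonneg _)
      ((hS2i.const_mul _).const_mul _) (ae_of_all _ fun ω => ?_)
    have := abs_exp_sub_quadratic_le (hbd ω) (by linarith)
    simpa only [mul_pow] using this
  have hAb : |u * A| ≤ C * E := by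
    rw [abs_mul]
    have h1 := H.abs_integral_truncSum_le (μ := μ) h0 hC hD0 m l
    calc |u| * |A| ≤ |u| * (l * (C * E)) := by gcongr
      _ = (|u| * l) * (C * E) := by ring
      _ ≤ 1 * (C * E) := by gcongr; linarith
      _ = _ := one_mul _
  have hVb : |V - sumVar ρ l| ≤ l ^ 2 * (2 * C ^ 2 * E) :=
    H.abs_integral_sq_truncSum_sub_le hC hρ hD0 m l
  have hul2 : u ^ 2 * (l : ℝ) ^ 2 ≤ 1 := by
    have : (|u| * l) ^ 2 ≤ 1 := pow_le_one₀ (by positivity) (by linarith)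
    rwa [mul_pow, sq_abs] at this
  have huV : |u ^ 2 * V - u ^ 2 * sumVar ρ l| ≤ 2 * C ^ 2 * E := by
    rw [← mul_sub, abs_mul, abs_of_nonneg (sq_nonneg u)]
    calc u ^ 2 * |V - sumVar ρ l| ≤ u ^ 2 * (l ^ 2 * (2 * C ^ 2 * E)) := by gcongr
      _ = (u ^ 2 * l ^ 2) * (2 * C ^ 2 * E) := by ring
      _ ≤ 1 * (2 * C ^ 2 * E) := by gcongr
      _ = _ := one_mul _
  have huVθ : u ^ 2 * V ≤ θ ^ 2 := by
    have : ∫ ω, (u * S ω) ^ 2 ∂μ ≤ ∫ _ω, θ ^ 2 ∂μ :=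
      integral_mono_of_nonneg (ae_of_all _ fun _ => sq_nonneg _) (integrable_const _)
        (ae_of_all _ fun ω => by
          have := pow_le_pow_left₀ (abs_nonneg _) (hbd ω) 2
          rwa [sq_abs] at this)
    simp only [mul_pow, integral_const_mul, integral_const, probReal_univ, smul_eq_mul,
      one_mul] at this
    exact this
  have hCE : C * E ≤ C ^ 2 * E := by
    gcongr
    exact le_self_pow₀ hC1 two_ne_zero
  rw [mul_assoc] at huV
  have h2 := log_bounds_of_quadratic hθ0 hθ (mul_nonneg (sq_nonneg u) hV0) huVθ hAb hCD
    hCE hT huV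
  have e3 : ∀ b, u ^ 2 / 2 * (b * sumVar ρ l) = b * (u ^ 2 * sumVar ρ l) / 2 := fun b => by ring
  rw [e3, e3, mul_assoc 4]
  exact h2

/-- Exponential moments are bounded below, so that their logarithms are as close as they are. -/
lemma StretchedMixing.half_le_expMoment (H : StretchedMixing μ ℱ ξ c g r)
    (h0 : ∀ i, ∫ ω, ξ i ω ∂μ = 0) (hC : TruncationBound μ ξ r C) {D u N : ℝ} (hD : 1 ≤ D)
    {m l : ℕ} (hN : |u| * D ^ r * l ≤ N) (hNC : N * (C * Real.exp (-D / 4)) ≤ 1 / 2) :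
    1 / 2 ≤ expMoment μ ξ (D ^ r) u m l := by
  refine le_trans ?_ (H.one_sub_le_expMoment h0 hC (by linarith) m l)
  have hul : |u| * l ≤ N := by
    refine le_trans ?_ hN
    rw [mul_right_comm]
    exact le_mul_of_one_le_right (by positivity) (Real.one_le_rpow hD H.r_nonneg)
  have hC1 := hC.1
  have : |u| * l * (C * Real.exp (-D / 4)) ≤ N * (C * Real.exp (-D / 4)) := by gcongr
  linarith

/-- Lowering the truncation level from `D ^ r` to `D' ^ r`. -/
lemma StretchedMixing.abs_logLaplace_sub_le (H : StretchedMixing μ ℱ ξ c g r)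
    (h0 : ∀ i, ∫ ω, ξ i ω ∂μ = 0) (hC : TruncationBound μ ξ r C) {D D' u N : ℝ} (hD' : 1 ≤ D')
    (hDD : D' ≤ D) {m l : ℕ} (hN : |u| * D ^ r * l ≤ N)
    (hNC : N * (C * Real.exp (-D' / 4)) ≤ 1 / 2) :
    |logLaplace μ ξ (D ^ r) u m l - logLaplace μ ξ (D' ^ r) u m l| ≤
      4 * Real.exp N * (l * Real.exp (1 - D')) := by
  have hMM : D' ^ r ≤ D ^ r := Real.rpow_le_rpow (by linarith) hDD H.r_nonneg
  have hN0 : 0 ≤ N := le_trans (by have := Real.rpow_nonneg (show (0:ℝ) ≤ D by linarith) r; positivity) hN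
  have hC1 := hC.1
  have hE : Real.exp (-D / 4) ≤ Real.exp (-D' / 4) := Real.exp_le_exp.2 (by linarith)
  have z1 := H.half_le_expMoment h0 hC (hD'.trans hDD) (m := m) hN
    (le_trans (by gcongr) hNC)
  have z2 := H.half_le_expMoment h0 hC hD' (m := m) (le_trans (by gcongr) hN) hNC
  refine (abs_log_sub_log_le (by norm_num) z1 z2).trans ?_
  have h1 := H.abs_expMoment_sub_le (μ := μ) (by linarith) hMM m l hN
  norm_num at h1 ⊢
  linarith

/-- Decoupling of two blocks at distance `d`, for logarithms of exponential moments. -/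
lemma StretchedMixing.abs_log_integral_exp_sub_le (H : StretchedMixing μ ℱ ξ c g r)
    (h0 : ∀ i, ∫ ω, ξ i ω ∂μ = 0) (hC : TruncationBound μ ξ r C) {D u N : ℝ} (hD : 1 ≤ D)
    {m l₁ d l₂ : ℕ} (hd : 1 ≤ d) (hN : |u| * D ^ r * (l₁ + l₂) ≤ N)
    (hNC : N * (C * Real.exp (-D / 4)) ≤ 1 / 2) :
    |Real.log (∫ ω, Real.exp (u * (truncSum ξ (D ^ r) m l₁ ω +
        truncSum ξ (D ^ r) (m + l₁ + d) l₂ ω)) ∂μ) -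
      (logLaplace μ ξ (D ^ r) u m l₁ + logLaplace μ ξ (D ^ r) u (m + l₁ + d) l₂)| ≤
      4 * Real.exp (2 * N - c * (d : ℝ) ^ g) := by
  have hD0 : 0 < D := by linarith
  have hM : 0 ≤ D ^ r := Real.rpow_nonneg hD0.le r
  have hM1 : 1 ≤ D ^ r := Real.one_le_rpow hD H.r_nonneg
  have hC1 := hC.1
  rw [mul_add] at hN
  have n1 : 0 ≤ |u| * D ^ r * l₁ := by positivity
  have n2 : 0 ≤ |u| * D ^ r * l₂ := by positivity
  have z1 := H.half_le_expMoment h0 hC hD (m := m) (l := l₁) (u := u) (N := N) (by linarith) hNC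
  have z2 := H.half_le_expMoment h0 hC hD (m := m + l₁ + d) (l := l₂) (u := u) (N := N)
    (by linarith) hNC
  -- both exponential moments that are compared are at least `1 / 4`
  have z12 : 1 / 4 ≤ expMoment μ ξ (D ^ r) u m l₁ * expMoment μ ξ (D ^ r) u (m + l₁ + d) l₂ := by
    calc (1 / 4 : ℝ) = 1 / 2 * (1 / 2) := by norm_num
      _ ≤ _ := by gcongr
  have z3 : 1 / 4 ≤ ∫ ω, Real.exp (u * (truncSum ξ (D ^ r) m l₁ ω +
        truncSum ξ (D ^ r) (m + l₁ + d) l₂ ω)) ∂μ := by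
    refine le_trans ?_ (one_add_integral_le_integral_exp (L := N)
      (((H.measurable_truncSum _ _ _).add (H.measurable_truncSum _ _ _)).const_mul u) fun ω => ?_)
    · rw [integral_const_mul, integral_add (H.integrable_truncSum hM _ _)
        (H.integrable_truncSum hM _ _)]
      have a1 := H.abs_integral_truncSum_le h0 hC hD0 m l₁
      have a2 := H.abs_integral_truncSum_le h0 hC hD0 (m + l₁ + d) l₂
      have a3 := abs_add_le (∫ ω, truncSum ξ (D ^ r) m l₁ ω ∂μ)
        (∫ ω, truncSum ξ (D ^ r) (m + l₁ + d) l₂ ω ∂μ)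
      have a4 := neg_abs_le (u * (∫ ω, truncSum ξ (D ^ r) m l₁ ω ∂μ +
        ∫ ω, truncSum ξ (D ^ r) (m + l₁ + d) l₂ ω ∂μ))
      rw [abs_mul] at a4
      set e := C * Real.exp (-D / 4) with he
      have he0 : 0 ≤ e := by positivity
      have a5 : |u| * |∫ ω, truncSum ξ (D ^ r) m l₁ ω ∂μ +
        ∫ ω, truncSum ξ (D ^ r) (m + l₁ + d) l₂ ω ∂μ| ≤ |u| * ((l₁ + l₂) * e) := by
        gcongr; linarith
      have a6 : |u| * ((l₁ + l₂) * e) ≤ N * e := by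
        rw [← mul_assoc]
        refine mul_le_mul_of_nonneg_right (le_trans ?_ hN) he0
        rw [← mul_add, mul_right_comm]
        exact le_mul_of_one_le_right (by positivity) hM1
      linarith
    · rw [mul_add]
      exact (abs_add_le _ _).trans ((add_le_add (abs_mul_truncSum_le hM _ _ _ _)
        (abs_mul_truncSum_le hM _ _ _ _)).trans hN)
  have e1 : logLaplace μ ξ (D ^ r) u m l₁ + logLaplace μ ξ (D ^ r) u (m + l₁ + d) l₂ =
      Real.log (expMoment μ ξ (D ^ r) u m l₁ * expMoment μ ξ (D ^ r) u (m + l₁ + d) l₂) := by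
    rw [Real.log_mul (by linarith) (by linarith)]; rfl
  rw [e1]
  refine (abs_log_sub_log_le (by norm_num) z3 z12).trans ?_
  have h1 := H.abs_integral_exp_sub_le (μ := μ) hM m l₁ d l₂ hd (u := u) (N := N)
    (by rw [mul_add]; exact hN)
  have h2 : |u| * l₂ ≤ Real.exp N := by
    have : |u| * l₂ ≤ |u| * D ^ r * l₂ := by
      rw [mul_right_comm]; exact le_mul_of_one_le_right (by positivity) hM1
    linarith [Real.add_one_le_exp N]
  have h3 : |u| * Real.exp N * l₂ * Real.exp (-c * (d : ℝ) ^ g) ≤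
      Real.exp (2 * N - c * (d : ℝ) ^ g) := by
    calc |u| * Real.exp N * l₂ * Real.exp (-c * (d : ℝ) ^ g)
        = (|u| * l₂) * (Real.exp N * Real.exp (-c * (d : ℝ) ^ g)) := by ring
      _ ≤ Real.exp N * (Real.exp N * Real.exp (-c * (d : ℝ) ^ g)) := by gcongr
      _ = _ := by rw [← Real.exp_add, ← Real.exp_add]; ring_nf
  rw [one_div, inv_inv]
  linarith

lemma truncSum_three (ξ : ℕ → Ω → ℝ) (M : ℝ) (m l₁ d l₂ : ℕ) (ω : Ω) :
    truncSum ξ M m (l₁ + d + l₂) ω = (truncSum ξ M m l₁ ω + truncSum ξ M (m + l₁ + d) l₂ ω) +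
      truncSum ξ M (m + l₁) d ω := by
  rw [truncSum_add, truncSum_add, ← add_assoc m]; ring

/-- Removing a gap of length `d` from a block: upper bound of the log-Laplace transform. -/
lemma StretchedMixing.logLaplace_split_le (H : StretchedMixing μ ℱ ξ c g r)
    (h0 : ∀ i, ∫ ω, ξ i ω ∂μ = 0) (hC : TruncationBound μ ξ r C) {D u w N : ℝ} (hD : 1 ≤ D)
    (hw0 : 0 < w) (hw1 : w < 1) {m l₁ d l₂ : ℕ} (hd : 1 ≤ d)
    (hN : |u / (1 - w)| * D ^ r * (l₁ + l₂) ≤ N)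
    (hNC : N * (C * Real.exp (-D / 4)) ≤ 1 / 2) :
    logLaplace μ ξ (D ^ r) u m (l₁ + d + l₂) ≤
      (1 - w) * (logLaplace μ ξ (D ^ r) (u / (1 - w)) m l₁ +
        logLaplace μ ξ (D ^ r) (u / (1 - w)) (m + l₁ + d) l₂) +
      w * logLaplace μ ξ (D ^ r) (u / w) (m + l₁) d +
      4 * Real.exp (2 * N - c * (d : ℝ) ^ g) := by
  have hM : 0 ≤ D ^ r := Real.rpow_nonneg (by linarith) r
  set S₁ := truncSum ξ (D ^ r) m l₁ with hS1
  set S₂ := truncSum ξ (D ^ r) (m + l₁ + d) l₂ with hS2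
  set G := truncSum ξ (D ^ r) (m + l₁) d with hG
  -- Hölder's inequality for the decomposition of the block into `S₁ + S₂` and the gap `G`
  have h1 := log_integral_exp_add_le (μ := μ) (f := fun ω => u * (S₁ ω + S₂ ω))
    (h := fun ω => u * G ω)
    (L := |u| * D ^ r * l₁ + |u| * D ^ r * l₂ + |u| * D ^ r * d)
    (((H.measurable_truncSum _ _ _).add (H.measurable_truncSum _ _ _)).const_mul u)
    ((H.measurable_truncSum _ _ _).const_mul u)
    (fun ω => by
      rw [mul_add]
      refine (abs_add_le _ _).trans ((add_le_add (abs_mul_truncSum_le hM _ _ _ _)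
        (abs_mul_truncSum_le hM _ _ _ _)).trans ?_)
      linarith [show 0 ≤ |u| * D ^ r * d by positivity])
    (fun ω => (abs_mul_truncSum_le hM _ _ _ _).trans (by
      linarith [show 0 ≤ |u| * D ^ r * l₁ by positivity,
        show 0 ≤ |u| * D ^ r * l₂ by positivity])) hw0 hw1
  have h2 := (abs_le.1 (H.abs_log_integral_exp_sub_le h0 hC hD (m := m) hd hN hNC)).2
  have e1 : ∀ ω, u * truncSum ξ (D ^ r) m (l₁ + d + l₂) ω = u * (S₁ ω + S₂ ω) + u * G ω :=
    fun ω => by rw [truncSum_three]; ring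
  have e2 : ∀ ω, u * (S₁ ω + S₂ ω) / (1 - w) = u / (1 - w) * (S₁ ω + S₂ ω) := fun ω => by ring
  have e3 : ∀ ω, u * G ω / w = u / w * G ω := fun ω => by ring
  simp only [e2, e3] at h1
  have e4 : logLaplace μ ξ (D ^ r) u m (l₁ + d + l₂) =
      Real.log (∫ ω, Real.exp (u * (S₁ ω + S₂ ω) + u * G ω) ∂μ) := by
    unfold logLaplace expMoment; simp only [e1]
  rw [e4]
  refine h1.trans ?_
  have h3 : (1 - w) * Real.log (∫ ω, Real.exp (u / (1 - w) * (S₁ ω + S₂ ω)) ∂μ) ≤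
      (1 - w) * (logLaplace μ ξ (D ^ r) (u / (1 - w)) m l₁ +
        logLaplace μ ξ (D ^ r) (u / (1 - w)) (m + l₁ + d) l₂ +
        4 * Real.exp (2 * N - c * (d : ℝ) ^ g)) :=
    mul_le_mul_of_nonneg_left (by linarith) (by linarith)
  have h4 : 0 ≤ w * (4 * Real.exp (2 * N - c * (d : ℝ) ^ g)) := by positivity
  have e5 : Real.log (∫ ω, Real.exp (u / w * G ω) ∂μ) =
    logLaplace μ ξ (D ^ r) (u / w) (m + l₁) d := rfl
  rw [e5]
  linarith

/-- Removing a gap of length `d` from a block: lower bound of the log-Laplace transform. -/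
lemma StretchedMixing.le_logLaplace_split (H : StretchedMixing μ ℱ ξ c g r)
    (h0 : ∀ i, ∫ ω, ξ i ω ∂μ = 0) (hC : TruncationBound μ ξ r C) {D u w N : ℝ} (hD : 1 ≤ D)
    (hw0 : 0 < w) (hw1 : w < 1) {m l₁ d l₂ : ℕ} (hd : 1 ≤ d)
    (hN : |u * (1 - w)| * D ^ r * (l₁ + l₂) ≤ N)
    (hNC : N * (C * Real.exp (-D / 4)) ≤ 1 / 2) :
    logLaplace μ ξ (D ^ r) (u * (1 - w)) m l₁ +
        logLaplace μ ξ (D ^ r) (u * (1 - w)) (m + l₁ + d) l₂ ≤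
      (1 - w) * logLaplace μ ξ (D ^ r) u m (l₁ + d + l₂) +
      w * logLaplace μ ξ (D ^ r) (-(u * (1 - w) / w)) (m + l₁) d +
      4 * Real.exp (2 * N - c * (d : ℝ) ^ g) := by
  have hM : 0 ≤ D ^ r := Real.rpow_nonneg (by linarith) r
  have hw : (1 - w) ≠ 0 := by linarith
  set S₁ := truncSum ξ (D ^ r) m l₁ with hS1
  set S₂ := truncSum ξ (D ^ r) (m + l₁ + d) l₂ with hS2
  set G := truncSum ξ (D ^ r) (m + l₁) d with hG
  set T := truncSum ξ (D ^ r) m (l₁ + d + l₂) with hT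
  set v := u * (1 - w) with hv
  -- Hölder's inequality for `S₁ + S₂ = T - G`, where `T` is the sum over the whole block
  have h1 := log_integral_exp_add_le (μ := μ) (f := fun ω => v * T ω)
    (h := fun ω => -v * G ω)
    (L := |v| * D ^ r * ((l₁ + d + l₂ : ℕ) : ℝ) + |v| * D ^ r * d)
    ((H.measurable_truncSum _ _ _).const_mul v)
    ((H.measurable_truncSum _ _ _).const_mul (-v))
    (fun ω => (abs_mul_truncSum_le hM _ _ _ _).trans
      (le_add_of_nonneg_right (by positivity)))
    (fun ω => (abs_mul_truncSum_le hM _ _ _ _).trans (by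
      rw [abs_neg]
      exact le_add_of_nonneg_left (by positivity))) hw0 hw1
  have h2 := (abs_le.1 (H.abs_log_integral_exp_sub_le h0 hC hD (m := m) hd hN hNC)).1
  have e1 : ∀ ω, v * T ω + -v * G ω = v * (S₁ ω + S₂ ω) :=
    fun ω => by rw [hT, truncSum_three]; ring
  have e2 : ∀ ω, v * T ω / (1 - w) = u * T ω := fun ω => by rw [hv]; field_simp
  have e3 : ∀ ω, -v * G ω / w = -(v / w) * G ω := fun ω => by ring
  simp only [e1, e2, e3] at h1
  have e5 : Real.log (∫ ω, Real.exp (-(v / w) * G ω) ∂μ) =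
    logLaplace μ ξ (D ^ r) (-(v / w)) (m + l₁) d := rfl
  have e6 : Real.log (∫ ω, Real.exp (u * T ω) ∂μ) =
    logLaplace μ ξ (D ^ r) u m (l₁ + d + l₂) := rfl
  rw [e5, e6] at h1
  linarith

end LogLaplace

/-! ### The multi-scale recursion -/

section Recursion

/-- The bound `U p^κ A_k^{1-κ} D_k^r` for `|u S|`, where `S` is a sum of at most `A_k` variables
truncated at `D_k^r` and `u` is admissible. -/
noncomputable def scaleBound (r κ U p : ℝ) (A D : ℕ → ℝ) (k : ℕ) : ℝ :=
  U * p ^ κ * A k ^ (1 - κ) * D k ^ r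

/-- Parameters of the multi-scale decomposition of a block of length at most `p`. At the level `k`
the blocks have length at most `A k` and the variables are truncated at `(D k) ^ r`; a block of
length in `(A k, A (k+1)]` is cut in two halves separated by a gap of length `gap k`, which enters
Hölder's inequality with the weight `w k`. A block of length `l` is tested against the parameters
`u` with `|u| ≤ U (p / l) ^ κ`. The error of each elementary step is at most `e₀`. -/
structure ScaleData (c g r C κ U p e₀ : ℝ) (J : ℕ) (A D w : ℕ → ℝ) (gap : ℕ → ℕ) : Prop where
  κ_pos : 0 < κ
  κ_le : κ ≤ 1 / 2
  U_nonneg : 0 ≤ U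
  p_pos : 0 < p
  A_zero : 8 ≤ A 0
  A_succ : ∀ k, A (k + 1) = 2 * A k
  D_one : ∀ k ≤ J, 1 ≤ D k
  D_mono : ∀ k < J, D k ≤ D (k + 1)
  gap_pos : ∀ k < J, 1 ≤ gap k
  gap_le : ∀ k < J, (gap k : ℝ) ≤ A k / 4
  w_eq : ∀ k < J, w k = (gap k / A k) ^ κ
  w_le : ∀ k < J, w k ≤ 1 - 2 ^ (-κ)
  w_le' : ∀ k < J, w k ≤ 1 / 4
  err_decouple : ∀ k < J, 4 * Real.exp (4 * scaleBound r κ U p A D (k + 1) - c * (gap k : ℝ) ^ g) ≤ e₀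
  err_trunc : ∀ k < J, 4 * Real.exp (scaleBound r κ U p A D (k + 1)) *
    (A (k + 1) * Real.exp (1 - D k)) ≤ e₀
  err_mean : ∀ k < J, 2 * scaleBound r κ U p A D (k + 1) * (C * Real.exp (-D k / 4)) ≤ 1 / 2

namespace ScaleData

variable {c g r C κ U p e₀ : ℝ} {J : ℕ} {A D w : ℕ → ℝ} {gap : ℕ → ℕ}

/-- The lengths `A k` increase from `A 0 ≥ 8`, so that integer parts do no harm. -/
lemma A_pos (P : ScaleData c g r C κ U p e₀ J A D w gap) (k : ℕ) : 8 ≤ A k := by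
  induction k with
  | zero => exact P.A_zero
  | succ k ih => rw [P.A_succ]; linarith

lemma A_zero_le (P : ScaleData c g r C κ U p e₀ J A D w gap) (k : ℕ) : A 0 ≤ A k := by
  induction k with
  | zero => exact le_rfl
  | succ k ih => rw [P.A_succ]; linarith [P.A_zero]

lemma w_pos (P : ScaleData c g r C κ U p e₀ J A D w gap) {k : ℕ} (hk : k < J) : 0 < w k := by
  rw [P.w_eq k hk]
  have h1 : (0 : ℝ) < gap k := by exact_mod_cast P.gap_pos k hk
  have h2 := P.A_pos k
  exact Real.rpow_pos_of_pos (by positivity) _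

lemma e_nonneg (P : ScaleData c g r C κ U p e₀ J A D w gap) {k : ℕ} (hk : k < J) : 0 ≤ e₀ :=
  le_trans (by positivity) (P.err_decouple k hk)

/-- As `κ ≤ 1 / 2`, the proportion of a block taken by its gap is at most the square of the weight. -/
lemma gap_div_le_sq (P : ScaleData c g r C κ U p e₀ J A D w gap) {k : ℕ} (hk : k < J) {l : ℝ}
    (hl : A k ≤ l) : gap k / l ≤ w k ^ 2 := by
  have h1 : (0 : ℝ) < gap k := by exact_mod_cast P.gap_pos k hk
  have h2 := P.A_pos k
  have h3 := P.gap_le k hk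
  have hx1 : gap k / A k ≤ 1 := by rw [div_le_one (by linarith)]; linarith
  calc gap k / l ≤ gap k / A k := by gcongr
    _ = (gap k / A k) ^ (1 : ℝ) := (Real.rpow_one _).symm
    _ ≤ (gap k / A k) ^ (κ * 2) := by
        apply Real.rpow_le_rpow_of_exponent_ge (by apply div_pos <;> linarith) hx1
        linarith [P.κ_le]
    _ = w k ^ 2 := by
        rw [P.w_eq k hk, Real.rpow_mul (div_nonneg h1.le (by linarith))]
        norm_cast

/-- The contribution `(u / w)² gap` of the gap, with the factor `w` from Hölder's inequality, is at most
the proportion `w` of `u² l`. -/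
lemma gap_div_w_le (P : ScaleData c g r C κ U p e₀ J A D w gap) {k : ℕ} (hk : k < J) {l : ℝ}
    (hl : A k ≤ l) : gap k / w k ≤ w k * l := by
  have hw := P.w_pos hk
  have hx := P.gap_div_le_sq hk hl
  rw [div_le_iff₀ (by linarith [P.A_pos k])] at hx
  rw [div_le_iff₀ hw]
  linarith

lemma inv_one_sub_w_le (P : ScaleData c g r C κ U p e₀ J A D w gap) {k : ℕ} (hk : k < J) :
    (1 - w k)⁻¹ ≤ 1 + 2 * w k := by
  have hw := P.w_pos hk
  have hw' := P.w_le' k hk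
  rw [inv_le_iff_one_le_mul₀ (by linarith)]
  nlinarith

/-- The bound for `|u S|` over all blocks of the level `k` and all admissible `u`; it increases with the
length since `κ < 1`. -/
lemma abs_mul_le (P : ScaleData c g r C κ U p e₀ J A D w gap) {k l : ℕ} (hk : k ≤ J) (hl : 1 ≤ l)
    (hlA : (l : ℝ) ≤ A k) {u : ℝ} (hu : |u| ≤ U * (p / l) ^ κ) :
    |u| * D k ^ r * l ≤ scaleBound r κ U p A D k := by
  have hl0 : (0 : ℝ) < l := by exact_mod_cast hl
  have hD := Real.rpow_nonneg (zero_le_one.trans (P.D_one k hk)) r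
  have hU := P.U_nonneg
  have hp := P.p_pos
  have h1 : (l : ℝ) ^ (1 - κ) ≤ A k ^ (1 - κ) :=
    Real.rpow_le_rpow hl0.le hlA (by linarith [P.κ_le])
  calc |u| * D k ^ r * l ≤ U * (p / l) ^ κ * D k ^ r * l := by gcongr
    _ = U * p ^ κ * (l : ℝ) ^ (1 - κ) * D k ^ r := by
        rw [Real.div_rpow hp.le hl0.le, Real.rpow_sub hl0, Real.rpow_one]
        field_simp
    _ ≤ _ := by unfold scaleBound; gcongr

/-- Halving a block keeps the parameter in the admissible range, although Hölder's inequality divides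
it by `1 - w`: the range is widened by `2 ^ κ`, and `1 - w ≥ 2 ^ (-κ)`. -/
lemma domain_half (P : ScaleData c g r C κ U p e₀ J A D w gap) {k l l' : ℕ} (hk : k < J)
    (hl' : 1 ≤ l') (hll : 2 * l' ≤ l) {u : ℝ} (hu : |u| ≤ U * (p / l) ^ κ) :
    |u / (1 - w k)| ≤ U * (p / l') ^ κ := by
  have hl0 : (0 : ℝ) < l' := by exact_mod_cast hl'
  have hw : 0 < 1 - w k := by linarith [P.w_le' k hk]
  have hp := P.p_pos
  have hU := P.U_nonneg
  have hll' : 2 * (l' : ℝ) ≤ l := by exact_mod_cast hll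
  rw [abs_div, abs_of_pos hw, div_le_iff₀ hw]
  refine hu.trans ?_
  have h1 : (p / l) ^ κ ≤ (p / (2 * l')) ^ κ :=
    Real.rpow_le_rpow (by positivity) (by gcongr) P.κ_pos.le
  have h2 : (p / (2 * l')) ^ κ = (p / l') ^ κ * 2 ^ (-κ) := by
    rw [Real.rpow_neg two_pos.le, ← Real.inv_rpow two_pos.le, ← Real.mul_rpow (by positivity)
      (by positivity)]
    congr 1; field_simp
  rw [h2] at h1
  have h3 := P.w_le k hk
  rw [mul_assoc]
  refine mul_le_mul_of_nonneg_left (h1.trans ?_) hU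
  gcongr
  linarith

/-- Shorter blocks have a larger admissible range. -/
lemma domain_mono (P : ScaleData c g r C κ U p e₀ J A D w gap) {l l' : ℕ} (hl' : 1 ≤ l')
    (hll : l' ≤ l) {u v : ℝ} (huv : |v| ≤ |u|) (hu : |u| ≤ U * (p / l) ^ κ) :
    |v| ≤ U * (p / l') ^ κ := by
  have hl0 : (0 : ℝ) < l' := by exact_mod_cast hl'
  have hll' : (l' : ℝ) ≤ l := by exact_mod_cast hll
  refine huv.trans (hu.trans (mul_le_mul_of_nonneg_left ?_ P.U_nonneg))
  have hp := P.p_pos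
  exact Real.rpow_le_rpow (by positivity) (by gcongr) P.κ_pos.le

/-- The parameter divided by the weight is admissible for the gap: this is what the choice
`w = (gap / A) ^ κ` achieves. -/
lemma domain_gap (P : ScaleData c g r C κ U p e₀ J A D w gap) {k l : ℕ} (hk : k < J)
    (hl : A k ≤ (l : ℝ)) {u v : ℝ} (huv : |v| ≤ |u|) (hu : |u| ≤ U * (p / l) ^ κ) :
    |v / w k| ≤ U * (p / gap k) ^ κ := by
  have hw := P.w_pos hk
  have hA := P.A_pos k
  have hl0 : (0 : ℝ) < l := by linarith
  have hg : (0 : ℝ) < gap k := by exact_mod_cast P.gap_pos k hk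
  have hp := P.p_pos
  rw [abs_div, abs_of_pos hw, div_le_iff₀ hw]
  refine huv.trans (hu.trans ?_)
  rw [mul_assoc]
  refine mul_le_mul_of_nonneg_left ?_ P.U_nonneg
  rw [P.w_eq k hk, ← Real.mul_rpow (by positivity) (div_nonneg hg.le (by linarith))]
  refine Real.rpow_le_rpow (by positivity) ?_ P.κ_pos.le
  rw [div_mul_div_comm, mul_comm (gap k : ℝ), mul_div_mul_right _ _ hg.ne']
  gcongr

/-- Lengths of the two halves of a block of length `l` once the gap has been removed. -/
lemma exists_split (P : ScaleData c g r C κ U p e₀ J A D w gap) {k l : ℕ} (hk : k < J)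
    (hl : A k < l) (hl' : (l : ℝ) ≤ A (k + 1)) : ∃ l₁ l₂ : ℕ, l = l₁ + gap k + l₂ ∧
      1 ≤ l₁ ∧ 1 ≤ l₂ ∧ 2 * l₁ ≤ l ∧ 2 * l₂ ≤ l ∧ A 0 / 4 ≤ l₁ ∧ A 0 / 4 ≤ l₂ ∧
      (l₁ : ℝ) ≤ A k ∧ (l₂ : ℝ) ≤ A k := by
  have hA := P.A_pos k
  have hA0 := P.A_zero_le k
  have hg1 := P.gap_pos k hk
  have hg := P.gap_le k hk
  have hgl : gap k + 4 ≤ l := by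
    have : ((gap k + 4 : ℕ) : ℝ) ≤ l := by push_cast; linarith
    exact_mod_cast this
  have hgl4 : 4 * gap k ≤ l := by
    have : ((4 * gap k : ℕ) : ℝ) ≤ l := by push_cast; linarith
    exact_mod_cast this
  rw [P.A_succ] at hl'
  refine ⟨(l - gap k) / 2, l - gap k - (l - gap k) / 2, by omega, by omega, by omega, by omega,
    by omega, ?_, ?_, ?_, ?_⟩
  · have : l ≤ 4 * ((l - gap k) / 2) := by omega
    have : (l : ℝ) ≤ 4 * ((l - gap k) / 2 : ℕ) := by exact_mod_cast this
    linarith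
  · have : l ≤ 4 * (l - gap k - (l - gap k) / 2) := by omega
    have : (l : ℝ) ≤ 4 * (l - gap k - (l - gap k) / 2 : ℕ) := by exact_mod_cast this
    linarith
  · have : 2 * ((l - gap k) / 2) ≤ l := by omega
    have : 2 * (((l - gap k) / 2 : ℕ) : ℝ) ≤ l := by exact_mod_cast this
    linarith
  · have : 2 * (l - gap k - (l - gap k) / 2) ≤ l := by omega
    have : 2 * ((l - gap k - (l - gap k) / 2 : ℕ) : ℝ) ≤ l := by exact_mod_cast this
    linarith

variable {Ω : Type*} {mΩ : MeasurableSpace Ω} {μ : Measure Ω} [IsProbabilityMeasure μ]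
  {ℱ : ℕ → MeasurableSpace Ω} {ξ : ℕ → Ω → ℝ}

lemma scaleBound_nonneg (P : ScaleData c g r C κ U p e₀ J A D w gap) {k : ℕ} (hk : k ≤ J) :
    0 ≤ scaleBound r κ U p A D k := by
  have h1 := P.A_pos k
  have h2 := P.U_nonneg
  have h3 := P.p_pos
  have h4 := P.D_one k hk
  unfold scaleBound; positivity

/-- Passing from the truncation level of a scale to that of the previous one. -/
lemma retruncate (P : ScaleData c g r C κ U p e₀ J A D w gap) (H : StretchedMixing μ ℱ ξ c g r)
    (h0 : ∀ i, ∫ ω, ξ i ω ∂μ = 0) (hC : TruncationBound μ ξ r C) {k l : ℕ} (hk : k < J)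
    (hl : 1 ≤ l) (hlA : (l : ℝ) ≤ A (k + 1)) {u : ℝ} (hu : |u| ≤ U * (p / l) ^ κ) (m : ℕ) :
    |logLaplace μ ξ (D (k + 1) ^ r) u m l - logLaplace μ ξ (D k ^ r) u m l| ≤ e₀ := by
  have hC1 := hC.1
  have hN0 := P.scaleBound_nonneg (show k + 1 ≤ J from hk)
  have h1 := P.err_mean k hk
  have h2 := H.abs_logLaplace_sub_le h0 hC (P.D_one k hk.le) (P.D_mono k hk) (m := m)
    (P.abs_mul_le hk hl hlA hu) (le_trans (by
      rw [mul_assoc 2]; linarith [show 0 ≤ scaleBound r κ U p A D (k + 1) *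
        (C * Real.exp (-D k / 4)) by positivity]) h1)
  refine h2.trans (le_trans ?_ (P.err_trunc k hk))
  gcongr

/-- One step of the recursion for upper bounds: split off the gap and lower the truncation level. -/
lemma split_le (P : ScaleData c g r C κ U p e₀ J A D w gap) (H : StretchedMixing μ ℱ ξ c g r)
    (h0 : ∀ i, ∫ ω, ξ i ω ∂μ = 0) (hC : TruncationBound μ ξ r C) {k l₁ l₂ : ℕ} (hk : k < J)
    (h1 : 1 ≤ l₁) (h2 : 1 ≤ l₂) (h1' : 2 * l₁ ≤ l₁ + gap k + l₂) (h2' : 2 * l₂ ≤ l₁ + gap k + l₂)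
    (h1A : (l₁ : ℝ) ≤ A k) (h2A : (l₂ : ℝ) ≤ A k)
    (hl : A k ≤ ((l₁ + gap k + l₂ : ℕ) : ℝ))
    {u : ℝ} (hu : |u| ≤ U * (p / (l₁ + gap k + l₂ : ℕ)) ^ κ) (m : ℕ) :
    logLaplace μ ξ (D (k + 1) ^ r) u m (l₁ + gap k + l₂) ≤
      (1 - w k) * (logLaplace μ ξ (D k ^ r) (u / (1 - w k)) m l₁ +
        logLaplace μ ξ (D k ^ r) (u / (1 - w k)) (m + l₁ + gap k) l₂) +
      w k * logLaplace μ ξ (D k ^ r) (u / w k) (m + l₁) (gap k) + 3 * e₀ := by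
  have hw := P.w_pos hk
  have hw' := P.w_le' k hk
  have hA := P.A_pos k
  have hAA := P.A_succ k
  have he := P.e_nonneg hk
  have hC1 := hC.1
  have d1 := P.domain_half hk h1 h1' hu
  have d2 := P.domain_half hk h2 h2' hu
  have dg := P.domain_gap hk hl le_rfl hu
  have hN0 := P.scaleBound_nonneg (show k + 1 ≤ J from hk)
  have b1 := P.abs_mul_le (k := k + 1) hk h1 (by linarith) d1
  have b2 := P.abs_mul_le (k := k + 1) hk h2 (by linarith) d2
  have hD1 := P.D_one (k + 1) hk
  have hmean : 2 * scaleBound r κ U p A D (k + 1) * (C * Real.exp (-D (k + 1) / 4)) ≤ 1 / 2 := by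
    refine le_trans ?_ (P.err_mean k hk)
    have := P.D_mono k hk
    gcongr
  have hs := H.logLaplace_split_le h0 hC hD1 hw (by linarith) (m := m) (P.gap_pos k hk)
    (u := u) (l₁ := l₁) (l₂ := l₂) (N := 2 * scaleBound r κ U p A D (k + 1))
    (by rw [mul_add]; linarith) hmean
  have hdec := P.err_decouple k hk
  rw [show 4 * scaleBound r κ U p A D (k + 1) = 2 * (2 * scaleBound r κ U p A D (k + 1)) by ring]
    at hdec
  have r1 := (abs_le.1 (P.retruncate H h0 hC hk h1 (by linarith) d1 m)).2
  have r2 := (abs_le.1 (P.retruncate H h0 hC hk h2 (by linarith) d2 (m + l₁ + gap k))).2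
  have rg := (abs_le.1 (P.retruncate H h0 hC hk (P.gap_pos k hk)
    (by linarith [P.gap_le k hk]) dg (m + l₁))).2
  have m1 := mul_le_mul_of_nonneg_left (add_le_add r1 r2) (show 0 ≤ 1 - w k by linarith)
  have m2 := mul_le_mul_of_nonneg_left rg hw.le
  have m3 : 0 ≤ w k * e₀ := by positivity
  nlinarith

/-- One step of the recursion for lower bounds. -/
lemma le_split (P : ScaleData c g r C κ U p e₀ J A D w gap) (H : StretchedMixing μ ℱ ξ c g r)
    (h0 : ∀ i, ∫ ω, ξ i ω ∂μ = 0) (hC : TruncationBound μ ξ r C) {k l₁ l₂ : ℕ} (hk : k < J)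
    (h1 : 1 ≤ l₁) (h2 : 1 ≤ l₂)
    (h1A : (l₁ : ℝ) ≤ A k) (h2A : (l₂ : ℝ) ≤ A k)
    (hl : A k ≤ ((l₁ + gap k + l₂ : ℕ) : ℝ))
    {u : ℝ} (hu : |u| ≤ U * (p / (l₁ + gap k + l₂ : ℕ)) ^ κ) (m : ℕ) :
    logLaplace μ ξ (D k ^ r) (u * (1 - w k)) m l₁ +
        logLaplace μ ξ (D k ^ r) (u * (1 - w k)) (m + l₁ + gap k) l₂ ≤
      (1 - w k) * logLaplace μ ξ (D (k + 1) ^ r) u m (l₁ + gap k + l₂) +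
      w k * logLaplace μ ξ (D k ^ r) (-(u * (1 - w k) / w k)) (m + l₁) (gap k) + 4 * e₀ := by
  have hw := P.w_pos hk
  have hw' := P.w_le' k hk
  have hA := P.A_pos k
  have hAA := P.A_succ k
  have he := P.e_nonneg hk
  have hC1 := hC.1
  have huu : |u * (1 - w k)| ≤ |u| := by
    rw [abs_mul]
    refine mul_le_of_le_one_right (abs_nonneg _) ?_
    rw [abs_le]; constructor <;> linarith
  have d1 := P.domain_mono h1 (by omega) huu hu
  have d2 := P.domain_mono h2 (by omega) huu hu
  have dg := P.domain_gap hk hl huu hu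
  rw [← abs_neg] at dg
  have hN0 := P.scaleBound_nonneg (show k + 1 ≤ J from hk)
  have b1 := P.abs_mul_le (k := k + 1) hk h1 (by linarith) d1
  have b2 := P.abs_mul_le (k := k + 1) hk h2 (by linarith) d2
  have hD1 := P.D_one (k + 1) hk
  have hmean : 2 * scaleBound r κ U p A D (k + 1) * (C * Real.exp (-D (k + 1) / 4)) ≤ 1 / 2 := by
    refine le_trans ?_ (P.err_mean k hk)
    have := P.D_mono k hk
    gcongr
  have hs := H.le_logLaplace_split h0 hC hD1 hw (by linarith) (m := m) (P.gap_pos k hk)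
    (u := u) (l₁ := l₁) (l₂ := l₂) (N := 2 * scaleBound r κ U p A D (k + 1))
    (by rw [mul_add]; linarith) hmean
  have hdec := P.err_decouple k hk
  rw [show 4 * scaleBound r κ U p A D (k + 1) = 2 * (2 * scaleBound r κ U p A D (k + 1)) by ring]
    at hdec
  have r1 := (abs_le.1 (P.retruncate H h0 hC hk h1 (by linarith) d1 m)).1
  have r2 := (abs_le.1 (P.retruncate H h0 hC hk h2 (by linarith) d2 (m + l₁ + gap k))).1
  have rg := (abs_le.1 (P.retruncate H h0 hC hk (P.gap_pos k hk)
    (by linarith [P.gap_le k hk]) dg (m + l₁))).2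
  have m2 := mul_le_mul_of_nonneg_left rg hw.le
  have m3 : w k * e₀ ≤ 1 * e₀ := by gcongr; linarith
  nlinarith

set_option maxHeartbeats 400000 in
/-- The crude bound: the log-Laplace transform of a sum of `l` variables is `O(u² l)`. -/
theorem logLaplace_le (P : ScaleData c g r C κ U p e₀ J A D w gap)
    (H : StretchedMixing μ ℱ ξ c g r) (h0 : ∀ i, ∫ ω, ξ i ω ∂μ = 0)
    (hC : TruncationBound μ ξ r C) {B E : ℝ} (hB : 0 ≤ B) (hE : 6 * e₀ ≤ E) (hE0 : 0 ≤ E)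
    (hbase : ∀ (l m : ℕ) (u : ℝ), 1 ≤ l → (l : ℝ) ≤ A 0 → |u| ≤ U * (p / l) ^ κ →
      logLaplace μ ξ (D 0 ^ r) u m l ≤ u ^ 2 * l * B + E) :
    ∀ k ≤ J, ∀ (l m : ℕ) (u : ℝ), 1 ≤ l → (l : ℝ) ≤ A k → |u| ≤ U * (p / l) ^ κ →
      logLaplace μ ξ (D k ^ r) u m l ≤
        u ^ 2 * l * (B * Real.exp (3 * ∑ i ∈ Finset.range k, w i)) + 4 ^ k * E := by
  intro k
  induction k with
  | zero => intro _ l m u hl hlA hu; simpa using hbase l m u hl hlA hu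
  | succ k ih =>
    intro hk l m u hl hlA hu
    have hkJ : k < J := hk
    have ih := ih hkJ.le
    have hw := P.w_pos hkJ
    have hw' := P.w_le' k hkJ
    have he := P.e_nonneg hkJ
    set b := B * Real.exp (3 * ∑ i ∈ Finset.range k, w i) with hb
    have hb0 : 0 ≤ b := by positivity
    have hbb : b * (1 + 3 * w k) ≤ B * Real.exp (3 * ∑ i ∈ Finset.range (k + 1), w i) := by
      rw [Finset.sum_range_succ, mul_add 3, Real.exp_add, ← mul_assoc]
      exact mul_le_mul_of_nonneg_left (by linarith [Real.add_one_le_exp (3 * w k)]) hb0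
    have hEk : E ≤ 4 ^ k * E := le_mul_of_one_le_left hE0 (one_le_pow₀ (by norm_num))
    have hpow : (4 : ℝ) ^ (k + 1) * E = 4 * (4 ^ k * E) := by ring
    set F := (4 : ℝ) ^ k * E with hF
    refine le_trans ?_ (add_le_add_left (mul_le_mul_of_nonneg_left hbb (by positivity)) _)
    rw [hpow]
    -- a block that already fits the level `k` only needs another truncation level; a longer one is split
    rcases le_or_gt (l : ℝ) (A k) with hlk | hlk
    · have h1 := ih l m u hl hlk hu
      have h2 := (abs_le.1 (P.retruncate H h0 hC hkJ hl hlA hu m)).2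
      have h3 : 0 ≤ u ^ 2 * l * (b * (3 * w k)) := by positivity
      linarith
    · obtain ⟨l₁, l₂, rfl, h1, h2, h1', h2', -, -, h1A, h2A⟩ := P.exists_split hkJ hlk hlA
      have hs := P.split_le H h0 hC hkJ h1 h2 h1' h2' h1A h2A hlk.le hu m
      have g1 := ih l₁ m _ h1 h1A (P.domain_half hkJ h1 h1' hu)
      have g2 := ih l₂ (m + l₁ + gap k) _ h2 h2A (P.domain_half hkJ h2 h2' hu)
      have g3 := ih (gap k) (m + l₁) _ (P.gap_pos k hkJ)
        (by linarith [P.gap_le k hkJ, P.A_pos k]) (P.domain_gap hkJ hlk.le le_rfl hu)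
      set L : ℝ := ((l₁ + gap k + l₂ : ℕ) : ℝ) with hL
      have hLe : L = l₁ + gap k + l₂ := by rw [hL]; push_cast; ring
      have hL0 : 0 < L := by linarith [P.A_pos k]
      have hgw := P.gap_div_w_le hkJ hlk.le
      have m1 := mul_le_mul_of_nonneg_left (add_le_add g1 g2) (show 0 ≤ 1 - w k by linarith)
      have m2 := mul_le_mul_of_nonneg_left g3 hw.le
      have e1 : (1 - w k) * ((u / (1 - w k)) ^ 2 * l₁ * b + F + ((u / (1 - w k)) ^ 2 * l₂ * b + F))
          = u ^ 2 * b * ((l₁ + l₂) * (1 - w k)⁻¹) + (1 - w k) * (2 * F) := by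
        have : 1 - w k ≠ 0 := by linarith
        field_simp; ring
      have e2 : w k * ((u / w k) ^ 2 * gap k * b + F) = u ^ 2 * b * (gap k / w k) + w k * F := by
        field_simp
      rw [e1] at m1
      rw [e2] at m2
      have hinv := P.inv_one_sub_w_le hkJ
      have hinv0 : 0 ≤ (1 - w k)⁻¹ := inv_nonneg.2 (by linarith)
      have h5 : ((l₁ : ℝ) + l₂) * (1 - w k)⁻¹ ≤ L * (1 + 2 * w k) := by
        have : (0 : ℝ) ≤ gap k := Nat.cast_nonneg _
        exact mul_le_mul (by linarith) hinv hinv0 hL0.le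
      have h6 : u ^ 2 * b * ((l₁ + l₂) * (1 - w k)⁻¹) + u ^ 2 * b * (gap k / w k) ≤
          u ^ 2 * L * (b * (1 + 3 * w k)) := by
        rw [← mul_add]
        have : u ^ 2 * L * (b * (1 + 3 * w k)) = u ^ 2 * b * (L * (1 + 2 * w k) + w k * L) := by
          ring
        rw [this]
        exact mul_le_mul_of_nonneg_left (add_le_add h5 hgw) (by positivity)
      have h7 : 0 ≤ w k * F := by positivity
      linarith only [hs, m1, m2, h6, h7, hE, hEk, he]

set_option maxHeartbeats 400000 in
/-- The sharp upper bound: starting from `u² l s / 2` at the lowest scale, the constant grows only by a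
multiple of the sum of the weights. The gaps are handled by the crude bound. -/
theorem logLaplace_le_sharp (P : ScaleData c g r C κ U p e₀ J A D w gap)
    (H : StretchedMixing μ ℱ ξ c g r) (h0 : ∀ i, ∫ ω, ξ i ω ∂μ = 0)
    (hC : TruncationBound μ ξ r C) {B E s : ℝ} (hE : 6 * e₀ ≤ E) (hE0 : 0 ≤ E)
    (hs : s + 6 * B * ∑ i ∈ Finset.range J, w i ≤ 2 * B)
    (hs0 : 0 ≤ s) (hB : 0 ≤ B)
    (hcrude : ∀ k ≤ J, ∀ (l m : ℕ) (u : ℝ), 1 ≤ l → (l : ℝ) ≤ A k → |u| ≤ U * (p / l) ^ κ →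
      logLaplace μ ξ (D k ^ r) u m l ≤ u ^ 2 * l * B + 4 ^ k * E)
    (hbase : ∀ (l m : ℕ) (u : ℝ), A 0 / 4 ≤ l → (l : ℝ) ≤ A 0 → |u| ≤ U * (p / l) ^ κ →
      logLaplace μ ξ (D 0 ^ r) u m l ≤ u ^ 2 / 2 * l * s + E) :
    ∀ k ≤ J, ∀ (l m : ℕ) (u : ℝ), A 0 / 4 ≤ l → (l : ℝ) ≤ A k → |u| ≤ U * (p / l) ^ κ →
      logLaplace μ ξ (D k ^ r) u m l ≤
        u ^ 2 / 2 * l * (s + 6 * B * ∑ i ∈ Finset.range k, w i) + 4 ^ k * E := by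
  intro k
  induction k with
  | zero => intro _ l m u hl hlA hu; simpa using hbase l m u hl hlA hu
  | succ k ih =>
    intro hk l m u hl hlA hu
    have hkJ : k < J := hk
    have ih := ih hkJ.le
    have hw := P.w_pos hkJ
    have hw' := P.w_le' k hkJ
    have he := P.e_nonneg hkJ
    have hl1 : 1 ≤ l := by
      have : (0 : ℝ) < l := by linarith [P.A_zero]
      exact_mod_cast this
    set S := s + 6 * B * ∑ i ∈ Finset.range k, w i with hS
    have hwsum : ∑ i ∈ Finset.range k, w i ≤ ∑ i ∈ Finset.range J, w i :=
      Finset.sum_le_sum_of_subset_of_nonneg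
        (fun i hi => Finset.mem_range.2 (lt_trans (Finset.mem_range.1 hi) hkJ))
        (fun i hi _ => (P.w_pos (Finset.mem_range.1 hi)).le)
    have hwsum0 : 0 ≤ ∑ i ∈ Finset.range k, w i := Finset.sum_nonneg fun i hi =>
      (P.w_pos ((Finset.mem_range.1 hi).trans hkJ)).le
    have hS0 : 0 ≤ S := by positivity
    have hSB : S ≤ 2 * B := le_trans (by rw [hS]; gcongr) hs
    have hSS : s + 6 * B * ∑ i ∈ Finset.range (k + 1), w i = S + 6 * B * w k := by
      rw [Finset.sum_range_succ]; ring
    have hEk : E ≤ 4 ^ k * E := le_mul_of_one_le_left hE0 (one_le_pow₀ (by norm_num))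
    have hpow : (4 : ℝ) ^ (k + 1) * E = 4 * (4 ^ k * E) := by ring
    set F := (4 : ℝ) ^ k * E with hF
    rw [hpow, hSS]
    -- a block that already fits the level `k` only needs another truncation level; a longer one is split
    rcases le_or_gt (l : ℝ) (A k) with hlk | hlk
    · have h1 := ih l m u hl hlk hu
      have h2 := (abs_le.1 (P.retruncate H h0 hC hkJ hl1 hlA hu m)).2
      have h3 : 0 ≤ u ^ 2 / 2 * l * (6 * B * w k) := by positivity
      linarith
    · obtain ⟨l₁, l₂, rfl, h1, h2, h1', h2', h1s, h2s, h1A, h2A⟩ := P.exists_split hkJ hlk hlA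
      have hs := P.split_le H h0 hC hkJ h1 h2 h1' h2' h1A h2A hlk.le hu m
      have g1 := ih l₁ m _ h1s h1A (P.domain_half hkJ h1 h1' hu)
      have g2 := ih l₂ (m + l₁ + gap k) _ h2s h2A (P.domain_half hkJ h2 h2' hu)
      have g3 := hcrude k hkJ.le (gap k) (m + l₁) _ (P.gap_pos k hkJ)
        (by linarith [P.gap_le k hkJ, P.A_pos k]) (P.domain_gap hkJ hlk.le le_rfl hu)
      set L : ℝ := ((l₁ + gap k + l₂ : ℕ) : ℝ) with hL
      have hLe : L = l₁ + gap k + l₂ := by rw [hL]; push_cast; ring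
      have hL0 : 0 < L := by linarith [P.A_pos k]
      have hgw := P.gap_div_w_le hkJ hlk.le
      have m1 := mul_le_mul_of_nonneg_left (add_le_add g1 g2) (show 0 ≤ 1 - w k by linarith)
      have m2 := mul_le_mul_of_nonneg_left g3 hw.le
      have e1 : (1 - w k) * ((u / (1 - w k)) ^ 2 / 2 * l₁ * S + F +
          ((u / (1 - w k)) ^ 2 / 2 * l₂ * S + F))
          = u ^ 2 / 2 * (S * ((l₁ + l₂) * (1 - w k)⁻¹)) + (1 - w k) * (2 * F) := by
        have : 1 - w k ≠ 0 := by linarith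
        field_simp; ring
      have e2 : w k * ((u / w k) ^ 2 * gap k * B + F) =
          u ^ 2 / 2 * (2 * B * (gap k / w k)) + w k * F := by
        field_simp
      rw [e1] at m1
      rw [e2] at m2
      have hinv := P.inv_one_sub_w_le hkJ
      have hinv0 : 0 ≤ (1 - w k)⁻¹ := inv_nonneg.2 (by linarith)
      have h5 : ((l₁ : ℝ) + l₂) * (1 - w k)⁻¹ ≤ L * (1 + 2 * w k) := by
        have : (0 : ℝ) ≤ gap k := Nat.cast_nonneg _
        exact mul_le_mul (by linarith) hinv hinv0 hL0.le
      have h6 : u ^ 2 / 2 * (S * ((l₁ + l₂) * (1 - w k)⁻¹)) + u ^ 2 / 2 * (2 * B * (gap k / w k)) ≤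
          u ^ 2 / 2 * L * (S + 6 * B * w k) := by
        rw [← mul_add, mul_assoc (u ^ 2 / 2)]
        refine mul_le_mul_of_nonneg_left ?_ (by positivity)
        calc S * ((l₁ + l₂) * (1 - w k)⁻¹) + 2 * B * (gap k / w k)
            ≤ S * (L * (1 + 2 * w k)) + 2 * B * (w k * L) :=
              add_le_add (mul_le_mul_of_nonneg_left h5 hS0)
                (mul_le_mul_of_nonneg_left hgw (by positivity))
          _ = L * (S + 2 * w k * S + 2 * B * w k) := by ring
          _ ≤ L * (S + 2 * w k * (2 * B) + 2 * B * w k) := by gcongr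
          _ = _ := by ring
      have h7 : 0 ≤ w k * F := by positivity
      linarith only [hs, m1, m2, h6, h7, hE, hEk, he]

set_option maxHeartbeats 400000 in
/-- The sharp lower bound; the log-Laplace transforms of the gaps, which are subtracted here, are again
handled by the crude upper bound. -/
theorem le_logLaplace_sharp (P : ScaleData c g r C κ U p e₀ J A D w gap)
    (H : StretchedMixing μ ℱ ξ c g r) (h0 : ∀ i, ∫ ω, ξ i ω ∂μ = 0)
    (hC : TruncationBound μ ξ r C) {B E s : ℝ} (hE : 6 * e₀ ≤ E) (hE0 : 0 ≤ E)
    (hs : s ≤ 2 * B) (hB : 0 ≤ B)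
    (hcrude : ∀ k ≤ J, ∀ (l m : ℕ) (u : ℝ), 1 ≤ l → (l : ℝ) ≤ A k → |u| ≤ U * (p / l) ^ κ →
      logLaplace μ ξ (D k ^ r) u m l ≤ u ^ 2 * l * B + 4 ^ k * E)
    (hbase : ∀ (l m : ℕ) (u : ℝ), A 0 / 4 ≤ l → (l : ℝ) ≤ A 0 → |u| ≤ U * (p / l) ^ κ →
      u ^ 2 / 2 * l * s - E ≤ logLaplace μ ξ (D 0 ^ r) u m l) :
    ∀ k ≤ J, ∀ (l m : ℕ) (u : ℝ), A 0 / 4 ≤ l → (l : ℝ) ≤ A k → |u| ≤ U * (p / l) ^ κ →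
      u ^ 2 / 2 * l * (s - 6 * B * ∑ i ∈ Finset.range k, w i) - 4 ^ k * E ≤
        logLaplace μ ξ (D k ^ r) u m l := by
  intro k
  induction k with
  | zero => intro _ l m u hl hlA hu; simpa using hbase l m u hl hlA hu
  | succ k ih =>
    intro hk l m u hl hlA hu
    have hkJ : k < J := hk
    have ih := ih hkJ.le
    have hw := P.w_pos hkJ
    have hw' := P.w_le' k hkJ
    have he := P.e_nonneg hkJ
    have hl1 : 1 ≤ l := by
      have : (0 : ℝ) < l := by linarith [P.A_zero]
      exact_mod_cast this
    set S := s - 6 * B * ∑ i ∈ Finset.range k, w i with hS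
    have hwsum0 : 0 ≤ ∑ i ∈ Finset.range k, w i := Finset.sum_nonneg fun i hi =>
      (P.w_pos ((Finset.mem_range.1 hi).trans hkJ)).le
    have hSB : S ≤ 2 * B := by
      have : 0 ≤ 6 * B * ∑ i ∈ Finset.range k, w i := by positivity
      linarith
    have hSS : s - 6 * B * ∑ i ∈ Finset.range (k + 1), w i = S - 6 * B * w k := by
      rw [Finset.sum_range_succ]; ring
    have hEk : E ≤ 4 ^ k * E := le_mul_of_one_le_left hE0 (one_le_pow₀ (by norm_num))
    have hpow : (4 : ℝ) ^ (k + 1) * E = 4 * (4 ^ k * E) := by ring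
    set F := (4 : ℝ) ^ k * E with hF
    rw [hpow, hSS]
    -- a block that already fits the level `k` only needs another truncation level; a longer one is split
    rcases le_or_gt (l : ℝ) (A k) with hlk | hlk
    · have h1 := ih l m u hl hlk hu
      have h2 := (abs_le.1 (P.retruncate H h0 hC hkJ hl1 hlA hu m)).1
      have h3 : 0 ≤ u ^ 2 / 2 * l * (6 * B * w k) := by positivity
      linarith
    · obtain ⟨l₁, l₂, rfl, h1, h2, h1', h2', h1s, h2s, h1A, h2A⟩ := P.exists_split hkJ hlk hlA
      have hs := P.le_split H h0 hC hkJ h1 h2 h1A h2A hlk.le hu m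
      have huu : |u * (1 - w k)| ≤ |u| := by
        rw [abs_mul]
        refine mul_le_of_le_one_right (abs_nonneg _) ?_
        rw [abs_le]; constructor <;> linarith
      have g1 := ih l₁ m _ h1s h1A (P.domain_mono h1 (by omega) huu hu)
      have g2 := ih l₂ (m + l₁ + gap k) _ h2s h2A (P.domain_mono h2 (by omega) huu hu)
      have g3 := hcrude k hkJ.le (gap k) (m + l₁) (-(u * (1 - w k) / w k)) (P.gap_pos k hkJ)
        (by linarith [P.gap_le k hkJ, P.A_pos k])
        (by rw [abs_neg]; exact P.domain_gap hkJ hlk.le huu hu)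
      have hx := P.gap_div_le_sq hkJ hlk.le
      set L : ℝ := ((l₁ + gap k + l₂ : ℕ) : ℝ) with hL
      have hLe : L = l₁ + gap k + l₂ := by rw [hL]; push_cast; ring
      have hL0 : 0 < L := by linarith [P.A_pos k]
      rw [div_le_iff₀ hL0] at hx
      have hgw := P.gap_div_w_le hkJ hlk.le
      have hgw' : (gap k : ℝ) ≤ w k * L := by
        refine hx.trans ?_
        gcongr
        nlinarith
      have hw1 : 0 < 1 - w k := by linarith
      have m2 := mul_le_mul_of_nonneg_left g3 hw.le
      have e2 : w k * ((-(u * (1 - w k) / w k)) ^ 2 * gap k * B + F) =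
          (1 - w k) * (u ^ 2 / 2 * (2 * B * ((1 - w k) * (gap k / w k)))) + w k * F := by
        field_simp
      rw [e2] at m2
      have h6 : u ^ 2 / 2 * L * (S - 6 * B * w k) ≤
          u ^ 2 / 2 * ((1 - w k) * (l₁ + l₂) * S) -
            u ^ 2 / 2 * (2 * B * ((1 - w k) * (gap k / w k))) := by
        rw [← mul_sub, mul_assoc (u ^ 2 / 2)]
        refine mul_le_mul_of_nonneg_left ?_ (by positivity)
        have q1 : 2 * B * ((1 - w k) * (gap k / w k)) ≤ 2 * B * (1 * (w k * L)) :=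
          mul_le_mul_of_nonneg_left (mul_le_mul (by linarith) hgw (by positivity) zero_le_one)
            (by linarith)
        -- the gap and the factor `1 - w` take away at most `2 w L` from the length `L` of the block
        have q2 : L * S - (1 - w k) * (l₁ + l₂) * S ≤ (2 * w k * L) * (2 * B) := by
          have q3 : L * S - (1 - w k) * (l₁ + l₂) * S = (L - (1 - w k) * (l₁ + l₂)) * S := by ring
          have q4 : 0 ≤ L - (1 - w k) * (l₁ + l₂) := by
            have : 0 ≤ w k * ((l₁ : ℝ) + l₂) := by positivity
            have : (0 : ℝ) ≤ gap k := Nat.cast_nonneg _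
            linarith
          have q5 : L - (1 - w k) * (l₁ + l₂) ≤ 2 * w k * L := by
            have : w k * ((l₁ : ℝ) + l₂) ≤ w k * L := by
              have : (0 : ℝ) ≤ gap k := Nat.cast_nonneg _
              gcongr; linarith
            linarith
          rw [q3]
          exact (mul_le_mul_of_nonneg_left hSB q4).trans
            (mul_le_mul_of_nonneg_right q5 (by linarith))
        linarith only [q1, q2]
      -- divide the inequality by `1 - w`
      have e3 : (u * (1 - w k)) ^ 2 / 2 * l₁ * S + (u * (1 - w k)) ^ 2 / 2 * l₂ * S =
          (1 - w k) * (u ^ 2 / 2 * ((1 - w k) * (l₁ + l₂) * S)) := by ring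
      have h7 : w k * F ≤ 1 / 4 * F := by gcongr
      have h8 : (1 - w k) * (u ^ 2 / 2 * L * (S - 6 * B * w k)) - 3 * F ≤
          (1 - w k) * logLaplace μ ξ (D (k + 1) ^ r) u m (l₁ + gap k + l₂) := by
        have := mul_le_mul_of_nonneg_left h6 hw1.le
        rw [mul_sub (1 - w k) (u ^ 2 / 2 * ((1 - w k) * (l₁ + l₂) * S))] at this
        linarith only [this, hs, g1, g2, e3, m2, h7, hE, hEk, he]
      have h9 : (1 - w k) * (u ^ 2 / 2 * L * (S - 6 * B * w k) - 4 * F) ≤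
          (1 - w k) * logLaplace μ ξ (D (k + 1) ^ r) u m (l₁ + gap k + l₂) := by
        have : 3 / 4 * F ≤ (1 - w k) * F := by gcongr; linarith
        linarith only [h8, this]
      exact le_of_mul_le_mul_left h9 hw1

end ScaleData

end Recursion

/-! ### Construction of the scales -/

section Scales

lemma sum_geometric_le {x : ℝ} (hx0 : 0 ≤ x) (hx1 : x < 1) (J : ℕ) :
    ∑ k ∈ Finset.range J, x ^ (J - (k + 1)) ≤ (1 - x)⁻¹ := by
  have h1 : ∑ k ∈ Finset.range J, x ^ (J - (k + 1)) = ∑ k ∈ Finset.range J, x ^ k := by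
    rw [← Finset.sum_range_reflect]
    exact Finset.sum_congr rfl fun k hk => by
      have := Finset.mem_range.1 hk
      congr 1; omega
  rw [h1, ← tsum_geometric_of_lt_one hx0 hx1]
  exact (summable_geometric_of_lt_one hx0 hx1).sum_le_tsum _ fun k _ => pow_nonneg hx0 k

set_option maxHeartbeats 1000000 in
/-- Construction of the scales: `A k = p 2^{k-J}`, gaps of length about
`δ k = q (A k / p)^{1+κ}`, and truncation levels given by `D k = (δ k)^g`. The lowest scale has length
of order `n ^ (4 κ)`. The number `ω` measures the ratio of the block length `p` to the gap length `q`
at the top, and `ν` the ratio of the bound for `|u S|` to the logarithm `q ^ g` of the mixing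
coefficient of that gap: the former has to be large and the latter small. -/
lemma exists_scaleData {c g r C κ U p q ω n ν e₀ : ℝ} (hc : 0 < c) (hg : 0 < g)
    (hC : 1 ≤ C) (hκ : 0 < κ) (hκ2 : κ ≤ 1 / 2) (hexp : (1 + κ) * g * (1 - r) ≤ 1 - κ)
    (hU : 0 ≤ U) (hq : 0 < q) (hω : 1 ≤ ω) (hpq : p = q * ω ^ κ) (hn : 1 ≤ n)
    (hUν : U * p * (q ^ g) ^ r ≤ ν * q ^ g)
    (hν : ν * 2 ^ ((1 + κ) * g) ≤ min c 1 / 8)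
    (hnp : n ^ (4 * κ) ≤ p) (hpn : p ≤ n) (hωn : ω ≤ n) (hn8 : 8 ≤ n ^ (4 * κ))
    (hω1 : 4 * ω ^ (-κ) ≤ 1 / 4) (hω2 : (4 * ω ^ (-κ)) ^ κ ≤ 1 / 4)
    (hω3 : (4 * ω ^ (-κ)) ^ κ ≤ 1 - 2 ^ (-κ))
    (hmean : 2 * C * Real.exp (-n ^ (2 * κ * g) / 8) ≤ 1 / 2)
    (he₀ : e₀ = 12 * n * Real.exp (-(min c 1 / 2) * n ^ (2 * κ * g))) :
    ∃ (J : ℕ) (A D w : ℕ → ℝ) (gap : ℕ → ℕ), ScaleData c g r C κ U p e₀ J A D w gap ∧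
      A J = p ∧ D J = q ^ g ∧ n ^ (4 * κ) ≤ A 0 ∧ A 0 ≤ 2 * n ^ (4 * κ) ∧ (2 : ℝ) ^ J ≤ n ∧
      n ^ (2 * κ * g) ≤ D 0 ∧ D 0 ≤ A 0 ^ g ∧
      ∑ k ∈ Finset.range J, w k ≤ (4 * ω ^ (-κ)) ^ κ * (1 - 2 ^ (-(κ * κ)))⁻¹ := by
  have hn0 : 0 < n := by linarith
  have hω0 : 0 < ω := by linarith
  have hns : 0 < n ^ (4 * κ) := Real.rpow_pos_of_pos hn0 _
  have hp : 0 < p := by linarith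
  obtain ⟨J, hJ1, hJ2⟩ := exists_nat_pow_near (show 1 ≤ p / n ^ (4 * κ) by
    rwa [one_le_div hns]) (one_lt_two)
  set A : ℕ → ℝ := fun k => p / 2 ^ J * 2 ^ k with hA
  set δ : ℕ → ℝ := fun k => q * (A k / p) ^ (1 + κ) with hδ
  set D : ℕ → ℝ := fun k => δ k ^ g with hD
  set gap : ℕ → ℕ := fun k => ⌈δ (k + 1)⌉₊ with hgap
  set w : ℕ → ℝ := fun k => (gap k / A k) ^ κ with hw
  have h2J : (0 : ℝ) < 2 ^ J := by positivity
  have hApos : ∀ k, 0 < A k := fun k => by positivity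
  have hAJ : A J = p := by simp only [hA]; field_simp
  have hAsucc : ∀ k, A (k + 1) = 2 * A k := fun k => by simp only [hA, pow_succ]; ring
  have hA0 : n ^ (4 * κ) ≤ A 0 := by
    simp only [hA, pow_zero, mul_one]
    rw [le_div_iff₀ h2J]; rw [le_div_iff₀ hns] at hJ1; linarith
  have hA0' : A 0 ≤ 2 * n ^ (4 * κ) := by
    simp only [hA, pow_zero, mul_one]
    rw [div_le_iff₀ h2J]; rw [div_lt_iff₀ hns, pow_succ] at hJ2; linarith
  have hAmono : Monotone A := monotone_nat_of_le_succ fun k => by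
    rw [hAsucc]; linarith [hApos k]
  have hAle : ∀ k ≤ J, A k ≤ p := fun k hk => by rw [← hAJ]; exact hAmono hk
  have hδpos : ∀ k, 0 < δ k := fun k => by have := hApos k; positivity
  have hδmono : Monotone δ := fun i j hij => by
    have := hAmono hij
    have := hApos i
    simp only [hδ]; gcongr
  have hDmono : Monotone D := fun i j hij =>
    Real.rpow_le_rpow (hδpos i).le (hδmono hij) hg.le
  have hδA : ∀ k, δ k = A k * (ω ^ (-κ) * (A k / p) ^ κ) := fun k => by
    simp only [hδ]
    rw [Real.rpow_add (by have := hApos k; positivity), Real.rpow_one, Real.rpow_neg hω0.le]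
    have : 0 < ω ^ κ := by positivity
    rw [hpq]; field_simp
  have hδ0 : n ^ (2 * κ) ≤ δ 0 := by
    rw [hδA]
    have h1 : n ^ (-κ) ≤ ω ^ (-κ) := by
      rw [Real.rpow_neg hn0.le, Real.rpow_neg hω0.le]; gcongr
    have h2 : n ^ (-κ) ≤ (A 0 / p) ^ κ := by
      rw [Real.rpow_neg hn0.le, ← Real.inv_rpow hn0.le]
      refine Real.rpow_le_rpow (by positivity) ?_ hκ.le
      rw [inv_eq_one_div, div_le_div_iff₀ hn0 hp]
      nlinarith
    calc n ^ (2 * κ) = n ^ (4 * κ) * (n ^ (-κ) * n ^ (-κ)) := by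
          rw [← Real.rpow_add hn0, ← Real.rpow_add hn0]; ring_nf
      _ ≤ _ := by gcongr
  have hn2 : 1 ≤ n ^ (2 * κ) := Real.one_le_rpow hn (by positivity)
  have hD0 : n ^ (2 * κ * g) ≤ D 0 := by
    simp only [hD]
    rw [Real.rpow_mul hn0.le]
    exact Real.rpow_le_rpow (by positivity) hδ0 hg.le
  have hDn : ∀ k, n ^ (2 * κ * g) ≤ D k := fun k => hD0.trans (hDmono (Nat.zero_le k))
  have hDone : ∀ k, 1 ≤ D k := fun k =>
    (Real.one_le_rpow hn (by positivity)).trans (hDn k)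
  have hδone : ∀ k, 1 ≤ δ k := fun k => (hn2.trans hδ0).trans (hδmono (Nat.zero_le k))
  have hδJ : δ J = q := by simp only [hδ, hAJ]; rw [div_self hp.ne', Real.one_rpow, mul_one]
  have hωκ : ω ^ (-κ) ≤ 1 := Real.rpow_le_one_of_one_le_of_nonpos hω (by linarith)
  have hDA : D 0 ≤ A 0 ^ g := by
    refine Real.rpow_le_rpow (hδpos 0).le ?_ hg.le
    rw [hδA]
    refine mul_le_of_le_one_right (hApos 0).le (mul_le_one₀ hωκ (by have := hApos 0; positivity) ?_)
    exact Real.rpow_le_one (by have := hApos 0; positivity)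
      ((div_le_one hp).2 (hAle 0 (Nat.zero_le _))) hκ.le
  have hgapdiv : ∀ k < J, gap k / A k ≤ 4 * ω ^ (-κ) * (A (k + 1) / p) ^ κ := fun k hk => by
    have h1 : (gap k : ℝ) ≤ 2 * δ (k + 1) := by
      have := Nat.ceil_lt_add_one (hδpos (k + 1)).le
      linarith [hδone (k + 1)]
    rw [div_le_iff₀ (hApos k)]
    refine h1.trans (le_of_eq ?_)
    rw [hδA, hAsucc]; ring
  have hgapdiv' : ∀ k < J, gap k / A k ≤ 4 * ω ^ (-κ) := fun k hk =>
    (hgapdiv k hk).trans (mul_le_of_le_one_right (by positivity)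
      (Real.rpow_le_one (by have := hApos (k + 1); positivity)
        ((div_le_one hp).2 (hAle (k + 1) hk)) hκ.le))
  have hwle : ∀ k < J, w k ≤ (4 * ω ^ (-κ)) ^ κ := fun k hk =>
    Real.rpow_le_rpow (by have := hApos k; positivity) (hgapdiv' k hk) hκ.le
  have hDJ : ∀ k, D k = q ^ g * (A k / p) ^ ((1 + κ) * g) := fun k => by
    have := hApos k
    simp only [hD, hδ]
    rw [Real.mul_rpow hq.le (by positivity), ← Real.rpow_mul (by positivity)]
  -- the ratio of the bound on `|u S|` to the cost `D k` does not grow at small scales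
  have hN : ∀ k ≤ J, scaleBound r κ U p A D k ≤ ν * D k := fun k hk => by
    have hAk := hApos k
    set a := A k / p with ha
    have ha0 : 0 < a := by positivity
    have ha1 : a ≤ 1 := (div_le_one hp).2 (hAle k hk)
    have hAa : A k = p * a := by rw [ha]; field_simp
    have e1 : scaleBound r κ U p A D k =
        U * p * (q ^ g) ^ r * a ^ (1 - κ + (1 + κ) * g * r) := by
      unfold scaleBound
      rw [hDJ, hAa, mul_div_cancel_left₀ _ hp.ne', Real.mul_rpow hp.le ha0.le,
        Real.mul_rpow (by positivity) (by positivity), ← Real.rpow_mul ha0.le,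
        Real.rpow_add ha0]
      have : p ^ κ * p ^ (1 - κ) = p := by rw [← Real.rpow_add hp]; simp
      linear_combination (U * a ^ (1 - κ) * (q ^ g) ^ r * a ^ ((1 + κ) * g * r)) * this
    rw [e1, hDJ, ← ha, ← mul_assoc]
    have h3 : a ^ (1 - κ + (1 + κ) * g * r) ≤ a ^ ((1 + κ) * g) :=
      Real.rpow_le_rpow_of_exponent_ge ha0 ha1 (by linarith)
    calc U * p * (q ^ g) ^ r * a ^ (1 - κ + (1 + κ) * g * r)
        ≤ U * p * (q ^ g) ^ r * a ^ ((1 + κ) * g) := by gcongr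
      _ ≤ ν * q ^ g * a ^ ((1 + κ) * g) := by gcongr
  have hDsucc : ∀ k, D (k + 1) = 2 ^ ((1 + κ) * g) * D k := fun k => by
    have := hApos k
    rw [hDJ, hDJ, hAsucc, mul_div_assoc, Real.mul_rpow two_pos.le (by positivity)]; ring
  have hν0 : 0 ≤ ν := by
    have : 0 ≤ U * p * (q ^ g) ^ r := by positivity
    exact nonneg_of_mul_nonneg_left (this.trans hUν) (by positivity)
  have hc1 : 0 < min c 1 := lt_min hc one_pos
  -- `D` changes by a constant factor from one level to the next, for which `ν` leaves room
  have hN' : ∀ k < J, scaleBound r κ U p A D (k + 1) ≤ min c 1 / 8 * D k := fun k hk => by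
    refine (hN (k + 1) hk).trans ?_
    rw [hDsucc, ← mul_assoc]
    exact mul_le_mul_of_nonneg_right hν (by linarith [hDone k])
  have hνc : ν ≤ min c 1 / 8 := by
    refine le_trans ?_ hν
    exact le_mul_of_one_le_right hν0 (Real.one_le_rpow one_le_two (by positivity))
  refine ⟨J, A, D, w, gap, ?_, hAJ, ?_, hA0, hA0', ?_, hD0, hDA, ?_⟩
  · refine ⟨hκ, hκ2, hU, hp, hn8.trans hA0, hAsucc, fun k _ => hDone k,
      fun k _ => hDmono (Nat.le_succ k), fun k _ => Nat.ceil_pos.2 (hδpos _), fun k hk => ?_,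
      fun k _ => rfl, fun k hk => (hwle k hk).trans hω3, fun k hk => (hwle k hk).trans hω2,
      fun k hk => ?_, fun k hk => ?_, fun k hk => ?_⟩
    · have := (hgapdiv' k hk).trans hω1
      rw [div_le_iff₀ (hApos k)] at this; linarith
    · have h1 : D (k + 1) ≤ (gap k : ℝ) ^ g :=
        Real.rpow_le_rpow (hδpos _).le (Nat.le_ceil _) hg.le
      have h2 := hN (k + 1) hk
      have h3 : 4 * scaleBound r κ U p A D (k + 1) - c * (gap k : ℝ) ^ g ≤
          -(min c 1 / 2) * n ^ (2 * κ * g) := by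
        have h4 := mul_le_mul_of_nonneg_left h1 hc.le
        have h5 : ν * D (k + 1) ≤ min c 1 / 8 * D (k + 1) := by
          have := hDone (k + 1); gcongr
        have h6 : min c 1 * D (k + 1) ≤ c * D (k + 1) := by
          have := hDone (k + 1); gcongr; exact min_le_left _ _
        have h7 := mul_le_mul_of_nonneg_left (hDn (k + 1)) hc1.le
        linarith
      rw [he₀]
      have h8 := Real.exp_le_exp.2 h3
      have h9 : 4 * Real.exp (-(min c 1 / 2) * n ^ (2 * κ * g)) ≤
          12 * n * Real.exp (-(min c 1 / 2) * n ^ (2 * κ * g)) := by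
        gcongr; linarith
      linarith
    · have h2 := hN' k hk
      have h3 : scaleBound r κ U p A D (k + 1) + (1 - D k) ≤
          1 + -(min c 1 / 2) * n ^ (2 * κ * g) := by
        have h5 : min c 1 / 8 * D k ≤ 1 / 2 * D k :=
          mul_le_mul_of_nonneg_right (by linarith [min_le_right c 1]) (by linarith [hDone k])
        have h7 : min c 1 / 2 * n ^ (2 * κ * g) ≤ 1 / 2 * D k := by
          exact mul_le_mul (by linarith [min_le_right c 1]) (hDn k) (by positivity) (by norm_num)
        linarith
      have h8 := Real.exp_le_exp.2 h3
      rw [Real.exp_add, Real.exp_add] at h8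
      have h9 : A (k + 1) ≤ n := (hAle (k + 1) hk).trans hpn
      have hA1 := hApos (k + 1)
      rw [he₀]
      have he : Real.exp 1 ≤ 3 := by linarith [Real.exp_one_lt_d9]
      calc 4 * Real.exp (scaleBound r κ U p A D (k + 1)) * (A (k + 1) * Real.exp (1 - D k))
          = 4 * A (k + 1) * (Real.exp (scaleBound r κ U p A D (k + 1)) * Real.exp (1 - D k)) := by
            ring
        _ ≤ 4 * n * (3 * Real.exp (-(min c 1 / 2) * n ^ (2 * κ * g))) :=
            mul_le_mul (by linarith) (h8.trans (mul_le_mul_of_nonneg_right he (Real.exp_pos _).le))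
              (by positivity) (by positivity)
        _ = _ := by ring
    · have h2 := hN' k hk
      have h3 : min c 1 / 8 * D k ≤ 1 / 8 * D k := by
        have := hDone k
        gcongr; linarith [min_le_right c 1]
      have h4 : 1 / 8 * D k ≤ Real.exp (D k / 8) := by
        linarith [Real.add_one_le_exp (D k / 8)]
      have h5 : Real.exp (D k / 8) * Real.exp (-D k / 4) ≤ Real.exp (-n ^ (2 * κ * g) / 8) := by
        rw [← Real.exp_add, Real.exp_le_exp]; linarith [hDn k]
      calc 2 * scaleBound r κ U p A D (k + 1) * (C * Real.exp (-D k / 4))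
          ≤ 2 * Real.exp (D k / 8) * (C * Real.exp (-D k / 4)) :=
            mul_le_mul_of_nonneg_right (by linarith) (by positivity)
        _ = 2 * C * (Real.exp (D k / 8) * Real.exp (-D k / 4)) := by ring
        _ ≤ 2 * C * Real.exp (-n ^ (2 * κ * g) / 8) := by gcongr
        _ ≤ _ := hmean
  · simp only [hD, hδJ]
  · refine hJ1.trans ?_
    rw [div_le_iff₀ hns]; nlinarith
  -- the weights decay geometrically from the top level down, with the ratio `2 ^ (-κ²)`
  · set x : ℝ := 2 ^ (-(κ * κ)) with hx
    have hx0 : 0 ≤ x := by positivity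
    have hx1 : x < 1 := Real.rpow_lt_one_of_one_lt_of_neg one_lt_two (by nlinarith)
    have hwk : ∀ k ∈ Finset.range J, w k ≤ (4 * ω ^ (-κ)) ^ κ * x ^ (J - (k + 1)) := by
      intro k hk
      have hkJ := Finset.mem_range.1 hk
      have h1 : A (k + 1) / p = (2 : ℝ) ^ (-((J - (k + 1) : ℕ) : ℝ)) := by
        rw [Real.rpow_neg two_pos.le, Real.rpow_natCast]
        simp only [hA]
        have : (2 : ℝ) ^ J = 2 ^ (k + 1) * 2 ^ (J - (k + 1)) := by
          rw [← pow_add]; congr 1; omega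
        rw [this]; field_simp
      have h2 := Real.rpow_le_rpow (by have := hApos k; positivity) (hgapdiv k hkJ) hκ.le
      refine h2.trans (le_of_eq ?_)
      rw [Real.mul_rpow (by positivity) (by rw [h1]; positivity), h1, ← Real.rpow_mul two_pos.le,
        ← Real.rpow_mul two_pos.le, hx, ← Real.rpow_natCast, ← Real.rpow_mul two_pos.le]
      ring_nf
    refine (Finset.sum_le_sum hwk).trans ?_
    rw [← Finset.mul_sum]
    gcongr
    exact sum_geometric_le hx0 hx1 J

variable {Ω : Type*} {mΩ : MeasurableSpace Ω} {μ : Measure Ω} [IsProbabilityMeasure μ]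
  {ℱ : ℕ → MeasurableSpace Ω} {ξ : ℕ → Ω → ℝ}

set_option maxHeartbeats 1000000 in
/-- Bounds for the log-Laplace transform of a block of length at most `p`: a crude one, and a
sharp one for the blocks that are not too short. The lowest scale is settled by Taylor expansion, and
the recursion over the scales does the rest. -/
lemma StretchedMixing.block_bounds {c g r C κ U p q ω n ν E θ ε V s₂ W : ℝ} {ρ : ℕ → ℝ}
    (H : StretchedMixing μ ℱ ξ c g r) (h0 : ∀ i, ∫ ω, ξ i ω ∂μ = 0)
    (hC : TruncationBound μ ξ r C) (hρ : ∀ i k, ∫ ω, ξ i ω * ξ (i + k) ω ∂μ = ρ k)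
    (hs₂ : 0 < s₂) (hV : s₂ < V) (hvar : ∀ l : ℕ, |sumVar ρ l - l * s₂| ≤ V - s₂)
    (hκ : 0 < κ) (hκ2 : κ ≤ 1 / 2) (hexp : (1 + κ) * g * (1 - r) ≤ 1 - κ)
    (hU : 0 ≤ U) (hq : 0 < q) (hω : 1 ≤ ω) (hpq : p = q * ω ^ κ) (hn : 1 ≤ n)
    (hUν : U * p * (q ^ g) ^ r ≤ ν * q ^ g)
    (hν : ν * 2 ^ ((1 + κ) * g) ≤ min c 1 / 8)
    (hnp : n ^ (4 * κ) ≤ p) (hpn : p ≤ n) (hωn : ω ≤ n) (hn8 : 8 ≤ n ^ (4 * κ))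
    (hω1 : 4 * ω ^ (-κ) ≤ 1 / 4) (hω2 : (4 * ω ^ (-κ)) ^ κ ≤ 1 / 4)
    (hω3 : (4 * ω ^ (-κ)) ^ κ ≤ 1 - 2 ^ (-κ))
    (hmean : 2 * C * Real.exp (-n ^ (2 * κ * g) / 8) ≤ 1 / 2)
    (hE1 : 72 * n * Real.exp (-(min c 1 / 2) * n ^ (2 * κ * g)) ≤ E)
    (hE2 : 4 * C ^ 2 * Real.exp (-n ^ (2 * κ * g) / 4) ≤ E)
    (hθ : U * n ^ κ * (2 * n ^ (4 * κ)) * ((2 * n ^ (4 * κ)) ^ g) ^ r ≤ θ) (hθ6 : θ ≤ 1 / 6)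
    (hW : (4 * ω ^ (-κ)) ^ κ * (1 - 2 ^ (-(κ * κ)))⁻¹ ≤ W) (hW6 : W ≤ 1 / 6)
    (hWε : 24 * V * W ≤ ε) (hεV : ε ≤ V)
    (hup : (1 + 2 * θ) * (s₂ + 4 * (V - s₂) / n ^ (4 * κ)) ≤ s₂ + ε / 2)
    (hlow : s₂ - ε / 2 ≤ (1 - 6 * θ) * (s₂ - 4 * (V - s₂) / n ^ (4 * κ))) :
    (∀ (l m : ℕ) (u : ℝ), 1 ≤ l → (l : ℝ) ≤ p → |u| ≤ U →
      logLaplace μ ξ ((q ^ g) ^ r) u m l ≤ u ^ 2 * l * (2 * V) + n ^ 2 * E) ∧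
    (∀ (l m : ℕ) (u : ℝ), p / 4 ≤ l → (l : ℝ) ≤ p → |u| ≤ U →
      |logLaplace μ ξ ((q ^ g) ^ r) u m l - u ^ 2 / 2 * l * s₂| ≤ u ^ 2 / 2 * l * ε + n ^ 2 * E) := by
  obtain ⟨J, A, D, w, gap, P, hAJ, hDJ, hA0, hA0', h2J, hD0, hDA, hwsum⟩ :=
    exists_scaleData H.c_pos H.g_pos hC.1 hκ hκ2 hexp hU hq hω hpq hn hUν hν hnp hpn
      hωn hn8 hω1 hω2 hω3 hmean rfl
  have hwW := hwsum.trans hW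
  have hp := P.p_pos
  have hn0 : 0 < n := by linarith
  have hE0 : 0 ≤ E := le_trans (by positivity) hE1
  have hC1 := hC.1
  have hV0 : 0 < V := by linarith
  have h6e : 6 * (12 * n * Real.exp (-(min c 1 / 2) * n ^ (2 * κ * g))) ≤ E := by linarith
  have hA8 := P.A_zero
  have hA0pos : 0 < A 0 := by linarith
  have hD1 := P.D_one 0 (Nat.zero_le _)
  -- the additive error grows by a factor of at most `4` per level, which is harmless as `2 ^ J ≤ n`
  have h4J : (4 : ℝ) ^ J * E ≤ n ^ 2 * E := by
    refine mul_le_mul_of_nonneg_right ?_ hE0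
    calc (4 : ℝ) ^ J = (2 ^ J) ^ 2 := by rw [← pow_mul, mul_comm, pow_mul]; norm_num
      _ ≤ n ^ 2 := by gcongr
  have hwJ0 : ∀ k ≤ J, 0 ≤ ∑ i ∈ Finset.range k, w i := fun k hk => Finset.sum_nonneg fun i hi =>
    (P.w_pos ((Finset.mem_range.1 hi).trans_le hk)).le
  have hwk : ∀ k ≤ J, ∑ i ∈ Finset.range k, w i ≤ W := fun k hk => by
    refine le_trans ?_ hwW
    exact Finset.sum_le_sum_of_subset_of_nonneg
        (fun i hi => Finset.mem_range.2 (lt_of_lt_of_le (Finset.mem_range.1 hi) hk))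
        (fun i hi _ => (P.w_pos (Finset.mem_range.1 hi)).le)
  have hθ' : scaleBound r κ U p A D 0 ≤ θ := by
    refine le_trans ?_ hθ
    unfold scaleBound
    have a1 : A 0 ^ (1 - κ) ≤ 2 * n ^ (4 * κ) := by
      refine le_trans ?_ hA0'
      exact Real.rpow_le_self_of_one_le (by linarith) (by linarith)
    have a2 : D 0 ^ r ≤ ((2 * n ^ (4 * κ)) ^ g) ^ r := by
      refine Real.rpow_le_rpow (by linarith) (hDA.trans ?_) H.r_nonneg
      exact Real.rpow_le_rpow hA0pos.le hA0' H.g_pos.le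
    gcongr
  have hexpD : Real.exp (-D 0 / 4) ≤ Real.exp (-n ^ (2 * κ * g) / 4) := by
    rw [Real.exp_le_exp]; linarith
  have hCD : C * Real.exp (-D 0 / 4) ≤ 1 / 4 := by
    have h1 : Real.exp (-D 0 / 4) ≤ Real.exp (-n ^ (2 * κ * g) / 8) := by
      rw [Real.exp_le_exp]; linarith
    have : C * Real.exp (-D 0 / 4) ≤ C * Real.exp (-n ^ (2 * κ * g) / 8) := by gcongr
    linarith
  have hCE : 4 * C ^ 2 * Real.exp (-D 0 / 4) ≤ E := le_trans (by gcongr) hE2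
  -- at the lowest scale `|u S| ≤ θ`
  have hsmall : ∀ (l m : ℕ) (u : ℝ), 1 ≤ l → (l : ℝ) ≤ A 0 → |u| ≤ U * (p / l) ^ κ →
      u ^ 2 / 2 * ((1 - 6 * θ) * sumVar ρ l) - E ≤ logLaplace μ ξ (D 0 ^ r) u m l ∧
      logLaplace μ ξ (D 0 ^ r) u m l ≤ u ^ 2 / 2 * ((1 + 2 * θ) * sumVar ρ l) + E := by
    intro l m u hl hlA hu
    have h1 := H.logLaplace_small h0 hC hρ hD1 hθ6 (m := m)
      ((P.abs_mul_le (Nat.zero_le _) hl hlA hu).trans hθ') hCD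
    constructor <;> linarith [h1.1, h1.2]
  have hθ0 : 0 ≤ θ := le_trans (by positivity) hθ
  have hvl : ∀ l : ℕ, 1 ≤ l → sumVar ρ l ≤ l * V := fun l hl => by
    have h1 := (abs_le.1 (hvar l)).2
    have h2 : (1 : ℝ) ≤ l := by exact_mod_cast hl
    nlinarith
  -- the bounded error in the variance is negligible for blocks of length at least `A 0 / 4`
  have hvs : ∀ l : ℕ, A 0 / 4 ≤ l → sumVar ρ l ≤ l * (s₂ + 4 * (V - s₂) / n ^ (4 * κ)) ∧
      l * (s₂ - 4 * (V - s₂) / n ^ (4 * κ)) ≤ sumVar ρ l := fun l hl => by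
    have h1 := abs_le.1 (hvar l)
    have hns : 0 < n ^ (4 * κ) := by linarith
    have h3 : V - s₂ ≤ l * (4 * (V - s₂) / n ^ (4 * κ)) := by
      rw [← mul_div_assoc, le_div_iff₀ hns]
      have : n ^ (4 * κ) ≤ 4 * l := by linarith
      nlinarith
    constructor <;> linarith [h1.1, h1.2]
  have hcrude0 := P.logLaplace_le H h0 hC hV0.le h6e hE0 (fun l m u hl hlA hu => by
    refine (hsmall l m u hl hlA hu).2.trans ?_
    have h1 := hvl l hl
    have h2 : (1 + 2 * θ) * sumVar ρ l ≤ (1 + 2 * θ) * (l * V) := by gcongr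
    have h3 : (1 + 2 * θ) * (l * V) ≤ 2 * (l * V) := by gcongr; linarith
    have h4 : u ^ 2 / 2 * ((1 + 2 * θ) * sumVar ρ l) ≤ u ^ 2 / 2 * (2 * (l * V)) := by
      exact mul_le_mul_of_nonneg_left (h2.trans h3) (by positivity)
    linarith)
  have hexp2 : ∀ k ≤ J, V * Real.exp (3 * ∑ i ∈ Finset.range k, w i) ≤ 2 * V := fun k hk => by
    have h1 : Real.exp (3 * ∑ i ∈ Finset.range k, w i) ≤ 2 := by
      refine (Real.exp_le_exp.2 (show _ ≤ (1 / 2 : ℝ) by linarith [hwk k hk])).trans ?_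
      have h2 : Real.exp (1 / 2) * Real.exp (1 / 2) ≤ 2 * 2 := by
        rw [← Real.exp_add]; norm_num; linarith [Real.exp_one_lt_d9]
      nlinarith [Real.exp_pos (1 / 2)]
    nlinarith
  have hcrude : ∀ k ≤ J, ∀ (l m : ℕ) (u : ℝ), 1 ≤ l → (l : ℝ) ≤ A k → |u| ≤ U * (p / l) ^ κ →
      logLaplace μ ξ (D k ^ r) u m l ≤ u ^ 2 * l * (2 * V) + 4 ^ k * E :=
    fun k hk l m u hl hlA hu => (hcrude0 k hk l m u hl hlA hu).trans
      (add_le_add_left (mul_le_mul_of_nonneg_left (hexp2 k hk) (by positivity)) _)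
  have hdom : ∀ (l : ℕ) (u : ℝ), 0 < (l : ℝ) → (l : ℝ) ≤ p → |u| ≤ U → |u| ≤ U * (p / l) ^ κ :=
    fun l u hl hlp hu => hu.trans (le_mul_of_one_le_right hU
      (Real.one_le_rpow ((one_le_div hl).2 hlp) hκ.le))
  have hsum : 12 * V * ∑ i ∈ Finset.range J, w i ≤ ε / 2 := by
    have := mul_le_mul_of_nonneg_left (hwk J le_rfl) (show 0 ≤ 12 * V by positivity)
    linarith
  have hpos : ∀ l : ℕ, A 0 / 4 ≤ l → 1 ≤ l := fun l hl => by
    have : (0 : ℝ) < l := by linarith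
    exact_mod_cast this
  have hε0 : 0 ≤ ε := by
    have : 0 ≤ 12 * V * ∑ i ∈ Finset.range J, w i := mul_nonneg (by positivity) (hwJ0 J le_rfl)
    linarith
  have hup' := P.logLaplace_le_sharp H h0 hC (B := 2 * V) (s := s₂ + ε / 2) h6e hE0
    (by linarith) (by linarith) (by linarith) hcrude (fun l m u hl hlA hu => by
      refine (hsmall l m u (hpos l hl) hlA hu).2.trans ?_
      have h1 : (1 + 2 * θ) * sumVar ρ l ≤ l * (s₂ + ε / 2) := by
        calc (1 + 2 * θ) * sumVar ρ l
            ≤ (1 + 2 * θ) * (l * (s₂ + 4 * (V - s₂) / n ^ (4 * κ))) := by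
              gcongr; exact (hvs l hl).1
          _ = l * ((1 + 2 * θ) * (s₂ + 4 * (V - s₂) / n ^ (4 * κ))) := by ring
          _ ≤ _ := by gcongr
      have h2 := mul_le_mul_of_nonneg_left h1 (show 0 ≤ u ^ 2 / 2 by positivity)
      linarith)
  have hlow' := P.le_logLaplace_sharp H h0 hC (B := 2 * V) (s := s₂ - ε / 2) h6e hE0
    (by linarith) (by linarith) hcrude (fun l m u hl hlA hu => by
      refine le_trans ?_ (hsmall l m u (hpos l hl) hlA hu).1
      have h1 : l * (s₂ - ε / 2) ≤ (1 - 6 * θ) * sumVar ρ l := by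
        calc l * (s₂ - ε / 2)
            ≤ l * ((1 - 6 * θ) * (s₂ - 4 * (V - s₂) / n ^ (4 * κ))) := by gcongr
          _ = (1 - 6 * θ) * (l * (s₂ - 4 * (V - s₂) / n ^ (4 * κ))) := by ring
          _ ≤ _ := mul_le_mul_of_nonneg_left (hvs l hl).2 (by linarith)
      have h2 := mul_le_mul_of_nonneg_left h1 (show 0 ≤ u ^ 2 / 2 by positivity)
      linarith)
  rw [← hDJ]
  constructor
  · intro l m u hl hlp hu
    have hl0 : (0 : ℝ) < l := by exact_mod_cast hl
    have := hcrude J le_rfl l m u hl (by rwa [hAJ]) (hdom l u hl0 hlp hu)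
    linarith
  · intro l m u hl hlp hu
    have hl4 : A 0 / 4 ≤ l := by linarith [P.A_zero_le J]
    have hl0 : (0 : ℝ) < l := by linarith
    have k1 := hup' J le_rfl l m u hl4 (by rwa [hAJ]) (hdom l u hl0 hlp hu)
    have k2 := hlow' J le_rfl l m u hl4 (by rwa [hAJ]) (hdom l u hl0 hlp hu)
    have k3 : u ^ 2 / 2 * l * (6 * (2 * V) * ∑ i ∈ Finset.range J, w i) ≤ u ^ 2 / 2 * l * (ε / 2) :=
      mul_le_mul_of_nonneg_left (by linarith) (by positivity)
    rw [abs_le]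
    constructor <;> linarith

end Scales

section

/-! ### Choice of the block lengths and of the truncation level -/

/-- A power beats the exponential of a negative power. -/
lemma tendsto_rpow_mul_exp_neg_mul_rpow (k : ℝ) {a s : ℝ} (ha : 0 < a) (hs : 0 < s) :
    Tendsto (fun x : ℝ => x ^ k * Real.exp (-a * x ^ s)) atTop (𝓝 0) := by
  have h := (tendsto_rpow_mul_exp_neg_mul_atTop_nhds_zero (k / s) a ha).comp
    (tendsto_rpow_atTop hs)
  refine h.congr' ?_
  filter_upwards [eventually_gt_atTop 0] with x hx
  simp only [Function.comp]
  rw [← Real.rpow_mul hx.le, mul_div_cancel₀ _ hs.ne']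

/-- The relations between the sizes that occur in the choice of the blocks, for `n` variables and
the speed `b`. Here `x = √(n b)` is the scale of the deviations, `D = q ^ g` controls the mixing
coefficient at the gap length `q`, `D ^ r` is the truncation level and `p` is the length of the
blocks. -/
lemma regime_bounds {γ g r κ n b x ω D q p : ℝ} (hγ0 : 0 < γ) (hγ1 : γ < 1)
    (hr : 0 ≤ r) (hγ : 1 / γ = 1 / g + r) (hκ2 : κ ≤ 1 / 2) (hn : 1 ≤ n) (hb : 1 ≤ b)
    (hx : x = √(n * b)) (hω : ω = x ^ γ / b) (hω1 : 1 ≤ ω) (hD : D = b * √ω)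
    (hq : q = D ^ (1 / g)) (hp : p = q * ω ^ κ) :
    ω ≤ n ∧ n ^ (γ / 4) ≤ D ∧ p ≤ x ∧ b / x ≤ n ^ (-((1 - γ) / (2 - γ))) ∧
      b / x * p * D ^ r ≤ ω ^ (-(1 / 2) : ℝ) * D := by
  -- in terms of the logarithms `N`, `β` and `W` of `n`, `b` and `ω`, all the claims are linear
  obtain ⟨N, rfl⟩ : ∃ N, n = Real.exp N := ⟨Real.log n, (Real.exp_log (by linarith)).symm⟩
  obtain ⟨β, rfl⟩ : ∃ β, b = Real.exp β := ⟨Real.log b, (Real.exp_log (by linarith)).symm⟩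
  have hN : 0 ≤ N := by simpa using hn
  have hβ : 0 ≤ β := by simpa using hb
  have hx' : x = Real.exp ((N + β) / 2) := by
    rw [hx, ← Real.exp_add, Real.exp_half]
  have hω' : ω = Real.exp ((N + β) / 2 * γ - β) := by
    rw [hω, hx', ← Real.exp_mul, ← Real.exp_sub]
  set W := (N + β) / 2 * γ - β with hW
  have hW0 : 0 ≤ W := by rw [hω'] at hω1; simpa using hω1
  have hD' : D = Real.exp (β + W / 2) := by
    rw [hD, hω', ← Real.exp_half, ← Real.exp_add]
  have hp' : p = Real.exp ((β + W / 2) * (1 / g) + W * κ) := by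
    rw [hp, hq, hω', hD', ← Real.exp_mul, ← Real.exp_mul, ← Real.exp_add]
  have hxW : (N + β) / 2 = (W + β) * (1 / γ) := by
    rw [hW]; field_simp; ring
  have hγinv : 1 ≤ 1 / γ := by rw [le_div_iff₀ hγ0]; linarith
  rw [hp', hD', hω', hx']
  simp only [← Real.exp_mul, ← Real.exp_add, ← Real.exp_sub, Real.exp_le_exp]
  have hgr : (β + W / 2) * (1 / g) + (β + W / 2) * r = (β + W / 2) * (1 / γ) := by
    rw [hγ]; ring
  have hDr : 0 ≤ (β + W / 2) * r := by positivity
  have hWγ : W ≤ W * (1 / γ) := le_mul_of_one_le_right hW0 hγinv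
  have hWκ : W * κ ≤ W / 2 := by nlinarith
  have h2 : 0 < 2 - γ := by linarith
  refine ⟨?_, ?_, ?_, ?_, ?_⟩
  · nlinarith
  · nlinarith
  · rw [hxW]; linarith
  · have : N * -((1 - γ) / (2 - γ)) = (γ / (2 - γ) * N - N) / 2 := by field_simp; ring
    rw [this]
    have h3 : β ≤ γ / (2 - γ) * N := by
      rw [div_mul_eq_mul_div, le_div_iff₀ h2]; nlinarith
    linarith
  · rw [hxW]; linarith

/-- A small exponent, for the hierarchy of scales in the choice of the blocks. That the third condition
can be met is the assumption `γ < 1`, which amounts to `g (1 - r) < 1`. -/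
lemma exists_scale_exponent {γ g r : ℝ} (hγ0 : 0 < γ) (hγ1 : γ < 1) (hg : 0 < g)
    (hγ : 1 / γ = 1 / g + r) :
    ∃ κ, 0 < κ ∧ κ ≤ 1 / 2 ∧ (1 + κ) * g * (1 - r) ≤ 1 - κ ∧ 4 * κ ≤ γ / (4 * g) ∧
      κ + 4 * κ * (1 + g * r) < (1 - γ) / (2 - γ) := by
  have h1 : g * (1 - r) < 1 := by
    have : 1 < 1 / γ := by rw [lt_div_iff₀ hγ0]; linarith
    have h2 : g * (1 / g) = 1 := by field_simp
    nlinarith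
  have h2 : 0 < (1 - γ) / (2 - γ) := div_pos (by linarith) (by linarith)
  have t1 : Tendsto (fun κ : ℝ => (1 + κ) * g * (1 - r) - (1 - κ)) (𝓝[>] 0)
      (𝓝 ((1 + 0) * g * (1 - r) - (1 - 0))) :=
    (Continuous.tendsto (by fun_prop) 0).mono_left nhdsWithin_le_nhds
  have t2 : Tendsto (fun κ : ℝ => κ + 4 * κ * (1 + g * r)) (𝓝[>] 0)
      (𝓝 (0 + 4 * 0 * (1 + g * r))) :=
    (Continuous.tendsto (by fun_prop) 0).mono_left nhdsWithin_le_nhds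
  have t3 : Tendsto (fun κ : ℝ => 4 * κ) (𝓝[>] 0) (𝓝 (4 * 0)) :=
    (Continuous.tendsto (by fun_prop) 0).mono_left nhdsWithin_le_nhds
  have t4 : Tendsto (fun κ : ℝ => κ) (𝓝[>] 0) (𝓝 0) :=
    (Continuous.tendsto (by fun_prop) 0).mono_left nhdsWithin_le_nhds
  obtain ⟨κ, h0, h3, h4, h5, h6⟩ := ((eventually_mem_nhdsWithin (a := (0 : ℝ)) (s := Set.Ioi 0)).and
    ((t1.eventually_lt_const (u := 0) (by linarith)).and
    ((t2.eventually_lt_const (u := (1 - γ) / (2 - γ)) (by simpa using h2)).and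
    ((t3.eventually_lt_const (u := γ / (4 * g)) (by simp; positivity)).and
    (t4.eventually_lt_const (u := 1 / 2) (by norm_num)))))).exists
  exact ⟨κ, h0, h6.le, by linarith, h5.le, h4⟩

/-- The properties of the block decomposition of `ξ 0, …, ξ (n - 1)` at speed `b n` that are used
to derive the deviation bounds: the blocks of length `L n`, separated by gaps of length `d n`, of
the variables truncated at `D n ^ r`. In the range `|u| ≤ Λ √(b n / n)`, the log-Laplace transforms
of short blocks are at most quadratic, and that of a block of length `L n` is asymptotically that
of a centered Gaussian variable of variance `L n * s₂`. -/
structure BlockRegime {Ω : Type*} {mΩ : MeasurableSpace Ω} (μ : Measure Ω) (ξ : ℕ → Ω → ℝ)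
    (g r s₂ V : ℝ) (b : ℕ → ℝ) (D : ℕ → ℝ) (L d : ℕ → ℕ) : Prop where
  one_le_D : ∀ᶠ n in atTop, 1 ≤ D n
  D_le : ∀ᶠ n in atTop, D n ≤ (d n : ℝ) ^ g
  exp_le : ∀ a K : ℝ, 0 < a → ∀ᶠ n : ℕ in atTop, n * Real.exp (-a * D n) ≤ Real.exp (-K * b n)
  one_le_gap : ∀ᶠ n in atTop, 1 ≤ d n
  gap_le : ∀ ε : ℝ, 0 < ε → ∀ᶠ n in atTop, (d n : ℝ) ≤ ε * L n
  length_le : ∀ ε : ℝ, 0 < ε → ∀ᶠ n : ℕ in atTop, (L n + d n : ℝ) ≤ ε * n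
  crude : ∀ Λ ε : ℝ, 0 < ε → ∀ᶠ n : ℕ in atTop, ∀ (l m : ℕ) (u : ℝ), 1 ≤ l → l ≤ L n + d n →
    |u| ≤ Λ * (b n / √(n * b n)) →
      logLaplace μ ξ (D n ^ r) u m l ≤ u ^ 2 * l * (2 * V) + ε / n
  sharp : ∀ Λ ε : ℝ, 0 < ε → ∀ᶠ n : ℕ in atTop, ∀ (m : ℕ) (u : ℝ),
    |u| ≤ Λ * (b n / √(n * b n)) →
      |logLaplace μ ξ (D n ^ r) u m (L n) - u ^ 2 / 2 * L n * s₂| ≤ u ^ 2 / 2 * L n * ε + ε / n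

variable {Ω : Type*} {mΩ : MeasurableSpace Ω} {μ : Measure Ω} [IsProbabilityMeasure μ]
  {ℱ : ℕ → MeasurableSpace Ω} {ξ : ℕ → Ω → ℝ}

set_option maxHeartbeats 1000000 in
/-- Blocks suitable for the speed `b` exist as soon as `√(n b n) ^ γ / b n` tends to infinity. -/
lemma StretchedMixing.exists_blockRegime {c g r C γ V s₂ : ℝ} {ρ : ℕ → ℝ} {b : ℕ → ℝ}
    (H : StretchedMixing μ ℱ ξ c g r) (h0 : ∀ i, ∫ ω, ξ i ω ∂μ = 0)
    (hC : TruncationBound μ ξ r C) (hρ : ∀ i k, ∫ ω, ξ i ω * ξ (i + k) ω ∂μ = ρ k)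
    (hs₂ : 0 < s₂) (hV : s₂ < V) (hvar : ∀ l : ℕ, |sumVar ρ l - l * s₂| ≤ V - s₂)
    (hγ0 : 0 < γ) (hγ1 : γ < 1) (hγ : 1 / γ = 1 / g + r) (hb : Tendsto b atTop atTop)
    (hω : Tendsto (fun n : ℕ => √(n * b n) ^ γ / b n) atTop atTop) :
    ∃ (D : ℕ → ℝ) (L d : ℕ → ℕ), BlockRegime μ ξ g r s₂ V b D L d := by
  have hg := H.g_pos
  have hr := H.r_nonneg
  obtain ⟨κ, hκ, hκ2, hexp, hκn, hκθ⟩ := exists_scale_exponent hγ0 hγ1 hg hγ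
  set ω : ℕ → ℝ := fun n => √(n * b n) ^ γ / b n with hωd
  set D : ℕ → ℝ := fun n => b n * √(ω n) with hDd
  set q : ℕ → ℝ := fun n => D n ^ (1 / g) with hqd
  set p : ℕ → ℝ := fun n => q n * ω n ^ κ with hpd
  have hnat : Tendsto (fun n : ℕ => (n : ℝ)) atTop atTop := tendsto_natCast_atTop_atTop
  have hn1 : ∀ᶠ n : ℕ in atTop, (1 : ℝ) ≤ n := hnat.eventually_ge_atTop 1
  have hb1 : ∀ᶠ n in atTop, 1 ≤ b n := hb.eventually_ge_atTop 1
  have hω1 : ∀ᶠ n in atTop, 1 ≤ ω n := hω.eventually_ge_atTop 1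
  have hbd : ∀ᶠ n : ℕ in atTop, ω n ≤ n ∧ (n : ℝ) ^ (γ / 4) ≤ D n ∧ p n ≤ √(n * b n) ∧
      b n / √(n * b n) ≤ (n : ℝ) ^ (-((1 - γ) / (2 - γ))) ∧
      b n / √(n * b n) * p n * D n ^ r ≤ ω n ^ (-(1 / 2) : ℝ) * D n := by
    filter_upwards [hn1, hb1, hω1] with n h1 h2 h3
    exact regime_bounds hγ0 hγ1 hr hγ hκ2 h1 h2 rfl rfl h3 rfl rfl rfl
  have hD1 : ∀ᶠ n in atTop, 1 ≤ D n := by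
    filter_upwards [hbd, hn1] with n h h1
    exact (Real.one_le_rpow h1 (by positivity)).trans h.2.1
  have hq1 : ∀ᶠ n in atTop, 1 ≤ q n := by
    filter_upwards [hD1] with n h
    exact Real.one_le_rpow h (by positivity)
  have hqg : ∀ᶠ n in atTop, q n ^ g = D n := by
    filter_upwards [hD1] with n h
    simp only [hqd]
    rw [← Real.rpow_mul (by linarith), one_div_mul_cancel hg.ne', Real.rpow_one]
  have hωκ : Tendsto (fun n => ω n ^ (-κ)) atTop (𝓝 0) := (tendsto_rpow_neg_atTop hκ).comp hω
  have hqp : ∀ ε : ℝ, 0 < ε → ∀ᶠ n in atTop, q n ≤ ε * p n := by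
    intro ε hε
    filter_upwards [hωκ.eventually_le_const hε, hω1, hq1] with n h h1 h2
    have h3 : 0 < ω n := by linarith
    rw [Real.rpow_neg h3.le] at h
    have h4 : 0 < ω n ^ κ := by positivity
    have h5 : 1 ≤ ε * ω n ^ κ := by
      have := mul_le_mul_of_nonneg_right h h4.le
      rwa [inv_mul_cancel₀ h4.ne'] at this
    simp only [hpd]
    nlinarith
  have hxn : ∀ᶠ n : ℕ in atTop, √(n * b n) ≤ n * (n : ℝ) ^ (-((1 - γ) / (2 - γ))) := by
    filter_upwards [hbd, hn1, hb1] with n h h1 h2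
    have h3 : 0 < √(n * b n) := Real.sqrt_pos.2 (by positivity)
    have h4 : √(n * b n) = n * (b n / √(n * b n)) := by
      rw [← mul_div_assoc, eq_div_iff h3.ne', Real.mul_self_sqrt (by positivity)]
    rw [h4]
    exact mul_le_mul_of_nonneg_left h.2.2.2.1 (by linarith)
  have hdel : 0 < (1 - γ) / (2 - γ) := div_pos (by linarith) (by linarith)
  have hpn : ∀ ε : ℝ, 0 < ε → ∀ᶠ n : ℕ in atTop, p n ≤ ε * n := by
    intro ε hε
    filter_upwards [hbd, hxn, ((tendsto_rpow_neg_atTop hdel).comp hnat).eventually_le_const hε,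
      hn1] with n h h1 h2 h3
    refine h.2.2.1.trans (h1.trans ?_)
    rw [mul_comm]
    exact mul_le_mul_of_nonneg_right h2 (by linarith)
  have hceil : ∀ᶠ n in atTop, (⌈q n⌉₊ : ℝ) ≤ 2 * q n := by
    filter_upwards [hq1] with n h
    have := (Nat.ceil_lt_add_one (show 0 ≤ q n by linarith)).le
    linarith
  have hgapfl : ∀ᶠ n in atTop, ⌈q n⌉₊ ≤ ⌊p n⌋₊ := by
    filter_upwards [hceil, hqp (1 / 2) (by norm_num)] with n h h2
    exact Nat.le_floor (by linarith)
  have hpL : ∀ᶠ n in atTop, p n - 3 * q n ≤ ((⌊p n⌋₊ - ⌈q n⌉₊ : ℕ) : ℝ) := by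
    filter_upwards [hceil, hgapfl, hq1] with n h h2 h3
    rw [Nat.cast_sub h2]
    have := Nat.lt_floor_add_one (p n)
    linarith
  have hsum : ∀ᶠ n in atTop, ((⌊p n⌋₊ - ⌈q n⌉₊ : ℕ) : ℝ) + (⌈q n⌉₊ : ℝ) ≤ p n := by
    filter_upwards [hgapfl, hq1, hω1] with n h2 h3 h4
    rw [Nat.cast_sub h2, sub_add_cancel]
    exact Nat.floor_le (by simp only [hpd]; positivity)
  -- every smallness condition of `block_bounds` holds for large `n`, as the quantities involved are
  -- negative powers of `n` or of `ω n`, or are stretched exponentially small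
  have hmain : ∀ Λ ε : ℝ, 0 ≤ Λ → 0 < ε → ε ≤ V → ∀ᶠ n : ℕ in atTop,
      (∀ (l m : ℕ) (u : ℝ), 1 ≤ l → (l : ℝ) ≤ p n → |u| ≤ Λ * (b n / √(n * b n)) →
        logLaplace μ ξ (D n ^ r) u m l ≤ u ^ 2 * l * (2 * V) + ε / n) ∧
      (∀ (l m : ℕ) (u : ℝ), p n / 4 ≤ l → (l : ℝ) ≤ p n → |u| ≤ Λ * (b n / √(n * b n)) →
        |logLaplace μ ξ (D n ^ r) u m l - u ^ 2 / 2 * l * s₂| ≤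
          u ^ 2 / 2 * l * ε + ε / n) := by
    intro Λ ε hΛ hε hεV
    have hc' : 0 < min c 1 := lt_min H.c_pos one_pos
    have hX : Tendsto (fun n : ℕ => (n : ℝ) ^ (4 * κ)) atTop atTop :=
      (tendsto_rpow_atTop (by positivity)).comp hnat
    set δ := (1 - γ) / (2 - γ) - (κ + 4 * κ * (1 + g * r)) with hδ
    have hδ0 : 0 < δ := by linarith
    set θ : ℕ → ℝ := fun n => Λ * (2 * (2 ^ g) ^ r) * (n : ℝ) ^ (-δ) with hθd
    set W : ℕ → ℝ := fun n => (4 * ω n ^ (-κ)) ^ κ * (1 - 2 ^ (-(κ * κ)))⁻¹ with hWd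
    set E : ℕ → ℝ := fun n => 72 * n * Real.exp (-(min c 1 / 2) * (n : ℝ) ^ (2 * κ * g)) +
      4 * C ^ 2 * Real.exp (-(n : ℝ) ^ (2 * κ * g) / 4) with hEd
    have h4ω : Tendsto (fun n => 4 * ω n ^ (-κ)) atTop (𝓝 0) := by
      simpa using hωκ.const_mul 4
    have h4ωκ : Tendsto (fun n => (4 * ω n ^ (-κ)) ^ κ) atTop (𝓝 0) := by
      have := h4ω.rpow_const (p := κ) (Or.inr hκ.le)
      rwa [Real.zero_rpow hκ.ne'] at this
    have hWt : Tendsto W atTop (𝓝 0) := by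
      simpa using h4ωκ.mul_const (1 - 2 ^ (-(κ * κ)) : ℝ)⁻¹
    have hθt : Tendsto θ atTop (𝓝 0) := by
      simpa using ((tendsto_rpow_neg_atTop hδ0).comp hnat).const_mul (Λ * (2 * (2 ^ g) ^ r))
    have hνt : Tendsto (fun n => Λ * ω n ^ (-(1 / 2) : ℝ) * 2 ^ ((1 + κ) * g)) atTop (𝓝 0) := by
      simpa using (((tendsto_rpow_neg_atTop (show (0 : ℝ) < 1 / 2 by norm_num)).comp
        hω).const_mul Λ).mul_const ((2 : ℝ) ^ ((1 + κ) * g))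
    have hmt : Tendsto (fun n : ℕ => 2 * C * Real.exp (-(n : ℝ) ^ (2 * κ * g) / 8)) atTop
        (𝓝 0) := by
      have := ((tendsto_rpow_mul_exp_neg_mul_rpow 0 (show (0 : ℝ) < 1 / 8 by norm_num)
        (show 0 < 2 * κ * g by positivity)).comp hnat).const_mul (2 * C)
      rw [mul_zero] at this
      refine this.congr fun n => ?_
      simp only [Function.comp, Real.rpow_zero, one_mul]
      congr 2; ring
    have hEt : Tendsto (fun n : ℕ => (n : ℝ) ^ 3 * E n) atTop (𝓝 0) := by
      have h1 := ((tendsto_rpow_mul_exp_neg_mul_rpow 4 (half_pos hc')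
        (show 0 < 2 * κ * g by positivity)).comp hnat).const_mul 72
      have h2 := ((tendsto_rpow_mul_exp_neg_mul_rpow 3 (show (0 : ℝ) < 1 / 4 by norm_num)
        (show 0 < 2 * κ * g by positivity)).comp hnat).const_mul (4 * C ^ 2)
      have h3 := h1.add h2
      rw [mul_zero, mul_zero, add_zero] at h3
      refine h3.congr fun n => ?_
      have e1 : (n : ℝ) ^ (4 : ℝ) = (n : ℝ) ^ 4 := by exact_mod_cast Real.rpow_natCast (n : ℝ) 4
      have e2 : (n : ℝ) ^ (3 : ℝ) = (n : ℝ) ^ 3 := by exact_mod_cast Real.rpow_natCast (n : ℝ) 3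
      have e3 : -(1 / 4) * (n : ℝ) ^ (2 * κ * g) = -(n : ℝ) ^ (2 * κ * g) / 4 := by ring
      simp only [Function.comp, hEd, e1, e2, e3]
      ring
    have hinv : Tendsto (fun n : ℕ => 4 * (V - s₂) / (n : ℝ) ^ (4 * κ)) atTop (𝓝 0) :=
      hX.const_div_atTop _
    have hupt : Tendsto (fun n : ℕ => (1 + 2 * θ n) * (s₂ + 4 * (V - s₂) / (n : ℝ) ^ (4 * κ)))
        atTop (𝓝 s₂) := by
      simpa using ((hθt.const_mul 2).const_add 1).mul (hinv.const_add s₂)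
    have hlowt : Tendsto (fun n : ℕ => (1 - 6 * θ n) * (s₂ - 4 * (V - s₂) / (n : ℝ) ^ (4 * κ)))
        atTop (𝓝 s₂) := by
      simpa using ((hθt.const_mul 6).const_sub 1).mul (hinv.const_sub s₂)
    have h2κ : (0 : ℝ) < 1 - 2 ^ (-κ) :=
      sub_pos.2 (Real.rpow_lt_one_of_one_lt_of_neg one_lt_two (by linarith))
    filter_upwards [hn1, hb1, hω1, hbd, hD1, hq1, hqg, hpn 1 one_pos,
      hX.eventually_ge_atTop 8, h4ω.eventually_le_const (show (0 : ℝ) < 1 / 4 by norm_num),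
      h4ωκ.eventually_le_const (show (0 : ℝ) < 1 / 4 by norm_num),
      h4ωκ.eventually_le_const h2κ, hmt.eventually_le_const (show (0 : ℝ) < 1 / 2 by norm_num),
      hθt.eventually_le_const (show (0 : ℝ) < 1 / 6 by norm_num),
      hWt.eventually_le_const (show (0 : ℝ) < 1 / 6 by norm_num),
      (hWt.const_mul (24 * V)).eventually_le_const (show 24 * V * 0 < ε by simpa using hε),
      hupt.eventually_le_const (show s₂ < s₂ + ε / 2 by linarith),
      hlowt.eventually_const_le (show s₂ - ε / 2 < s₂ by linarith),
      hνt.eventually_le_const (show 0 < min c 1 / 8 by positivity),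
      hEt.eventually_le_const hε] with n a1 a2 a3 a4 a5 a6 a7 a8 a9 a10 a11 a12 a13 a14 a15 a16 a17
        a18 a19 a20
    have hn0 : (0 : ℝ) < n := by linarith
    have hEn : (n : ℝ) ^ 2 * E n ≤ ε / n := by
      rw [le_div_iff₀ hn0]
      calc (n : ℝ) ^ 2 * E n * n = n ^ 3 * E n := by ring
        _ ≤ ε := a20
    have hU0 : 0 ≤ Λ * (b n / √(n * b n)) := by positivity
    -- here `U = Λ b / x` is the size of the parameters, and `ν` is of order `ω ^ (-1 / 2)`
    have hUν : Λ * (b n / √(n * b n)) * p n * (q n ^ g) ^ r ≤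
        Λ * ω n ^ (-(1 / 2) : ℝ) * q n ^ g := by
      rw [a7]
      calc Λ * (b n / √(n * b n)) * p n * D n ^ r
          = Λ * (b n / √(n * b n) * p n * D n ^ r) := by ring
        _ ≤ Λ * (ω n ^ (-(1 / 2) : ℝ) * D n) := mul_le_mul_of_nonneg_left a4.2.2.2.2 hΛ
        _ = _ := by ring
    have hnp : (n : ℝ) ^ (4 * κ) ≤ p n := by
      have h1 : (n : ℝ) ^ (4 * κ) ≤ (n : ℝ) ^ (γ / 4 * (1 / g)) :=
        Real.rpow_le_rpow_of_exponent_le a1 (hκn.trans (le_of_eq (by field_simp)))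
      have h2 : (n : ℝ) ^ (γ / 4 * (1 / g)) ≤ q n := by
        rw [Real.rpow_mul hn0.le]
        exact Real.rpow_le_rpow (by positivity) a4.2.1 (by positivity)
      have h3 : q n ≤ p n :=
        le_mul_of_one_le_right (by linarith) (Real.one_le_rpow a3 hκ.le)
      exact h1.trans (h2.trans h3)
    have hθn : Λ * (b n / √(n * b n)) * (n : ℝ) ^ κ * (2 * (n : ℝ) ^ (4 * κ)) *
        ((2 * (n : ℝ) ^ (4 * κ)) ^ g) ^ r ≤ θ n := by
      have e1 : ((2 * (n : ℝ) ^ (4 * κ)) ^ g) ^ r =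
          (2 ^ g) ^ r * (n : ℝ) ^ (4 * κ * g * r) := by
        rw [Real.mul_rpow two_pos.le (by positivity), Real.mul_rpow (by positivity)
          (by positivity), ← Real.rpow_mul hn0.le, ← Real.rpow_mul hn0.le]
      have e2 : (n : ℝ) ^ (-δ) = (n : ℝ) ^ (-((1 - γ) / (2 - γ))) * (n : ℝ) ^ κ *
          (n : ℝ) ^ (4 * κ) * (n : ℝ) ^ (4 * κ * g * r) := by
        rw [← Real.rpow_add hn0, ← Real.rpow_add hn0, ← Real.rpow_add hn0]
        congr 1
        rw [hδ]; ring
      simp only [hθd]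
      rw [e1, e2]
      calc Λ * (b n / √(n * b n)) * (n : ℝ) ^ κ * (2 * (n : ℝ) ^ (4 * κ)) *
            ((2 ^ g) ^ r * (n : ℝ) ^ (4 * κ * g * r))
          = (b n / √(n * b n)) * (Λ * (2 * (2 ^ g) ^ r) * ((n : ℝ) ^ κ * (n : ℝ) ^ (4 * κ) *
            (n : ℝ) ^ (4 * κ * g * r))) := by ring
        _ ≤ (n : ℝ) ^ (-((1 - γ) / (2 - γ))) * (Λ * (2 * (2 ^ g) ^ r) * ((n : ℝ) ^ κ *
            (n : ℝ) ^ (4 * κ) * (n : ℝ) ^ (4 * κ * g * r))) :=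
          mul_le_mul_of_nonneg_right a4.2.2.2.1 (by positivity)
        _ = _ := by ring
    have key := H.block_bounds (C := C) (κ := κ) (U := Λ * (b n / √(n * b n))) (p := p n)
      (q := q n) (ω := ω n) (n := n) (ν := Λ * ω n ^ (-(1 / 2) : ℝ)) (E := E n) (θ := θ n)
      (ε := ε) (V := V) (s₂ := s₂) (W := W n) h0 hC hρ hs₂ hV hvar hκ hκ2 hexp hU0
      (by linarith) a3 rfl a1 hUν a19 hnp (by linarith) a4.1 a9 a10 a11 a12 a13
      (le_add_of_nonneg_right (by positivity)) (le_add_of_nonneg_left (by positivity)) hθn a14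
      le_rfl a15 a16 hεV a17 a18
    rw [a7] at key
    exact ⟨fun l m u h1 h2 h3 => (key.1 l m u h1 h2 h3).trans (by linarith),
      fun l m u h1 h2 h3 => (key.2 l m u h1 h2 h3).trans (by linarith)⟩
  have hV0 : 0 < V := by linarith
  -- a block together with the gap that follows it has length `⌊p n⌋`
  refine ⟨D, fun n => ⌊p n⌋₊ - ⌈q n⌉₊, fun n => ⌈q n⌉₊, hD1, ?_, ?_, ?_, ?_, ?_, ?_, ?_⟩
  · filter_upwards [hqg, hq1] with n h h1
    rw [← h]
    exact Real.rpow_le_rpow (by linarith) (Nat.le_ceil _) hg.le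
  · intro a K ha
    have hKω : ∀ᶠ n in atTop, K ≤ a / 2 * √(ω n) :=
      ((Real.tendsto_sqrt_atTop.comp hω).const_mul_atTop (half_pos ha)).eventually_ge_atTop K
    have h1 := ((tendsto_rpow_mul_exp_neg_mul_rpow 1 (half_pos ha)
      (show 0 < γ / 4 by positivity)).comp hnat).eventually_le_const one_pos
    filter_upwards [hKω, h1, hb1, hbd] with n h2 h3 h4 h5
    simp only [Function.comp, Real.rpow_one] at h3
    have h6 : K * b n ≤ a / 2 * D n := by
      have := mul_le_mul_of_nonneg_right h2 (show 0 ≤ b n by linarith)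
      simp only [hDd]; linarith
    calc n * Real.exp (-a * D n)
        = n * Real.exp (-(a / 2) * D n) * Real.exp (-(a / 2) * D n) := by
          rw [mul_assoc, ← Real.exp_add]; ring_nf
      _ ≤ n * Real.exp (-(a / 2) * (n : ℝ) ^ (γ / 4)) * Real.exp (-K * b n) := by
          refine mul_le_mul (mul_le_mul_of_nonneg_left (Real.exp_le_exp.2 ?_) (by positivity))
            (Real.exp_le_exp.2 ?_) (Real.exp_pos _).le (by positivity)
          · nlinarith [h5.2.1]
          · linarith
      _ ≤ 1 * Real.exp (-K * b n) := by gcongr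
      _ = _ := one_mul _
  · filter_upwards [hq1] with n h
    exact Nat.one_le_ceil_iff.2 (by linarith)
  · intro ε hε
    filter_upwards [hceil, hpL, hqp (min (1 / 6) (ε / 4)) (by positivity), hq1, hω1]
      with n h1 h2 h3 h4 h5
    have hp0 : 0 ≤ p n := by simp only [hpd]; positivity
    have h6 : q n ≤ 1 / 6 * p n := h3.trans (by gcongr; exact min_le_left _ _)
    have h7 : q n ≤ ε / 4 * p n := h3.trans (by gcongr; exact min_le_right _ _)
    have h8 : ε * (p n / 2) ≤ ε * ((⌊p n⌋₊ - ⌈q n⌉₊ : ℕ) : ℝ) := by gcongr; linarith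
    linarith
  · intro ε hε
    filter_upwards [hsum, hpn ε hε] with n h1 h2
    exact h1.trans h2
  · intro Λ ε hε
    filter_upwards [hmain (max Λ 0) (min ε V) (le_max_right _ _) (lt_min hε hV0) (min_le_right _ _),
      hsum, hb1] with n h1 h2 h3 l m u hl hl2 hu
    have hl3 : (l : ℝ) ≤ p n := le_trans (by exact_mod_cast hl2) h2
    refine (h1.1 l m u hl hl3 (hu.trans ?_)).trans ?_
    · gcongr; exact le_max_left _ _
    · gcongr; exact min_le_left _ _
  · intro Λ ε hε
    filter_upwards [hmain (max Λ 0) (min ε V) (le_max_right _ _) (lt_min hε hV0) (min_le_right _ _),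
      hsum, hb1, hpL, hqp (1 / 6) (by norm_num), hq1, hω1] with n h1 h2 h3 h4 h5 h6 h7 m u hu
    have hp0 : 0 ≤ p n := by simp only [hpd]; positivity
    refine (h1.2 _ m u (le_trans (by linarith) h4) (le_trans (by simp) h2) (hu.trans ?_)).trans ?_
    · gcongr; exact le_max_left _ _
    · gcongr <;> exact min_le_left _ _

end

section

/-! ### Comparison with independent blocks -/

/-- The sum of `k` blocks of `L` truncated variables, the `i`-th of which starts at the index
`m + i * P`. -/
noncomputable def blockSum {Ω : Type*} (ξ : ℕ → Ω → ℝ) (M : ℝ) (m P L k : ℕ) (ω : Ω) : ℝ :=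
  ∑ i ∈ Finset.range k, truncSum ξ M (m + i * P) L ω

/-- The law that `blockSum ξ M m P L k` would have if its blocks were independent: the convolution
of the laws of the blocks. -/
noncomputable def indepBlocks {Ω : Type*} {mΩ : MeasurableSpace Ω} (μ : Measure Ω)
    (ξ : ℕ → Ω → ℝ) (M : ℝ) (m P L : ℕ) : ℕ → Measure ℝ
  | 0 => Measure.dirac 0
  | k + 1 => (indepBlocks μ ξ M m P L k).conv (μ.map (truncSum ξ M (m + k * P) L))

variable {Ω : Type*} {mΩ : MeasurableSpace Ω} {μ : Measure Ω} [IsProbabilityMeasure μ]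
  {ℱ : ℕ → MeasurableSpace Ω} {ξ : ℕ → Ω → ℝ} {c g r : ℝ}

lemma StretchedMixing.isProbabilityMeasure_indepBlocks (H : StretchedMixing μ ℱ ξ c g r) (M : ℝ)
    (m P L k : ℕ) : IsProbabilityMeasure (indepBlocks μ ξ M m P L k) := by
  induction k with
  | zero => exact Measure.dirac.isProbabilityMeasure
  | succ k ih =>
    have := Measure.isProbabilityMeasure_map (μ := μ)
      (H.measurable_truncSum M (m + k * P) L).aemeasurable
    unfold indepBlocks
    infer_instance

lemma StretchedMixing.measurable_blockSum (H : StretchedMixing μ ℱ ξ c g r) (M : ℝ)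
    (m P L k : ℕ) : Measurable (blockSum ξ M m P L k) :=
  Finset.measurable_sum _ fun _ _ => H.measurable_truncSum _ _ _

/-- For independent blocks the log-Laplace transforms add up. -/
lemma StretchedMixing.integral_exp_indepBlocks (H : StretchedMixing μ ℱ ξ c g r) {M : ℝ}
    (hM : 0 ≤ M) (m P L : ℕ) (u : ℝ) (k : ℕ) :
    Integrable (fun z => Real.exp (u * z)) (indepBlocks μ ξ M m P L k) ∧
      ∫ z, Real.exp (u * z) ∂(indepBlocks μ ξ M m P L k) =
        Real.exp (∑ i ∈ Finset.range k, logLaplace μ ξ M u (m + i * P) L) := by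
  induction k with
  | zero =>
    simp only [indepBlocks, Finset.range_zero, Finset.sum_empty, Real.exp_zero, integral_dirac,
      mul_zero, and_true]
    exact integrable_dirac (by simp)
  | succ k ih =>
    have := H.isProbabilityMeasure_indepBlocks M m P L k
    have hY := H.measurable_truncSum M (m + k * P) L
    have := Measure.isProbabilityMeasure_map (μ := μ) hY.aemeasurable
    have hexp : Measurable fun z : ℝ => Real.exp (u * z) := by fun_prop
    have hiY : Integrable (fun ω => Real.exp (u * truncSum ξ M (m + k * P) L ω)) μ :=
      integrable_exp_of_abs_le (hY.const_mul u) (abs_mul_truncSum_le hM u _ _)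
    have hint : Integrable (fun z => Real.exp (u * z)) (indepBlocks μ ξ M m P L (k + 1)) := by
      unfold indepBlocks
      rw [integrable_conv_iff hexp.aestronglyMeasurable]
      constructor
      · refine ae_of_all _ fun z => ?_
        rw [integrable_map_measure (by fun_prop) hY.aemeasurable]
        refine (hiY.const_mul (Real.exp (u * z))).congr (ae_of_all _ fun ω => ?_)
        simp only [Function.comp, mul_add, Real.exp_add]
      · refine (ih.1.mul_const (∫ y, Real.exp (u * y) ∂(μ.map (truncSum ξ M (m + k * P) L)))).congr
          (ae_of_all _ fun z => ?_)
        simp only [Real.norm_eq_abs, mul_add, Real.exp_add, abs_mul, Real.abs_exp,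
          integral_const_mul]
    refine ⟨hint, ?_⟩
    have hpos : 0 < ∫ ω, Real.exp (u * truncSum ξ M (m + k * P) L ω) ∂μ := integral_exp_pos hiY
    unfold indepBlocks at hint ⊢
    rw [integral_conv hint]
    simp only [mul_add, Real.exp_add, integral_const_mul, integral_mul_const]
    rw [ih.2, integral_map hY.aemeasurable (by fun_prop), Finset.sum_range_succ, Real.exp_add,
      logLaplace, expMoment, Real.exp_log hpos]

/-- Replacing the blocks by independent copies, one at a time from the last one on, changes the
expectation of a bounded Lipschitz function of their sum by at most one mixing coefficient per
variable. -/
lemma StretchedMixing.abs_integral_blockSum_sub_le (H : StretchedMixing μ ℱ ξ c g r) (M : ℝ)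
    {m P L d : ℕ} (hd : 1 ≤ d) (hP : L + d ≤ P) {B : ℝ} {K : ℝ≥0} (k : ℕ) {h : ℝ → ℝ}
    (hB : ∀ z, |h z| ≤ B) (hK : LipschitzWith K h) :
    |∫ ω, h (blockSum ξ M m P L k ω) ∂μ - ∫ z, h z ∂(indepBlocks μ ξ M m P L k)| ≤
      k * (K * L * Real.exp (-c * (d : ℝ) ^ g)) := by
  induction k generalizing h with
  | zero => simp [indepBlocks, blockSum]
  | succ k ih =>
    have := H.isProbabilityMeasure_indepBlocks M m P L k
    have hY := H.measurable_truncSum M (m + k * P) L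
    have := Measure.isProbabilityMeasure_map (μ := μ) hY.aemeasurable
    have hm : Measurable h := hK.continuous.measurable
    set h' : ℝ → ℝ := fun w => ∫ ω, h (w + truncSum ξ M (m + k * P) L ω) ∂μ with hh'
    have hi : ∀ w, Integrable (fun ω => h (w + truncSum ξ M (m + k * P) L ω)) μ := fun w =>
      Integrable.of_bound (hm.comp (hY.const_add w)).aestronglyMeasurable B
        (ae_of_all _ fun ω => hB _)
    have hB' : ∀ w, |h' w| ≤ B := fun w => by
      have := norm_integral_le_of_norm_le_const (μ := μ) (C := B)
        (f := fun ω => h (w + truncSum ξ M (m + k * P) L ω)) (ae_of_all _ fun ω => hB (w + truncSum ξ M (m + k * P) L ω))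
      simpa using this
    have hK' : LipschitzWith K h' := LipschitzWith.of_dist_le_mul fun x y => by
      rw [Real.dist_eq, Real.dist_eq]
      simp only [hh']
      rw [← integral_sub (hi x) (hi y)]
      have := norm_integral_le_of_norm_le_const (μ := μ) (C := K * |x - y|)
        (f := fun ω => h (x + truncSum ξ M (m + k * P) L ω) - h (y + truncSum ξ M (m + k * P) L ω))
        (ae_of_all _ fun ω => by
          have := hK.dist_le_mul (x + truncSum ξ M (m + k * P) L ω)
            (y + truncSum ξ M (m + k * P) L ω)
          rwa [Real.dist_eq, Real.dist_eq, add_sub_add_right_eq_sub] at this)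
      simpa using this
    -- block `k` starts at `m + k P`, and the earlier blocks end at least `d` indices before it
    have hW : Measurable[ℱ (m + k * P - d)] (blockSum ξ M m P L k) :=
      Finset.measurable_sum _ fun i hi => H.measurable_past_truncSum M (by
        have h1 := Finset.mem_range.1 hi
        have h2 : (i + 1) * P ≤ k * P := Nat.mul_le_mul_right _ h1
        rw [add_mul] at h2
        omega)
    have hdec : |∫ ω, h (blockSum ξ M m P L (k + 1) ω) ∂μ - ∫ ω, h' (blockSum ξ M m P L k ω) ∂μ| ≤
        K * L * Real.exp (-c * (d : ℝ) ^ g) := by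
      -- for `k = 0` there is nothing to decouple, and `m + k P - d` may be a truncated subtraction
      rcases Nat.eq_zero_or_pos k with rfl | hk
      · have : (0 : ℝ) ≤ K * L * Real.exp (-c * (d : ℝ) ^ g) := by positivity
        simpa [blockSum, hh'] using this
      · have hkP : d ≤ k * P := by nlinarith
        have := H.decouple (m + k * P - d) d (m + k * P) L M (blockSum ξ M m P L k)
          (fun w y => h (w + y)) B K hd (by omega) hW (hm.comp measurable_add)
          (fun _ _ => hB _) (fun w => LipschitzWith.of_dist_le_mul fun x y => by
            simpa using hK.dist_le_mul (w + x) (w + y))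
        simpa only [blockSum, Finset.sum_range_succ, truncSum, hh'] using this
    have hconv : ∫ z, h z ∂(indepBlocks μ ξ M m P L (k + 1)) =
        ∫ z, h' z ∂(indepBlocks μ ξ M m P L k) := by
      have hint : Integrable h (indepBlocks μ ξ M m P L (k + 1)) := by
        have := H.isProbabilityMeasure_indepBlocks M m P L (k + 1)
        exact Integrable.of_bound hm.aestronglyMeasurable B (ae_of_all _ hB)
      have hsucc : indepBlocks μ ξ M m P L (k + 1) =
        (indepBlocks μ ξ M m P L k).conv (μ.map (truncSum ξ M (m + k * P) L)) := rfl
      rw [hsucc] at hint ⊢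
      rw [integral_conv hint]
      refine integral_congr_ae (ae_of_all _ fun z => ?_)
      exact integral_map hY.aemeasurable
        (hm.comp (measurable_const_add z)).aestronglyMeasurable
    rw [hconv]
    have := (abs_sub_le _ _ _).trans (add_le_add hdec (ih hB' hK'))
    refine this.trans (le_of_eq ?_)
    push_cast; ring

/-- The thickened indicator function lies between the indicators of a set and of its thickening. -/
lemma measureReal_le_integral_thickenedIndicator {Ω' : Type*} {mΩ' : MeasurableSpace Ω'}
    (ν : Measure Ω') [IsFiniteMeasure ν] {f : Ω' → ℝ} (hf : Measurable f) {δ : ℝ} (hδ : 0 < δ)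
    {A : Set ℝ} (hA : MeasurableSet A) :
    ν.real {ω | f ω ∈ A} ≤ ∫ ω, (thickenedIndicator hδ A (f ω) : ℝ) ∂ν ∧
      ∫ ω, (thickenedIndicator hδ A (f ω) : ℝ) ∂ν ≤
        ν.real {ω | f ω ∈ Metric.thickening δ A} := by
  have h1 : ∀ z, (thickenedIndicator hδ A z : ℝ) ≤ 1 := fun z => by
    have := thickenedIndicator_le_one hδ A z
    exact_mod_cast this
  have hc : Continuous fun z => (thickenedIndicator hδ A z : ℝ) :=
    NNReal.continuous_coe.comp (thickenedIndicator hδ A).continuous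
  have hi : Integrable (fun ω => (thickenedIndicator hδ A (f ω) : ℝ)) ν := Integrable.of_bound
    (hc.measurable.comp hf).aestronglyMeasurable 1 (ae_of_all _ fun _ => by
      rw [Real.norm_of_nonneg (NNReal.coe_nonneg _)]; exact h1 _)
  have hmt : MeasurableSet {ω | f ω ∈ Metric.thickening δ A} :=
    hf Metric.isOpen_thickening.measurableSet
  constructor
  · change ν.real (f ⁻¹' A) ≤ _
    rw [← integral_indicator_one (hf hA)]
    refine integral_mono ((integrable_const (1 : ℝ)).indicator (hf hA)) hi fun ω => ?_
    by_cases hω : f ω ∈ A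
    · rw [Set.indicator_of_mem (by exact hω), thickenedIndicator_one hδ A hω]; simp
    · rw [Set.indicator_of_notMem (by exact hω)]; exact NNReal.coe_nonneg _
  · rw [← integral_indicator_one hmt]
    refine integral_mono hi ((integrable_const (1 : ℝ)).indicator hmt) fun ω => ?_
    by_cases hω : f ω ∈ Metric.thickening δ A
    · rw [Set.indicator_of_mem (by exact hω)]; exact h1 _
    · rw [Set.indicator_of_notMem (by exact hω), thickenedIndicator_zero hδ A hω]; simp

/-- The laws of the sum of the blocks and of its independent version are close on the sets up to
thickenings. -/
lemma StretchedMixing.measureReal_blockSum_le (H : StretchedMixing μ ℱ ξ c g r) (M : ℝ)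
    {m P L d : ℕ} (hd : 1 ≤ d) (hP : L + d ≤ P) (k : ℕ) {δ : ℝ} (hδ : 0 < δ) {A : Set ℝ}
    (hA : MeasurableSet A) :
    μ.real {ω | blockSum ξ M m P L k ω ∈ A} ≤
        (indepBlocks μ ξ M m P L k).real (Metric.thickening δ A) +
          k * L * (δ⁻¹ * Real.exp (-c * (d : ℝ) ^ g)) ∧
      (indepBlocks μ ξ M m P L k).real A ≤
        μ.real {ω | blockSum ξ M m P L k ω ∈ Metric.thickening δ A} +
          k * L * (δ⁻¹ * Real.exp (-c * (d : ℝ) ^ g)) := by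
  have := H.isProbabilityMeasure_indepBlocks M m P L k
  have hT := H.measurable_blockSum M m P L k
  set h : ℝ → ℝ := fun z => (thickenedIndicator hδ A z : ℝ) with hh
  have hB : ∀ z, |h z| ≤ 1 := fun z => by
    have h1 := thickenedIndicator_le_one hδ A z
    rw [abs_of_nonneg (NNReal.coe_nonneg _)]
    exact_mod_cast h1
  have hK : LipschitzWith δ.toNNReal⁻¹ h := fun x y => lipschitzWith_thickenedIndicator hδ A x y
  have hcmp := abs_le.1 (H.abs_integral_blockSum_sub_le M hd hP (m := m) k hB hK)
  have hKδ : ((δ.toNNReal⁻¹ : ℝ≥0) : ℝ) = δ⁻¹ := by simp [hδ.le]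
  rw [hKδ] at hcmp
  have e1 : (k : ℝ) * (δ⁻¹ * L * Real.exp (-c * (d : ℝ) ^ g)) =
      k * L * (δ⁻¹ * Real.exp (-c * (d : ℝ) ^ g)) := by ring
  rw [e1] at hcmp
  obtain ⟨a1, a2⟩ := measureReal_le_integral_thickenedIndicator μ hT hδ hA
  obtain ⟨a3, a4⟩ := measureReal_le_integral_thickenedIndicator
    (indepBlocks μ ξ M m P L k) measurable_id hδ hA
  simp only [id, Set.ofPred_mem_eq] at a3 a4
  constructor <;> linarith [hcmp.1, hcmp.2]

/-- Chernoff's bound for a sum of blocks, in both directions (`s = 1` and `s = -1`). -/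
lemma StretchedMixing.measureReal_le_mul_blockSum_le (H : StretchedMixing μ ℱ ξ c g r) {M : ℝ}
    (hM : 0 ≤ M) {m P L d : ℕ} (hd : 1 ≤ d) (hP : L + d ≤ P) (k : ℕ) {δ s u y : ℝ} (hδ : 0 < δ)
    (hs : |s| = 1) (hu : 0 ≤ u) :
    μ.real {ω | y ≤ s * blockSum ξ M m P L k ω} ≤
      Real.exp (∑ i ∈ Finset.range k, logLaplace μ ξ M (u * s) (m + i * P) L - u * (y - δ)) +
        k * L * (δ⁻¹ * Real.exp (-c * (d : ℝ) ^ g)) := by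
  have := H.isProbabilityMeasure_indepBlocks M m P L k
  have hA : MeasurableSet {z : ℝ | y ≤ s * z} := measurableSet_le (by fun_prop) (by fun_prop)
  refine (H.measureReal_blockSum_le M (m := m) hd hP k hδ hA).1.trans ?_
  gcongr
  obtain ⟨hi, he⟩ := H.integral_exp_indepBlocks hM m P L (u * s) k
  have hsub : Metric.thickening δ {z : ℝ | y ≤ s * z} ⊆ {z | y - δ ≤ s * z} := by
    intro z hz
    obtain ⟨w, hw, hzw⟩ := Metric.mem_thickening_iff.1 hz
    have h1 : |s * z - s * w| < δ := by rwa [← mul_sub, abs_mul, hs, one_mul, ← Real.dist_eq]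
    have h2 : y ≤ s * w := hw
    show y - δ ≤ s * z
    linarith [(abs_lt.1 h1).1]
  have hch := measure_ge_le_exp_mul_mgf (μ := indepBlocks μ ξ M m P L k) (X := fun z => s * z)
    (y - δ) hu (by simpa only [mul_assoc] using hi)
  refine (measureReal_mono hsub).trans (hch.trans (le_of_eq ?_))
  have he' : mgf (fun z => s * z) (indepBlocks μ ξ M m P L k) u =
      Real.exp (∑ i ∈ Finset.range k, logLaplace μ ξ M (u * s) (m + i * P) L) := by
    rw [← he, mgf]; simp only [mul_assoc]
  rw [he', ← Real.exp_add]
  congr 1; ring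

end

section

/-! ### Exponential bounds at a given speed -/

/-- The sequence `f` is at most `exp(-(κ + o(1)) b n)`. -/
def ExpLe (b f : ℕ → ℝ) (κ : ℝ) : Prop :=
  ∀ ε : ℝ, 0 < ε → ∀ᶠ n in atTop, f n ≤ Real.exp (-(κ - ε) * b n)

lemma ExpLe.add {b f h : ℕ → ℝ} {κ : ℝ} (hb : Tendsto b atTop atTop) (hf : ExpLe b f κ)
    (hh : ExpLe b h κ) : ExpLe b (fun n => f n + h n) κ := by
  intro ε hε
  filter_upwards [hf (ε / 2) (by positivity), hh (ε / 2) (by positivity),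
    hb.eventually_ge_atTop (2 / ε)] with n h1 h2 h3
  have h4 : 1 ≤ ε / 2 * b n := by
    have := mul_le_mul_of_nonneg_left h3 (show 0 ≤ ε / 2 by positivity)
    have e : ε / 2 * (2 / ε) = 1 := by field_simp
    linarith
  have h5 : 2 ≤ Real.exp (ε / 2 * b n) := by linarith [Real.add_one_le_exp (ε / 2 * b n)]
  calc f n + h n ≤ 2 * Real.exp (-(κ - ε / 2) * b n) := by linarith
    _ ≤ Real.exp (ε / 2 * b n) * Real.exp (-(κ - ε / 2) * b n) := by gcongr
    _ = Real.exp (-(κ - ε) * b n) := by rw [← Real.exp_add]; congr 1; ring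

lemma ExpLe.mono {b f h : ℕ → ℝ} {κ : ℝ} (hf : ExpLe b f κ) (hh : ∀ᶠ n in atTop, h n ≤ f n) :
    ExpLe b h κ := fun ε hε => by
  filter_upwards [hf ε hε, hh] with n h1 h2 using h2.trans h1

lemma ExpLe.anti {b f : ℕ → ℝ} {κ κ' : ℝ} (hb : Tendsto b atTop atTop) (hf : ExpLe b f κ)
    (hκ : κ' ≤ κ) : ExpLe b f κ' := fun ε hε => by
  filter_upwards [hf ε hε, hb.eventually_ge_atTop 0] with n h1 h2
  refine h1.trans (Real.exp_le_exp.2 ?_)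
  nlinarith

/-- Lower bound for the probability of a ball by exponential tilting: when the log-Laplace
transform of `ν` at `v t` is close to `b v² s / 2`, the mass of `ν` tilted by `exp((y / s) t z)`
concentrates around `y b / t`. -/
lemma half_exp_le_measureReal_ball {ν : Measure ℝ} [IsProbabilityMeasure ν] {Λ : ℝ → ℝ}
    {b s t x y δ ε : ℝ} (hint : ∀ u, Integrable (fun z => Real.exp (u * z)) ν)
    (hΛ : ∀ u, ∫ z, Real.exp (u * z) ∂ν = Real.exp (Λ u)) (hs : 0 < s) (ht : 0 ≤ t)
    (hδ : 0 < δ) (htx : t * x = b)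
    (h : ∀ v ∈ ({y / s, y / s + δ / s, y / s - δ / s} : Set ℝ),
      |Λ (v * t) - v ^ 2 * s / 2 * b| ≤ ε * b)
    (hsmall : Real.exp (-(δ ^ 2 / (2 * s) - 2 * ε) * b) ≤ 1 / 4) :
    1 / 2 * Real.exp (-(y ^ 2 / (2 * s) + |y| * δ / s + ε) * b) ≤
      ν.real {z | |z - y * x| < δ * x} := by
  set B : Set ℝ := {z | |z - y * x| < δ * x} with hB
  have hBm : MeasurableSet B := measurableSet_lt (by fun_prop) (by fun_prop)
  set lam := y / s with hlam
  set η := δ / s with hη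
  have hη0 : 0 < η := div_pos hδ hs
  have hy : y = lam * s := by rw [hlam]; field_simp
  have hδη : δ = η * s := by rw [hη]; field_simp
  have h1 := abs_le.1 (h lam (by simp))
  have h2 := abs_le.1 (h (lam + η) (by simp))
  have h3 := abs_le.1 (h (lam - η) (by simp))
  set c₁ := Real.exp ((lam * y + |lam| * δ) * b) with hc₁
  set c₂ := Real.exp (-(η * (y + δ) * b)) with hc₂
  set c₃ := Real.exp (η * (y - δ) * b) with hc₃
  -- outside the ball, the tilted density is dominated by one of the densities with parameters `lam ± η`
  have hpt : ∀ z, Real.exp (lam * t * z) ≤ B.indicator (fun _ => c₁) z +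
      (c₂ * Real.exp ((lam + η) * t * z) + c₃ * Real.exp ((lam - η) * t * z)) := by
    intro z
    by_cases hz : z ∈ B
    · rw [Set.indicator_of_mem hz]
      have h4 : Real.exp (lam * t * z) ≤ c₁ := by
        rw [hc₁, Real.exp_le_exp]
        have h5 : |lam| * (t * |z - y * x|) ≤ |lam| * (t * (δ * x)) := by
          have : |z - y * x| < δ * x := hz
          gcongr
        have h6 : lam * (t * (z - y * x)) ≤ |lam| * (t * |z - y * x|) := by
          refine (le_abs_self _).trans ?_
          rw [abs_mul, abs_mul, abs_of_nonneg ht]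
        rw [← htx]
        linarith
      have : 0 ≤ c₂ * Real.exp ((lam + η) * t * z) + c₃ * Real.exp ((lam - η) * t * z) := by
        positivity
      linarith
    · rw [Set.indicator_of_notMem hz, zero_add]
      have hz' : δ * x ≤ |z - y * x| := not_lt.1 hz
      rw [hc₂, hc₃, ← Real.exp_add, ← Real.exp_add]
      rcases le_abs.1 hz' with h4 | h4
      · have h5 : lam * t * z ≤ -(η * (y + δ) * b) + (lam + η) * t * z := by
          have : 0 ≤ η * (t * (z - y * x - δ * x)) :=
            mul_nonneg hη0.le (mul_nonneg ht (by linarith))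
          rw [← htx]; linarith
        have := Real.exp_le_exp.2 h5
        have := Real.exp_pos (η * (y - δ) * b + (lam - η) * t * z)
        linarith
      · have h5 : lam * t * z ≤ η * (y - δ) * b + (lam - η) * t * z := by
          have : 0 ≤ η * (t * (-(z - y * x) - δ * x)) :=
            mul_nonneg hη0.le (mul_nonneg ht (by linarith))
          rw [← htx]; linarith
        have := Real.exp_le_exp.2 h5
        have := Real.exp_pos (-(η * (y + δ) * b) + (lam + η) * t * z)
        linarith
  have hi1 : Integrable (B.indicator fun _ => c₁) ν := (integrable_const c₁).indicator hBm
  have hi2 := (hint ((lam + η) * t)).const_mul c₂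
  have hi3 := (hint ((lam - η) * t)).const_mul c₃
  have hmono := integral_mono (hint (lam * t)) (hi1.add (hi2.add hi3)) hpt
  rw [integral_add' hi1 (hi2.add hi3), integral_add' hi2 hi3, integral_const_mul,
    integral_const_mul, hΛ, hΛ, hΛ, integral_indicator_const _ hBm, smul_eq_mul] at hmono
  have hq2 : c₂ * Real.exp (Λ ((lam + η) * t)) ≤ 1 / 4 * Real.exp (Λ (lam * t)) := by
    refine le_trans ?_ (mul_le_mul_of_nonneg_right hsmall (Real.exp_pos _).le)
    rw [hc₂, ← Real.exp_add, ← Real.exp_add, Real.exp_le_exp]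
    have e : -(η * (y + δ) * b) + (lam + η) ^ 2 * s / 2 * b =
        lam ^ 2 * s / 2 * b - δ ^ 2 / (2 * s) * b := by
      rw [hy, hδη]; field_simp; ring
    nlinarith
  have hq3 : c₃ * Real.exp (Λ ((lam - η) * t)) ≤ 1 / 4 * Real.exp (Λ (lam * t)) := by
    refine le_trans ?_ (mul_le_mul_of_nonneg_right hsmall (Real.exp_pos _).le)
    rw [hc₃, ← Real.exp_add, ← Real.exp_add, Real.exp_le_exp]
    have e : η * (y - δ) * b + (lam - η) ^ 2 * s / 2 * b =
        lam ^ 2 * s / 2 * b - δ ^ 2 / (2 * s) * b := by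
      rw [hy, hδη]; field_simp; ring
    nlinarith
  have hfin : 1 / 2 * Real.exp (Λ (lam * t)) ≤ ν.real B * c₁ := by linarith
  have hc₁0 : 0 < c₁ := Real.exp_pos _
  rw [← div_le_iff₀ hc₁0] at hfin
  refine le_trans ?_ hfin
  rw [mul_div_assoc (1 / 2 : ℝ), hc₁, ← Real.exp_sub]
  gcongr
  have e1 : |y| / s = |lam| := by rw [hlam, abs_div, abs_of_pos hs]
  have e2 : |y| * δ / s = |lam| * δ := by rw [← e1]; ring
  have e3 : y ^ 2 / (2 * s) = lam * y - lam ^ 2 * s / 2 := by rw [hlam]; field_simp; ring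
  rw [e2, e3]
  linarith

/-! ### Deviations of the sum of the blocks and of the remaining variables -/

variable {Ω : Type*} {mΩ : MeasurableSpace Ω} {μ : Measure Ω} [IsProbabilityMeasure μ]
  {ℱ : ℕ → MeasurableSpace Ω} {ξ : ℕ → Ω → ℝ} {c g r : ℝ}

/-- A sum over `k` blocks of length `L` with gaps of length `d`, and a remainder of length `e`. -/
lemma truncSum_mul_add (ξ : ℕ → Ω → ℝ) (M : ℝ) (L d k e : ℕ) (ω : Ω) :
    truncSum ξ M 0 (k * (L + d) + e) ω = blockSum ξ M 0 (L + d) L k ω +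
      blockSum ξ M L (L + d) d k ω + truncSum ξ M (k * (L + d)) e ω := by
  rw [truncSum_add, zero_add]
  congr 1
  unfold blockSum
  rw [← Finset.sum_add_distrib]
  induction k with
  | zero => simp [truncSum]
  | succ k ih =>
    rw [Finset.sum_range_succ, ← ih, add_mul, one_mul, truncSum_add, zero_add, truncSum_add,
      add_comm (k * (L + d)) L]

/-- The probability that the truncation changes the sum of the first `n` variables. -/
lemma StretchedMixing.measureReal_sum_ne_truncSum_le (H : StretchedMixing μ ℱ ξ c g r) {D : ℝ}
    (hD : 0 < D) (n : ℕ) :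
    μ.real {ω | ∑ i ∈ Finset.range n, ξ i ω ≠ truncSum ξ (D ^ r) 0 n ω} ≤
      n * Real.exp (1 - D) := by
  have hsub : {ω | ∑ i ∈ Finset.range n, ξ i ω ≠ truncSum ξ (D ^ r) 0 n ω} ⊆
      ⋃ i ∈ Finset.range n, {ω | D ^ r < |ξ i ω|} := by
    intro ω hω
    by_contra hcon
    simp only [Set.mem_iUnion, not_exists] at hcon
    refine hω (Finset.sum_congr rfl fun i hi => ?_)
    rw [zero_add, clip_of_abs_le (not_lt.1 (hcon i hi))]
  refine (measureReal_mono hsub (measure_ne_top _ _)).trans ((measureReal_biUnion_finset_le _ _).trans ?_)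
  refine (Finset.sum_le_sum fun i _ => H.tail i D hD).trans ?_
  simp

variable {s₂ V : ℝ} {b D : ℕ → ℝ} {L d : ℕ → ℕ}

lemma BlockRegime.exp_mixing_le (R : BlockRegime μ ξ g r s₂ V b D L d) (hc : 0 < c) (K : ℝ) :
    ∀ᶠ n : ℕ in atTop, n * Real.exp (-c * (d n : ℝ) ^ g) ≤ Real.exp (-K * b n) := by
  filter_upwards [R.exp_le c K hc, R.D_le] with n h1 h2
  refine le_trans ?_ h1
  gcongr n * Real.exp ?_
  nlinarith

/-- Sums of blocks that contain in total a small proportion of the `n` variables are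
superexponentially small at the scale `√(n b n)`. -/
lemma BlockRegime.short_blocks (R : BlockRegime μ ξ g r s₂ V b D L d)
    (H : StretchedMixing μ ℱ ξ c g r) (hb : Tendsto b atTop atTop) (hV : 0 < V) {δ K s : ℝ}
    (hδ : 0 < δ) (hK : 0 < K) (hs : |s| = 1) :
    ∃ ε > 0, ∀ᶠ n : ℕ in atTop, ∀ k l m P : ℕ, l ≤ L n + d n → l + d n ≤ P → k ≤ n →
      (k * l : ℝ) ≤ ε * n →
      μ.real {ω | δ * √(n * b n) ≤ s * blockSum ξ (D n ^ r) m P l k ω} ≤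
        Real.exp (-K * b n) := by
  -- Chernoff's bound with the parameter `Λ b / x` gives `exp(-(K + 2) b)`, up to the log-Laplace
  -- transforms; these contribute at most `b + 1` when the blocks contain few variables
  set Λ := 2 * (K + 2) / δ with hΛ
  have hΛ0 : 0 < Λ := by positivity
  have hΛδ : Λ * (δ / 2) = K + 2 := by rw [hΛ]; field_simp
  refine ⟨min 1 (1 / (2 * V * Λ ^ 2)), by positivity, ?_⟩
  filter_upwards [R.crude Λ 1 one_pos, R.one_le_D, R.one_le_gap, R.exp_mixing_le H.c_pos (K + 1),
    hb.eventually_ge_atTop 2, eventually_gt_atTop 0,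
    tendsto_natCast_atTop_atTop.eventually_ge_atTop ((2 / δ) ^ 2)]
    with n h1 h2 h3 h4 h5 h6 h7 k l m P hl hP hk hkl
  set x := √(n * b n) with hx
  have hn : (0 : ℝ) < n := by exact_mod_cast h6
  have hx0 : 0 < x := Real.sqrt_pos.2 (by positivity)
  have hxx : x * x = n * b n := Real.mul_self_sqrt (by positivity)
  have hx2 : 2 / δ ≤ x := by
    rw [hx]; refine Real.le_sqrt_of_sq_le ?_; nlinarith
  have hM : 0 ≤ D n ^ r := Real.rpow_nonneg (by linarith) _
  have hkn : (k : ℝ) ≤ n := by exact_mod_cast hk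
  have hu : |Λ * (b n / x) * s| ≤ Λ * (b n / x) := by
    rw [abs_mul, hs, mul_one, abs_of_nonneg (by positivity)]
  have hu2 : (Λ * (b n / x) * s) ^ 2 * n = Λ ^ 2 * b n := by
    have : s ^ 2 = 1 := by rw [← sq_abs, hs, one_pow]
    have : (Λ * (b n / x) * s) ^ 2 = Λ ^ 2 * (b n ^ 2 / (x * x)) * s ^ 2 := by field_simp
    rw [this, hxx]; field_simp; linarith
  have hlap : ∀ i, logLaplace μ ξ (D n ^ r) (Λ * (b n / x) * s) (m + i * P) l ≤
      (Λ * (b n / x) * s) ^ 2 * l * (2 * V) + 1 / n := fun i => by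
    rcases Nat.eq_zero_or_pos l with rfl | hl0
    · simp [logLaplace, expMoment, truncSum]
    · exact h1 l _ _ hl0 hl hu
  refine (H.measureReal_le_mul_blockSum_le hM (m := m) h3 hP k
    (show 0 < δ / 2 * x by positivity) hs (show 0 ≤ Λ * (b n / x) by positivity)).trans ?_
  have hsum : ∑ i ∈ Finset.range k, logLaplace μ ξ (D n ^ r) (Λ * (b n / x) * s) (m + i * P) l ≤
      b n + 1 := by
    refine (Finset.sum_le_sum fun i _ => hlap i).trans ?_
    rw [Finset.sum_const, Finset.card_range, nsmul_eq_mul, mul_add]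
    refine add_le_add ?_ ?_
    · calc (k : ℝ) * ((Λ * (b n / x) * s) ^ 2 * l * (2 * V))
          = (k * l) * ((Λ * (b n / x) * s) ^ 2 * (2 * V)) := by ring
        _ ≤ (1 / (2 * V * Λ ^ 2) * n) * ((Λ * (b n / x) * s) ^ 2 * (2 * V)) :=
          mul_le_mul_of_nonneg_right (hkl.trans (by gcongr; exact min_le_right _ _))
            (by positivity)
        _ = (1 / (2 * V * Λ ^ 2)) * (2 * V) * ((Λ * (b n / x) * s) ^ 2 * n) := by ring
        _ = b n := by rw [hu2]; field_simp
    · rw [mul_one_div, div_le_one hn]; exact hkn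
  have hux : Λ * (b n / x) * (δ * x - δ / 2 * x) = (K + 2) * b n := by
    rw [← hΛδ]; field_simp; ring
  have hhalf : Real.exp (-(K + 1) * b n) ≤ 1 / 4 * Real.exp (-K * b n) := by
    have e : Real.exp (-(K + 1) * b n) = Real.exp (-b n) * Real.exp (-K * b n) := by
      rw [← Real.exp_add]; congr 1; ring
    rw [e]
    gcongr
    have h8 : 4 ≤ Real.exp (b n) := by
      have h9 : Real.exp 2 = Real.exp 1 * Real.exp 1 := by rw [← Real.exp_add]; norm_num
      have h10 := Real.exp_le_exp.2 h5
      nlinarith [Real.exp_one_gt_d9]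
    rw [Real.exp_neg, inv_eq_one_div]
    exact one_div_le_one_div_of_le (by norm_num) h8
  have hE1 : Real.exp (∑ i ∈ Finset.range k,
      logLaplace μ ξ (D n ^ r) (Λ * (b n / x) * s) (m + i * P) l -
        Λ * (b n / x) * (δ * x - δ / 2 * x)) ≤ 3 / 4 * Real.exp (-K * b n) := by
    rw [hux]
    calc _ ≤ Real.exp (1 + -(K + 1) * b n) := by rw [Real.exp_le_exp]; linarith
      _ = Real.exp 1 * Real.exp (-(K + 1) * b n) := Real.exp_add _ _
      _ ≤ 3 * (1 / 4 * Real.exp (-K * b n)) := by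
        gcongr; linarith [Real.exp_one_lt_d9]
      _ = _ := by ring
  have hE2 : (k * l : ℝ) * ((δ / 2 * x)⁻¹ * Real.exp (-c * (d n : ℝ) ^ g)) ≤
      1 / 4 * Real.exp (-K * b n) := by
    have h8 : (δ / 2 * x)⁻¹ ≤ 1 := by
      refine inv_le_one_of_one_le₀ ?_
      have := mul_le_mul_of_nonneg_left hx2 (show 0 ≤ δ / 2 by positivity)
      have e : δ / 2 * (2 / δ) = 1 := by field_simp
      linarith
    have h9 : (k * l : ℝ) ≤ n := hkl.trans (by
      have := min_le_left 1 (1 / (2 * V * Λ ^ 2)); nlinarith)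
    calc (k * l : ℝ) * ((δ / 2 * x)⁻¹ * Real.exp (-c * (d n : ℝ) ^ g))
        ≤ n * (1 * Real.exp (-c * (d n : ℝ) ^ g)) := by gcongr
      _ ≤ Real.exp (-(K + 1) * b n) := by rw [one_mul]; exact h4
      _ ≤ _ := hhalf
  linarith

/-- The sum of the log-Laplace transforms of the long blocks is asymptotically quadratic. -/
lemma BlockRegime.abs_sum_logLaplace_sub_le (R : BlockRegime μ ξ g r s₂ V b D L d)
    (hb : Tendsto b atTop atTop) (hs₂ : 0 < s₂) (v : ℝ) {ε : ℝ} (hε : 0 < ε) :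
    ∀ᶠ n : ℕ in atTop,
      |∑ i ∈ Finset.range (n / (L n + d n)),
        logLaplace μ ξ (D n ^ r) (v * (b n / √(n * b n))) (0 + i * (L n + d n)) (L n) -
          v ^ 2 * s₂ / 2 * b n| ≤ ε * b n := by
  obtain ⟨ε', hε', hε1⟩ : ∃ ε' : ℝ, 0 < ε' ∧ v ^ 2 / 2 * (2 * s₂ * ε' + ε') + ε' ≤ ε := by
    have : Tendsto (fun e : ℝ => v ^ 2 / 2 * (2 * s₂ * e + e) + e) (𝓝[>] 0)
        (𝓝 (v ^ 2 / 2 * (2 * s₂ * 0 + 0) + 0)) :=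
      (Continuous.tendsto (by fun_prop) 0).mono_left nhdsWithin_le_nhds
    obtain ⟨e, he, he1⟩ := ((eventually_mem_nhdsWithin (a := (0 : ℝ)) (s := Set.Ioi 0)).and
      (this.eventually_le_const (u := ε) (by simpa using hε))).exists
    exact ⟨e, he, he1⟩
  filter_upwards [R.sharp |v| ε' hε', R.gap_le ε' hε', R.length_le ε' hε', R.one_le_gap,
    hb.eventually_ge_atTop 1, eventually_gt_atTop 0] with n h1 h2 h3 h4 h5 h6
  have hn : (0 : ℝ) < n := by exact_mod_cast h6
  set x := √(n * b n) with hx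
  have hx0 : 0 < x := Real.sqrt_pos.2 (by positivity)
  have hxx : x * x = n * b n := Real.mul_self_sqrt (by positivity)
  set u := v * (b n / x) with hu
  have hu2 : u ^ 2 * n = v ^ 2 * b n := by
    have : u ^ 2 = v ^ 2 * (b n ^ 2 / (x * x)) := by rw [hu]; field_simp
    rw [this, hxx]; field_simp
  set k := n / (L n + d n) with hk
  have hkP : k * (L n + d n) + n % (L n + d n) = n := by
    rw [hk, mul_comm]; exact Nat.div_add_mod _ _
  have hkPr : (k : ℝ) * (L n + d n) + (n % (L n + d n) : ℕ) = n := by exact_mod_cast hkP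
  have hmod : ((n % (L n + d n) : ℕ) : ℝ) ≤ ε' * n := by
    refine le_trans ?_ h3
    exact_mod_cast (Nat.mod_lt n (by omega)).le
  have hkL : (k : ℝ) * L n ≤ n := by
    have : (0 : ℝ) ≤ k * d n + (n % (L n + d n) : ℕ) := by positivity
    linarith
  have hkL' : n - 2 * ε' * n ≤ (k : ℝ) * L n := by
    have h7 : (k : ℝ) * d n ≤ k * (ε' * L n) := by gcongr
    have h8 : ε' * (k * L n : ℝ) ≤ ε' * n := by gcongr
    linarith
  have hkn : (k : ℝ) ≤ n := by exact_mod_cast Nat.div_le_self _ _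
  have hsum : |∑ i ∈ Finset.range k, logLaplace μ ξ (D n ^ r) u (0 + i * (L n + d n)) (L n) -
      k * (u ^ 2 / 2 * L n * s₂)| ≤ k * (u ^ 2 / 2 * L n * ε' + ε' / n) := by
    have e : ∑ i ∈ Finset.range k, logLaplace μ ξ (D n ^ r) u (0 + i * (L n + d n)) (L n) -
        k * (u ^ 2 / 2 * L n * s₂) = ∑ i ∈ Finset.range k,
          (logLaplace μ ξ (D n ^ r) u (0 + i * (L n + d n)) (L n) - u ^ 2 / 2 * L n * s₂) := by
      rw [Finset.sum_sub_distrib, Finset.sum_const, Finset.card_range, nsmul_eq_mul]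
    rw [e]
    refine (Finset.abs_sum_le_sum_abs _ _).trans ?_
    refine (Finset.sum_le_sum fun i _ => h1 (0 + i * (L n + d n)) u (le_of_eq ?_)).trans ?_
    · rw [hu, abs_mul, abs_of_nonneg (show 0 ≤ b n / x by positivity)]
    · rw [Finset.sum_const, Finset.card_range, nsmul_eq_mul]
  have hA : u ^ 2 / 2 * (k * L n * s₂) ≤ v ^ 2 * s₂ / 2 * b n := by
    have : u ^ 2 / 2 * (k * L n * s₂) ≤ u ^ 2 / 2 * (n * s₂) := by gcongr
    linarith [congrArg (fun z => z * (s₂ / 2)) hu2]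
  have hA' : v ^ 2 * s₂ / 2 * b n - v ^ 2 / 2 * (2 * s₂ * ε') * b n ≤
      u ^ 2 / 2 * (k * L n * s₂) := by
    have h7 : u ^ 2 / 2 * ((n - 2 * ε' * n) * s₂) ≤ u ^ 2 / 2 * (k * L n * s₂) := by gcongr
    have h8 : u ^ 2 / 2 * ((n - 2 * ε' * n) * s₂) =
        (u ^ 2 * n) * (s₂ / 2 - ε' * s₂) := by ring
    rw [h8, hu2] at h7
    linarith
  have hB : (k : ℝ) * (u ^ 2 / 2 * L n * ε' + ε' / n) ≤ v ^ 2 / 2 * ε' * b n + ε' * b n := by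
    have h7 : u ^ 2 / 2 * (k * L n * ε') ≤ u ^ 2 / 2 * (n * ε') := by gcongr
    have h8 : u ^ 2 / 2 * (n * ε') = (u ^ 2 * n) * (ε' / 2) := by ring
    rw [h8, hu2] at h7
    have h9 : (k : ℝ) * (ε' / n) ≤ ε' * b n := by
      calc (k : ℝ) * (ε' / n) ≤ n * (ε' / n) := by gcongr
        _ = ε' * 1 := by field_simp
        _ ≤ ε' * b n := by gcongr
    linarith
  have hC : (v ^ 2 / 2 * (2 * s₂ * ε' + ε') + ε') * b n ≤ ε * b n := by gcongr
  have hs := abs_le.1 hsum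
  have hv0 : 0 ≤ v ^ 2 / 2 * (2 * s₂ * ε') * b n := by positivity
  rw [abs_le]
  constructor <;> linarith [hs.1, hs.2]

end

section

/-! ### Deviation bounds for the partial sums -/

lemma ExpLe.of_forall_lt {b f : ℕ → ℝ} {κ : ℝ} (h : ∀ κ' < κ, ExpLe b f κ') : ExpLe b f κ := by
  intro ε hε
  filter_upwards [h (κ - ε / 2) (by linarith) (ε / 2) (by positivity)] with n h1
  refine h1.trans (le_of_eq ?_)
  congr 1; ring

lemma ExpLe.of_eventually_le {b f : ℕ → ℝ} {κ : ℝ} (hb : Tendsto b atTop atTop)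
    (h : ∀ᶠ n in atTop, f n ≤ Real.exp (-κ * b n)) : ExpLe b f κ := by
  intro ε hε
  filter_upwards [h, hb.eventually_ge_atTop 0] with n h1 h2
  refine h1.trans (Real.exp_le_exp.2 ?_)
  nlinarith

variable {Ω : Type*} {mΩ : MeasurableSpace Ω} {μ : Measure Ω} [IsProbabilityMeasure μ]
  {ℱ : ℕ → MeasurableSpace Ω} {ξ : ℕ → Ω → ℝ} {c g r : ℝ} {s₂ V : ℝ} {b D : ℕ → ℝ} {L d : ℕ → ℕ}

/-- The gaps, the last incomplete block and the truncation are negligible at the scale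
`√(n b n)`. -/
lemma BlockRegime.expLe_sub_blockSum (R : BlockRegime μ ξ g r s₂ V b D L d)
    (H : StretchedMixing μ ℱ ξ c g r) (hb : Tendsto b atTop atTop) (hV : 0 < V) {δ K s : ℝ}
    (hδ : 0 < δ) (hK : 0 < K) (hs : |s| = 1) :
    ExpLe b (fun n => μ.real {ω | δ * √(n * b n) ≤ s * (∑ i ∈ Finset.range n, ξ i ω -
      blockSum ξ (D n ^ r) 0 (L n + d n) (L n) (n / (L n + d n)) ω)}) K := by
  obtain ⟨ε, hε, hshort⟩ := R.short_blocks H hb hV (half_pos hδ) hK hs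
  have hgap : ExpLe b (fun n => μ.real {ω | δ / 2 * √(n * b n) ≤
      s * blockSum ξ (D n ^ r) (L n) (L n + d n) (d n) (n / (L n + d n)) ω}) K := by
    refine ExpLe.of_eventually_le hb ?_
    filter_upwards [hshort, R.gap_le (min 1 ε) (by positivity)] with n h1 h2
    have h3 : (d n : ℝ) ≤ L n := h2.trans (mul_le_of_le_one_left (by positivity) (min_le_left _ _))
    have h4 : d n ≤ L n := by exact_mod_cast h3
    refine h1 _ _ _ _ (by omega) (by omega) (Nat.div_le_self _ _) ?_
    have h5 : ((n / (L n + d n) : ℕ) : ℝ) * L n ≤ n := by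
      have : n / (L n + d n) * L n ≤ n :=
        (Nat.mul_le_mul_left _ (Nat.le_add_right _ _)).trans (Nat.div_mul_le_self _ _)
      exact_mod_cast this
    calc ((n / (L n + d n) : ℕ) : ℝ) * d n ≤ (n / (L n + d n) : ℕ) * (ε * L n) := by
          gcongr; exact h2.trans (by gcongr; exact min_le_right _ _)
      _ = ε * ((n / (L n + d n) : ℕ) * L n) := by ring
      _ ≤ ε * n := by gcongr
  have hrest : ExpLe b (fun n => μ.real {ω | δ / 2 * √(n * b n) ≤
      s * truncSum ξ (D n ^ r) (n / (L n + d n) * (L n + d n)) (n % (L n + d n)) ω}) K := by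
    refine ExpLe.of_eventually_le hb ?_
    filter_upwards [hshort, R.length_le ε hε, R.one_le_gap, eventually_gt_atTop 0]
      with n h1 h2 h3 h4
    have h5 : n % (L n + d n) ≤ L n + d n := (Nat.mod_lt n (by omega)).le
    have h6 : ((n % (L n + d n) : ℕ) : ℝ) ≤ L n + d n := by exact_mod_cast h5
    have := h1 1 (n % (L n + d n)) (n / (L n + d n) * (L n + d n)) (n % (L n + d n) + d n) h5
      le_rfl h4 (by simpa using h6.trans h2)
    simpa [blockSum] using this
  have htr : ExpLe b (fun n => μ.real {ω | ∑ i ∈ Finset.range n, ξ i ω ≠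
      truncSum ξ (D n ^ r) 0 n ω}) K := by
    refine ExpLe.of_eventually_le hb ?_
    filter_upwards [R.exp_le 1 (K + 1) one_pos, R.one_le_D, hb.eventually_ge_atTop 1]
      with n h1 h2 h3
    refine (H.measureReal_sum_ne_truncSum_le (by linarith) n).trans ?_
    calc (n : ℝ) * Real.exp (1 - D n) = Real.exp 1 * (n * Real.exp (-1 * D n)) := by
          rw [sub_eq_add_neg, Real.exp_add, neg_one_mul]; ring
      _ ≤ Real.exp 1 * Real.exp (-(K + 1) * b n) := by gcongr
      _ ≤ Real.exp (-K * b n) := by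
        rw [← Real.exp_add, Real.exp_le_exp]; linarith
  refine ((hgap.add hb hrest).add hb htr).mono (Eventually.of_forall fun n => ?_)
  refine le_trans (measureReal_mono ?_ (measure_ne_top _ _))
    ((measureReal_union_le _ _).trans (add_le_add (measureReal_union_le _ _) le_rfl))
  intro ω hω
  by_contra hcon
  simp only [Set.mem_union, Set.mem_ofPred_eq, not_or, not_le, not_not] at hcon hω
  obtain ⟨⟨h1, h2⟩, h3⟩ := hcon
  -- if the truncation has no effect, the difference consists of the gaps and of the incomplete block
  have hdec := truncSum_mul_add ξ (D n ^ r) (L n) (d n) (n / (L n + d n)) (n % (L n + d n)) ω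
  have hn : n / (L n + d n) * (L n + d n) + n % (L n + d n) = n := by
    rw [mul_comm]; exact Nat.div_add_mod _ _
  rw [hn] at hdec
  rw [h3, hdec] at hω
  linarith

/-- Upper bound for the moderate deviations of the sum of the blocks, by Chernoff's bound with the
optimal parameter `y b / (s₂ x)`, where `x = √(n b n)`. -/
lemma BlockRegime.expLe_blockSum (R : BlockRegime μ ξ g r s₂ V b D L d)
    (H : StretchedMixing μ ℱ ξ c g r) (hb : Tendsto b atTop atTop) (hs₂ : 0 < s₂) {y s : ℝ}
    (hy : 0 < y) (hs : |s| = 1) :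
    ExpLe b (fun n => μ.real {ω | y * √(n * b n) ≤
      s * blockSum ξ (D n ^ r) 0 (L n + d n) (L n) (n / (L n + d n)) ω}) (y ^ 2 / (2 * s₂)) := by
  refine ExpLe.of_forall_lt fun κ' hκ' => ?_
  obtain ⟨δ, hδ, hδκ⟩ : ∃ δ, 0 < δ ∧ κ' ≤ y ^ 2 / (2 * s₂) - y * δ / s₂ := by
    refine ⟨(y ^ 2 / (2 * s₂) - κ') * s₂ / y,
      div_pos (mul_pos (sub_pos.2 hκ') hs₂) hy, le_of_eq ?_⟩
    field_simp; ring
  have herr : ExpLe b (fun n => ((n / (L n + d n) : ℕ) : ℝ) * L n *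
      ((δ * √(n * b n))⁻¹ * Real.exp (-c * (d n : ℝ) ^ g))) (y ^ 2 / (2 * s₂) - y * δ / s₂) := by
    refine ExpLe.of_eventually_le hb ?_
    filter_upwards [R.exp_mixing_le H.c_pos (y ^ 2 / (2 * s₂) - y * δ / s₂),
      hb.eventually_ge_atTop 1,
      tendsto_natCast_atTop_atTop.eventually_ge_atTop ((1 / δ) ^ 2)] with n h1 h2 h3
    refine le_trans ?_ h1
    have h4 : 1 / δ ≤ √(n * b n) := Real.le_sqrt_of_sq_le (h3.trans
      (le_mul_of_one_le_right (Nat.cast_nonneg n) h2))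
    have h5 : (δ * √(n * b n))⁻¹ ≤ 1 := by
      refine inv_le_one_of_one_le₀ ?_
      rw [div_le_iff₀ hδ] at h4
      linarith
    have h6 : ((n / (L n + d n) : ℕ) : ℝ) * L n ≤ n := by
      have : n / (L n + d n) * L n ≤ n :=
        (Nat.mul_le_mul_left _ (Nat.le_add_right _ _)).trans (Nat.div_mul_le_self _ _)
      exact_mod_cast this
    calc _ ≤ n * (1 * Real.exp (-c * (d n : ℝ) ^ g)) := by gcongr
      _ = _ := by rw [one_mul]
  have hmain : ExpLe b (fun n => Real.exp (∑ i ∈ Finset.range (n / (L n + d n)),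
      logLaplace μ ξ (D n ^ r) (y / s₂ * (b n / √(n * b n)) * s) (0 + i * (L n + d n)) (L n) -
        y / s₂ * (b n / √(n * b n)) * (y * √(n * b n) - δ * √(n * b n))))
      (y ^ 2 / (2 * s₂) - y * δ / s₂) := by
    intro ε hε
    filter_upwards [R.abs_sum_logLaplace_sub_le hb hs₂ (y / s₂ * s) hε,
      hb.eventually_ge_atTop 1, eventually_gt_atTop 0] with n h1 h2 h3
    have hn : (0 : ℝ) < n := by exact_mod_cast h3
    have hx0 : 0 < √(n * b n) := Real.sqrt_pos.2 (by positivity)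
    rw [Real.exp_le_exp]
    have e1 : y / s₂ * (b n / √(n * b n)) * (y * √(n * b n) - δ * √(n * b n)) =
        (y ^ 2 / s₂ - y * δ / s₂) * b n := by field_simp
    have e2 : (y / s₂ * s) ^ 2 * s₂ / 2 = y ^ 2 / (2 * s₂) := by
      have : s ^ 2 = 1 := by rw [← sq_abs, hs, one_pow]
      rw [mul_pow, this]; field_simp
    have e3 : y / s₂ * s * (b n / √(n * b n)) = y / s₂ * (b n / √(n * b n)) * s := by ring
    have e4 : y ^ 2 / s₂ = 2 * (y ^ 2 / (2 * s₂)) := by field_simp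
    rw [e2, e3] at h1
    rw [e1, e4]
    linarith [(abs_le.1 h1).2]
  refine ((hmain.add hb herr).anti hb hδκ).mono ?_
  filter_upwards [R.one_le_gap, R.one_le_D, hb.eventually_ge_atTop 1, eventually_gt_atTop 0]
    with n h1 h2 h3 h4
  have hn : (0 : ℝ) < n := by exact_mod_cast h4
  have hx0 : 0 < √(n * b n) := Real.sqrt_pos.2 (by positivity)
  exact H.measureReal_le_mul_blockSum_le (Real.rpow_nonneg (by linarith) _) h1 le_rfl _
    (by positivity) hs (by positivity)

/-- Upper bound for the moderate deviations of the partial sums. -/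
lemma BlockRegime.expLe_sum (R : BlockRegime μ ξ g r s₂ V b D L d)
    (H : StretchedMixing μ ℱ ξ c g r) (hb : Tendsto b atTop atTop) (hs₂ : 0 < s₂) (hV : 0 < V)
    {y s : ℝ} (hy : 0 < y) (hs : |s| = 1) :
    ExpLe b (fun n => μ.real {ω | y * √(n * b n) ≤ s * ∑ i ∈ Finset.range n, ξ i ω})
      (y ^ 2 / (2 * s₂)) := by
  refine ExpLe.of_forall_lt fun κ' hκ' => ?_
  have ht : Tendsto (fun η : ℝ => (y - η) ^ 2 / (2 * s₂)) (𝓝[>] 0)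
      (𝓝 ((y - 0) ^ 2 / (2 * s₂))) :=
    (Continuous.tendsto (by fun_prop) 0).mono_left nhdsWithin_le_nhds
  obtain ⟨η, hη, hηy, hηκ⟩ := ((eventually_mem_nhdsWithin (a := (0 : ℝ)) (s := Set.Ioi 0)).and
    ((eventually_nhdsWithin_of_eventually_nhds (eventually_lt_nhds hy)).and
      (ht.eventually_const_le (u := κ') (by simpa using hκ')))).exists
  have hη0 : 0 < η := hη
  have h1 := (R.expLe_blockSum H hb hs₂ (sub_pos.2 hηy) hs).anti hb hηκ
  have h2 := (R.expLe_sub_blockSum H hb hV hη0 (show 0 < |κ'| + 1 by positivity) hs).anti hb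
    (show κ' ≤ |κ'| + 1 by linarith [le_abs_self κ'])
  refine (h1.add hb h2).mono (Eventually.of_forall fun n => ?_)
  refine le_trans (measureReal_mono ?_ (measure_ne_top _ _)) (measureReal_union_le _ _)
  intro ω hω
  by_contra hcon
  simp only [Set.mem_union, Set.mem_ofPred_eq, not_or, not_le] at hcon hω
  linarith [hcon.1, hcon.2]

/-- Lower bound for the moderate deviations of the partial sums. -/
lemma BlockRegime.exp_le_measureReal_ball (R : BlockRegime μ ξ g r s₂ V b D L d)
    (H : StretchedMixing μ ℱ ξ c g r) (hb : Tendsto b atTop atTop) (hs₂ : 0 < s₂) (hV : 0 < V)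
    (y : ℝ) {δ ε : ℝ} (hδ : 0 < δ) (hε : 0 < ε) :
    ∀ᶠ n : ℕ in atTop, Real.exp (-(y ^ 2 / (2 * s₂) + ε) * b n) ≤
      μ.real {ω | |∑ i ∈ Finset.range n, ξ i ω - y * √(n * b n)| < δ * √(n * b n)} := by
  obtain ⟨δ₁, hδ₁, hδ3, hδε⟩ : ∃ δ₁, 0 < δ₁ ∧ 3 * δ₁ ≤ δ ∧ |y| * δ₁ / s₂ ≤ ε / 4 := by
    refine ⟨min (δ / 3) (ε * s₂ / (4 * (|y| + 1))), by positivity, ?_, ?_⟩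
    · linarith [min_le_left (δ / 3) (ε * s₂ / (4 * (|y| + 1)))]
    · rw [div_le_iff₀ hs₂]
      calc |y| * min (δ / 3) (ε * s₂ / (4 * (|y| + 1))) ≤
            (|y| + 1) * (ε * s₂ / (4 * (|y| + 1))) := by
            gcongr
            · linarith
            · exact min_le_right _ _
        _ = ε / 4 * s₂ := by field_simp
  set ε₁ := min (ε / 4) (δ₁ ^ 2 / (8 * s₂)) with hε₁
  have hε₁0 : 0 < ε₁ := by positivity
  have hρ : 0 < δ₁ ^ 2 / (2 * s₂) - 2 * ε₁ := by
    have h1 : ε₁ ≤ δ₁ ^ 2 / (8 * s₂) := min_le_right _ _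
    have h2 : δ₁ ^ 2 / (2 * s₂) = 4 * (δ₁ ^ 2 / (8 * s₂)) := by field_simp; norm_num
    have h3 : 0 < δ₁ ^ 2 / (8 * s₂) := by positivity
    linarith
  -- with this rate the errors are exponentially smaller than the main term
  set K := y ^ 2 / (2 * s₂) + 2 * ε with hK
  have hK0 : 0 < K := by positivity
  have hex : Tendsto (fun n => Real.exp (-(δ₁ ^ 2 / (2 * s₂) - 2 * ε₁) * b n)) atTop (𝓝 0) :=
    Real.tendsto_exp_atBot.comp (hb.const_mul_atTop_of_neg (neg_lt_zero.2 hρ))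
  have herr := ((R.expLe_sub_blockSum H hb hV hδ₁ hK0 (s := 1) (by simp)).add hb
    (R.expLe_sub_blockSum H hb hV hδ₁ hK0 (s := -1) (by simp))).add hb
    (ExpLe.of_eventually_le hb (R.exp_mixing_le H.c_pos K))
  filter_upwards [R.abs_sum_logLaplace_sub_le hb hs₂ (y / s₂) hε₁0,
    R.abs_sum_logLaplace_sub_le hb hs₂ (y / s₂ + δ₁ / s₂) hε₁0,
    R.abs_sum_logLaplace_sub_le hb hs₂ (y / s₂ - δ₁ / s₂) hε₁0,
    herr ε hε, hex.eventually_le_const (show (0 : ℝ) < 1 / 4 by norm_num), R.one_le_gap, R.one_le_D,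
    hb.eventually_ge_atTop 1, hb.eventually_ge_atTop (6 / ε), eventually_gt_atTop 0,
    tendsto_natCast_atTop_atTop.eventually_ge_atTop ((1 / δ₁) ^ 2)]
    with n a1 a2 a3 a4 a5 a6 a7 a8 a9 a10 a11
  have hn : (0 : ℝ) < n := by exact_mod_cast a10
  set x := √(n * b n) with hx
  have hx0 : 0 < x := Real.sqrt_pos.2 (by positivity)
  have hx1 : 1 / δ₁ ≤ x := Real.le_sqrt_of_sq_le (a11.trans
    (le_mul_of_one_le_right (Nat.cast_nonneg n) a8))
  set k := n / (L n + d n) with hk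
  have hM : 0 ≤ D n ^ r := Real.rpow_nonneg (by linarith) _
  have := H.isProbabilityMeasure_indepBlocks (D n ^ r) 0 (L n + d n) (L n) k
  have htilt := half_exp_le_measureReal_ball
    (ν := indepBlocks μ ξ (D n ^ r) 0 (L n + d n) (L n) k)
    (Λ := fun u => ∑ i ∈ Finset.range k, logLaplace μ ξ (D n ^ r) u (0 + i * (L n + d n)) (L n))
    (b := b n) (s := s₂) (t := b n / x) (x := x) (y := y) (δ := δ₁) (ε := ε₁)
    (fun u => (H.integral_exp_indepBlocks hM 0 _ _ u k).1)
    (fun u => (H.integral_exp_indepBlocks hM 0 _ _ u k).2) hs₂ (by positivity) hδ₁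
    (by field_simp) (by
      intro v hv
      simp only [Set.mem_insert_iff, Set.mem_singleton_iff] at hv
      rcases hv with rfl | rfl | rfl
      · exact a1
      · exact a2
      · exact a3) a5
  have hcmp := (H.measureReal_blockSum_le (D n ^ r) (m := 0) a6 (le_refl (L n + d n)) k
    (show 0 < δ₁ * x by positivity)
    (show MeasurableSet {z : ℝ | |z - y * x| < δ₁ * x} from
      measurableSet_lt (by fun_prop) (by fun_prop))).2
  have hkL : (k * L n : ℝ) * ((δ₁ * x)⁻¹ * Real.exp (-c * (d n : ℝ) ^ g)) ≤
      n * Real.exp (-c * (d n : ℝ) ^ g) := by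
    have h5 : (δ₁ * x)⁻¹ ≤ 1 := by
      refine inv_le_one_of_one_le₀ ?_
      rw [div_le_iff₀ hδ₁] at hx1
      linarith
    have h6 : (k : ℝ) * L n ≤ n := by
      have : k * L n ≤ n :=
        (Nat.mul_le_mul_left _ (Nat.le_add_right _ _)).trans (Nat.div_mul_le_self _ _)
      exact_mod_cast this
    calc _ ≤ n * (1 * Real.exp (-c * (d n : ℝ) ^ g)) := by gcongr
      _ = _ := by rw [one_mul]
  -- pass from the sum of the blocks in the thickened ball to the whole sum in the larger ball
  have hincl : μ.real {ω | blockSum ξ (D n ^ r) 0 (L n + d n) (L n) k ω ∈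
      Metric.thickening (δ₁ * x) {z : ℝ | |z - y * x| < δ₁ * x}} ≤
      μ.real {ω | |∑ i ∈ Finset.range n, ξ i ω - y * x| < δ * x} +
        (μ.real {ω | δ₁ * x ≤ 1 * (∑ i ∈ Finset.range n, ξ i ω -
          blockSum ξ (D n ^ r) 0 (L n + d n) (L n) k ω)} +
        μ.real {ω | δ₁ * x ≤ -1 * (∑ i ∈ Finset.range n, ξ i ω -
          blockSum ξ (D n ^ r) 0 (L n + d n) (L n) k ω)}) := by
    refine le_trans (measureReal_mono ?_ (measure_ne_top _ _)) ((measureReal_union_le _ _).trans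
      (add_le_add le_rfl (measureReal_union_le _ _)))
    intro ω hω
    obtain ⟨w, hw, hzw⟩ := Metric.mem_thickening_iff.1 hω
    rw [Real.dist_eq] at hzw
    have hw' : |w - y * x| < δ₁ * x := hw
    by_contra hcon
    simp only [Set.mem_union, Set.mem_ofPred_eq, not_or, not_le, not_lt] at hcon
    obtain ⟨h1, h2, h3⟩ := hcon
    have h4 : 3 * δ₁ * x ≤ δ * x := by gcongr
    rw [abs_lt] at hzw hw'
    rcases le_abs.1 h1 with h5 | h5 <;> linarith [hzw.1, hzw.2, hw'.1, hw'.2]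
  have hKε : K - ε = y ^ 2 / (2 * s₂) + ε := by rw [hK]; ring
  rw [hKε] at a4
  set I := y ^ 2 / (2 * s₂) with hI
  have hexp : 2 * Real.exp (-(I + ε) * b n) ≤
      1 / 2 * Real.exp (-(I + |y| * δ₁ / s₂ + ε₁) * b n) := by
    have h1 : 4 ≤ Real.exp (ε / 2 * b n) := by
      rw [div_le_iff₀ hε] at a9
      linarith [Real.add_one_le_exp (ε / 2 * b n)]
    have h2 : Real.exp (-(I + ε / 2) * b n) ≤ Real.exp (-(I + |y| * δ₁ / s₂ + ε₁) * b n) := by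
      rw [Real.exp_le_exp]
      have : ε₁ ≤ ε / 4 := min_le_left _ _
      nlinarith
    have h3 : Real.exp (-(I + ε / 2) * b n) =
        Real.exp (ε / 2 * b n) * Real.exp (-(I + ε) * b n) := by
      rw [← Real.exp_add]; congr 1; ring
    have h4 : 4 * Real.exp (-(I + ε) * b n) ≤ Real.exp (-(I + ε / 2) * b n) := by
      rw [h3]; gcongr
    linarith
  linarith

end

/-! ### The moderate deviation principle -/

lemma log_ofReal_exp (v : ℝ) : ENNReal.log (ENNReal.ofReal (Real.exp v)) = v := by
  rw [ENNReal.log_ofReal_of_pos (Real.exp_pos _), Real.log_exp]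

lemma coe_mul_coe_mul_inv {a : ℝ} (ha : 0 < a) (z : ℝ) :
    (a : EReal) * ((z * a⁻¹ : ℝ) : EReal) = z := by
  rw [← EReal.coe_mul]
  congr 1; field_simp

lemma coe_neg_ofReal {v : ℝ} (hv : 0 ≤ v) :
    -((ENNReal.ofReal v : ℝ≥0∞) : EReal) = ((-v : ℝ) : EReal) := by
  rw [EReal.coe_ennreal_ofReal, max_eq_left hv, EReal.coe_neg]

/-- The moderate deviation principle with a quadratic rate function follows from upper bounds for
the half-lines and lower bounds for the balls. -/
lemma satisfiesMDP_of_expLe {Ω : Type*} {mΩ : MeasurableSpace Ω} {μ : Measure Ω}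
    [IsProbabilityMeasure μ] {T : ℕ → Ω → ℝ} {a : ℕ → ℝ} {σ : ℝ} (hσ : 0 < σ)
    (ha : ∀ᶠ n in atTop, 0 < a n)
    (hup : ∀ y s : ℝ, 0 < y → |s| = 1 → ExpLe (fun n => (a n)⁻¹)
      (fun n => μ.real {ω | y ≤ s * (√(a n) * T n ω)}) (y ^ 2 / (2 * σ ^ 2)))
    (hb : Tendsto (fun n => (a n)⁻¹) atTop atTop)
    (hlow : ∀ y δ ε : ℝ, 0 < δ → 0 < ε → ∀ᶠ n in atTop,
      Real.exp (-(y ^ 2 / (2 * σ ^ 2) + ε) * (a n)⁻¹) ≤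
        μ.real {ω | |√(a n) * T n ω - y| < δ}) :
    SatisfiesMDP μ T a (fun t : ℝ => ENNReal.ofReal (t ^ 2 / (2 * σ ^ 2))) := by
  intro A _
  have hI : ∀ t : ℝ, 0 ≤ t ^ 2 / (2 * σ ^ 2) := fun t => by positivity
  have hm : ∀ s : Set Ω, μ s = ENNReal.ofReal (μ.real s) := fun s => (ofReal_measureReal).symm
  constructor
  -- if `z < -I(t)` for some interior point `t`, a ball around `t` is contained in the set
  · refine EReal.ge_of_forall_gt_iff_ge.1 fun z hz => ?_
    refine le_liminf_of_le (by isBoundedDefault) ?_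
    obtain ⟨t, htA, ht⟩ : ∃ t ∈ interior A, t ^ 2 / (2 * σ ^ 2) < -z := by
      by_contra! hcon
      refine absurd hz (not_lt.2 ?_)
      have h1 : ENNReal.ofReal (-z) ≤
          ⨅ t ∈ interior A, ENNReal.ofReal (t ^ 2 / (2 * σ ^ 2)) :=
        le_iInf₂ fun t ht => ENNReal.ofReal_le_ofReal (hcon t ht)
      have h2 : ((-z : ℝ) : EReal) ≤ ((ENNReal.ofReal (-z) : ℝ≥0∞) : EReal) := by
        rw [EReal.coe_ennreal_ofReal]; exact_mod_cast le_max_left _ _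
      rw [EReal.neg_le, ← EReal.coe_neg]
      exact h2.trans (by exact_mod_cast h1)
    obtain ⟨δ, hδ, hball⟩ := Metric.isOpen_iff.1 isOpen_interior t htA
    filter_upwards [hlow t δ (-z - t ^ 2 / (2 * σ ^ 2)) hδ (by linarith), ha] with n h1 h2
    have h3 : μ.real {ω | |√(a n) * T n ω - t| < δ} ≤ μ.real {ω | √(a n) * T n ω ∈ A} :=
      by
      refine measureReal_mono (fun ω hω => ?_) (measure_ne_top _ _)
      have h5 : √(a n) * T n ω ∈ interior A := hball hω
      exact interior_subset (s := A) h5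
    have h4 : Real.exp (z * (a n)⁻¹) ≤ μ.real {ω | √(a n) * T n ω ∈ A} := by
      refine le_trans (le_of_eq ?_) (h1.trans h3)
      congr 1; ring
    calc (z : EReal) = a n * ((z * (a n)⁻¹ : ℝ) : EReal) := (coe_mul_coe_mul_inv h2 z).symm
      _ ≤ _ := by
        refine mul_le_mul_of_nonneg_left ?_ (by exact_mod_cast h2.le)
        rw [← log_ofReal_exp, hm]
        exact ENNReal.log_monotone (ENNReal.ofReal_le_ofReal h4)
  · refine EReal.le_of_forall_lt_iff_le.1 fun z' hz' => ?_
    refine limsup_le_of_le (by isBoundedDefault) ?_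
    -- probabilities are at most `1`, which settles the case of a nonnegative bound
    rcases le_or_gt 0 z' with h0 | h0
    · filter_upwards [ha] with n h2
      have h3 : ENNReal.log (μ {ω | √(a n) * T n ω ∈ A}) ≤ 0 := by
        rw [← ENNReal.log_one]; exact ENNReal.log_monotone prob_le_one
      calc _ ≤ (a n : EReal) * 0 := mul_le_mul_of_nonneg_left h3 (by exact_mod_cast h2.le)
        _ = 0 := mul_zero _
        _ ≤ z' := by exact_mod_cast h0
    obtain ⟨z, hz, hzz'⟩ := EReal.lt_iff_exists_real_btwn.1 hz'
    have hzz : z < z' := by exact_mod_cast hzz'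
    -- the set lies outside `(-y, y)`, where `I(y) = -z`
    set y := √(2 * σ ^ 2 * (-z)) with hy
    have hy0 : 0 < y := Real.sqrt_pos.2 (mul_pos (by positivity) (by linarith))
    have hyI : y ^ 2 / (2 * σ ^ 2) = -z := by
      rw [hy, Real.sq_sqrt (mul_nonneg (by positivity) (by linarith))]; field_simp
    have hA : ∀ t ∈ A, y ≤ |t| := by
      intro t ht
      have h1 : (⨅ t ∈ closure A, ENNReal.ofReal (t ^ 2 / (2 * σ ^ 2))) ≤
          ENNReal.ofReal (t ^ 2 / (2 * σ ^ 2)) := iInf₂_le t (subset_closure ht)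
      have h2 : ((-(t ^ 2 / (2 * σ ^ 2)) : ℝ) : EReal) < z := by
        refine lt_of_le_of_lt ?_ hz
        rw [← coe_neg_ofReal (hI t), EReal.neg_le_neg_iff]
        exact_mod_cast h1
      have h3 : -(t ^ 2 / (2 * σ ^ 2)) < z := by exact_mod_cast h2
      rw [← Real.sqrt_sq_eq_abs]
      refine Real.sqrt_le_sqrt ?_
      have h4 : -z ≤ t ^ 2 / (2 * σ ^ 2) := by linarith
      rw [le_div_iff₀ (by positivity)] at h4
      linarith
    have hsum := (hup y 1 hy0 (by simp)).add hb (hup y (-1) hy0 (by simp))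
    filter_upwards [hsum (z' - z) (by linarith), ha] with n h1 h2
    have h3 : μ.real {ω | √(a n) * T n ω ∈ A} ≤ Real.exp (z' * (a n)⁻¹) := by
      refine le_trans (measureReal_mono ?_ (measure_ne_top _ _))
        ((measureReal_union_le _ _).trans (h1.trans (le_of_eq ?_)))
      · intro ω hω
        rcases le_abs.1 (hA _ hω) with h | h
        · left; simpa using h
        · right; simpa using h
      · rw [hyI]; congr 1; ring
    calc _ ≤ (a n : EReal) * ((z' * (a n)⁻¹ : ℝ) : EReal) := by
          refine mul_le_mul_of_nonneg_left ?_ (by exact_mod_cast h2.le)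
          rw [← log_ofReal_exp, hm]
          exact ENNReal.log_monotone (ENNReal.ofReal_le_ofReal h3)
      _ = z' := coe_mul_coe_mul_inv h2 z'

lemma isGoodRateFunction_quadratic {σ : ℝ} (hσ : 0 < σ) :
    IsGoodRateFunction (fun t : ℝ => ENNReal.ofReal (t ^ 2 / (2 * σ ^ 2))) := by
  have hc : Continuous fun t : ℝ => ENNReal.ofReal (t ^ 2 / (2 * σ ^ 2)) :=
    ENNReal.continuous_ofReal.comp (by fun_prop)
  refine ⟨hc.lowerSemicontinuous, fun r => ?_⟩
  refine Metric.isCompact_of_isClosed_isBounded (isClosed_le hc continuous_const) ?_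
  refine (Metric.isBounded_closedBall (x := (0 : ℝ)) (r := √(r * (2 * σ ^ 2)))).subset ?_
  intro t ht
  have h1 : ENNReal.ofReal (t ^ 2 / (2 * σ ^ 2)) ≤ ENNReal.ofReal r := by
    rw [ENNReal.ofReal_coe_nnreal]; exact ht
  have h2 := (ENNReal.ofReal_le_ofReal_iff r.coe_nonneg).1 h1
  rw [div_le_iff₀ (by positivity)] at h2
  rw [mem_closedBall_zero_iff, Real.norm_eq_abs, ← Real.sqrt_sq_eq_abs]
  exact Real.sqrt_le_sqrt h2

/-- The condition on the speed in terms of the quantity that governs the choice of the blocks. -/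
lemma tendsto_sqrt_rpow_div {γ : ℝ} (hγ0 : 0 < γ) (hγ1 : γ < 1) {a : ℕ → ℝ}
    (ha : ∀ᶠ n in atTop, 0 < a n)
    (h : Tendsto (fun n : ℕ => a n * (n : ℝ) ^ (γ / (2 - γ))) atTop atTop) :
    Tendsto (fun n : ℕ => √(n * (a n)⁻¹) ^ γ / (a n)⁻¹) atTop atTop := by
  have h2 : 0 < 2 - γ := by linarith
  refine ((tendsto_rpow_atTop (show 0 < (2 - γ) / 2 by positivity)).comp h).congr' ?_
  filter_upwards [ha, eventually_gt_atTop 0] with n h3 h4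
  have hn : (0 : ℝ) < n := by exact_mod_cast h4
  simp only [Function.comp]
  rw [Real.mul_rpow h3.le (by positivity), ← Real.rpow_mul hn.le, Real.sqrt_eq_rpow,
    ← Real.rpow_mul (by positivity), Real.mul_rpow hn.le (by positivity), Real.inv_rpow h3.le,
    div_inv_eq_mul, ← Real.rpow_neg h3.le]
  have e1 : γ / (2 - γ) * ((2 - γ) / 2) = 1 / 2 * γ := by field_simp
  have e2 : a n ^ ((2 - γ) / 2) = a n ^ (-(1 / 2 * γ)) * a n := by
    rw [← Real.rpow_add_one h3.ne']; congr 1; ring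
  rw [e1, e2]; ring

theorem corollary1 {Ω : Type*} {mΩ : MeasurableSpace Ω} (μ : Measure Ω) [IsProbabilityMeasure μ]
    (X : ℤ → Ω → ℝ) (hX : ∀ i, Measurable (X i))
    (hstat : SecondOrderStationary μ X) (hcent : ∀ i, ∫ ω, X i ω ∂μ = 0)
    (c γ γ₁ : ℝ) (γ₂ : ℝ≥0∞) (hc : 0 < c) (hγ₁ : 0 < γ₁) (hγ₂ : 0 < γ₂)
    (hτ : ∀ x : ℝ, 1 ≤ x → tauMix μ X ⌊x⌋₊ ≤ ENNReal.ofReal (Real.exp (-c * x ^ γ₁)))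
    (htail : TailCondition μ X γ₂)
    (hγ : 1 / γ = 1 / γ₁ + (γ₂⁻¹).toReal) (hγ_lt : γ < 1)
    (hvar : Tendsto (fun n : ℕ => variance (partialSum X n) μ) atTop atTop) :
    ∃ σ : ℝ, 0 < σ ∧
      Tendsto (fun n : ℕ => variance (partialSum X n) μ / n) atTop (𝓝 (σ ^ 2)) ∧
      IsGoodRateFunction (fun t : ℝ => ENNReal.ofReal (t ^ 2 / (2 * σ ^ 2))) ∧
      ∀ a : ℕ → ℝ, (∀ n, 1 ≤ n → 0 < a n) → Tendsto a atTop (𝓝 0) →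
        Tendsto (fun n : ℕ => a n * (n : ℝ) ^ (γ / (2 - γ))) atTop atTop →
        SatisfiesMDP μ (fun n ω => partialSum X n ω / √(n : ℝ)) a
          (fun t : ℝ => ENNReal.ofReal (t ^ 2 / (2 * σ ^ 2))) := by
  have H := stretchedMixing_of_tauMix μ X hX c γ₁ γ₂ hc hγ₁ hγ₂ hτ htail
  set ξ : ℕ → Ω → ℝ := fun i => X ((i : ℤ) + 1) with hξ
  set r := (γ₂⁻¹).toReal with hr
  have hγ0 : 0 < γ := by
    have h1 : 0 < 1 / γ := by rw [hγ]; have := H.r_nonneg; positivity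
    exact one_div_pos.1 h1
  have h0 : ∀ i, ∫ ω, ξ i ω ∂μ = 0 := fun i => hcent _
  set ρ : ℕ → ℝ := fun k => covariance (X 0) (X k) μ with hρd
  have hρ : ∀ i k, ∫ ω, ξ i ω * ξ (i + k) ω ∂μ = ρ k := fun i k => by
    have h1 := hstat.2.2 ((i : ℤ) + 1) k
    rw [covariance] at h1
    simp only [hcent, sub_zero] at h1
    simp only [hρd, hξ]
    rw [← h1]
    push_cast
    rw [add_right_comm]
  have hpart : ∀ n ω, partialSum X n ω = ∑ i ∈ Finset.range n, ξ i ω := fun n ω => by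
    unfold partialSum
    induction n with
    | zero => simp
    | succ n ih =>
      rw [Finset.sum_Icc_succ_top (by omega), ih, Finset.sum_range_succ]
      simp [hξ]
  obtain ⟨C, hC⟩ : ∃ C, TruncationBound μ ξ r C := H.exists_truncation_bound
  obtain ⟨s₂, B, hB0, hB⟩ := exists_abs_sumVar_sub_le (H.summable_covariance h0 hρ)
  have hvarS : ∀ n, variance (partialSum X n) μ = sumVar ρ n := fun n => by
    have h1 := integral_sq_sum_eq (μ := μ) H.memLp_two hρ 0 n
    simp only [zero_add] at h1
    rw [← h1, variance_of_integral_eq_zero]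
    · simp only [hpart]
    · exact (Finset.measurable_sum _ fun i _ => hX _).aemeasurable
    · simp only [hpart]
      rw [integral_finsetSum _ fun i _ => (H.memLp_two i).integrable (by norm_num)]
      exact Finset.sum_eq_zero fun i _ => h0 i
  simp only [hvarS] at hvar ⊢
  -- otherwise the variances of the partial sums would be bounded
  have hs₂ : 0 < s₂ := by
    by_contra hcon
    obtain ⟨n, hn⟩ := (hvar.eventually_gt_atTop B).exists
    have h1 := (abs_le.1 (hB n)).2
    have h2 : (n : ℝ) * s₂ ≤ 0 :=
      mul_nonpos_of_nonneg_of_nonpos (Nat.cast_nonneg n) (not_lt.1 hcon)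
    linarith
  have hσ2 : √s₂ ^ 2 = s₂ := Real.sq_sqrt hs₂.le
  refine ⟨√s₂, Real.sqrt_pos.2 hs₂, ?_, isGoodRateFunction_quadratic (Real.sqrt_pos.2 hs₂), ?_⟩
  · rw [hσ2, tendsto_iff_norm_sub_tendsto_zero]
    refine squeeze_zero' (Eventually.of_forall fun n => norm_nonneg _) ?_
      (tendsto_natCast_atTop_atTop.const_div_atTop B)
    filter_upwards [eventually_gt_atTop 0] with n hn
    have hn' : (0 : ℝ) < n := by exact_mod_cast hn
    have e : sumVar ρ n / n - s₂ = (sumVar ρ n - n * s₂) / n := by field_simp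
    rw [e, norm_div, Real.norm_eq_abs, Real.norm_of_nonneg hn'.le]
    gcongr
    exact hB n
  · intro a ha ha0 hspeed
    have ha' : ∀ᶠ n in atTop, 0 < a n := by
      filter_upwards [eventually_ge_atTop 1] with n hn using ha n hn
    have hb : Tendsto (fun n => (a n)⁻¹) atTop atTop :=
      tendsto_inv_nhdsGT_zero.comp (tendsto_nhdsWithin_iff.2 ⟨ha0, ha'⟩)
    obtain ⟨D, L, d, R⟩ := H.exists_blockRegime (V := s₂ + B + 1) h0 hC hρ hs₂ (by linarith)
      (fun l => (hB l).trans (by linarith)) hγ0 hγ_lt hγ hb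
      (tendsto_sqrt_rpow_div hγ0 hγ_lt ha' hspeed)
    have hV : 0 < s₂ + B + 1 := by linarith
    -- `√(a_n) T_n` is the partial sum divided by `√(n / a_n)`
    have hscale : ∀ᶠ n : ℕ in atTop, 0 < √(n * (a n)⁻¹) ∧ ∀ S : ℝ,
        √(a n) * (S / √(n : ℝ)) = S / √(n * (a n)⁻¹) := by
      filter_upwards [ha', eventually_gt_atTop 0] with n h1 h2
      have hn : (0 : ℝ) < n := by exact_mod_cast h2
      refine ⟨Real.sqrt_pos.2 (by positivity), fun S => ?_⟩
      have h3 : 0 < √(a n) := Real.sqrt_pos.2 h1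
      rw [Real.sqrt_mul hn.le, Real.sqrt_inv]
      field_simp
    refine satisfiesMDP_of_expLe (Real.sqrt_pos.2 hs₂) ha' (fun y s hy hs => ?_) hb
      (fun y δ ε hδ hε => ?_)
    · rw [hσ2]
      refine (R.expLe_sum H hb hs₂ hV hy hs).mono ?_
      filter_upwards [hscale] with n hn
      refine measureReal_mono (fun ω hω => ?_) (measure_ne_top _ _)
      have h1 : y ≤ s * (√(a n) * (partialSum X n ω / √(n : ℝ))) := hω
      rw [hn.2, hpart, ← mul_div_assoc, le_div_iff₀ hn.1] at h1
      exact h1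
    · rw [hσ2]
      filter_upwards [R.exp_le_measureReal_ball H hb hs₂ hV y hδ hε, hscale] with n h1 hn
      refine h1.trans (measureReal_mono (fun ω hω => ?_) (measure_ne_top _ _))
      have h2 : |∑ i ∈ Finset.range n, ξ i ω - y * √(n * (a n)⁻¹)| < δ * √(n * (a n)⁻¹) := hω
      show |√(a n) * (partialSum X n ω / √(n : ℝ)) - y| < δ
      have e : (∑ i ∈ Finset.range n, ξ i ω) / √(n * (a n)⁻¹) - y =
          (∑ i ∈ Finset.range n, ξ i ω - y * √(n * (a n)⁻¹)) / √(n * (a n)⁻¹) := by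
        rw [sub_div, mul_div_cancel_right₀ _ hn.1.ne']
      rw [hn.2, hpart, e, abs_div, abs_of_pos hn.1, div_lt_iff₀ hn.1]
      exact h2
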